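/- **Lemma (Consistency of the divergence term).** Let $1\le d\le 3$, let $\Omega\subset\mathbb R^d$ be an open bounded polyhedral set, $T>0$, and $\zeta=2d$. *Meshes.* A mesh $\mathcal M$ of $\Omega$ is a finite family of compact connected cells $K$ (intervals, quadrangles or hexahedra, according to $d=1,2,3$) with pairwise disjoint interiors, whose union is $\overline\Omega$; the boundary of $K$ is the union of its $\zeta$ faces $\sigma\in\mathcal E(K)$, which are compact non-degenerate parts of hyperplanes with unit normal $n_{K,\sigma}$ outward $K$. The mesh is conforming: distinct faces overlap at most on a set of zero $(d-1)$-dimensional measure. A face $\sigma$ is internal, written $\sigma=K|L$, if it is a face of two distinct cells $K$ and $L$; otherwise it is external. Write $|\cdot|$ for the $d$- or $(d-1)$-dimensional Lebesgue measure, $h_K$ for the diameter of $K$, $h_{\mathcal M}=\max_K h_K$, and $$\theta_{\mathcal M,1}=\max_{\sigma=K|L}\max\Bigl\{\frac{|K|}{|L|},\frac{|L|}{|K|}\Bigr\},\qquad \theta_{\mathcal M,2}=\max_{K}\Bigl\{\frac{\sum_{\sigma'\in\mathcal E(K)}|\sigma'|}{|K|}\max_{\sigma=K|L\in\mathcal E(K)}(h_K+h_L)\Bigr\}.$$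 Each cell $K$ is divided, up to null sets, into measurable half-diamond cells $D_{K,\sigma}\subset K$, $\sigma\in\mathcal E(K)$, with $|D_{K,\sigma}|=|K|/\zeta$; the dual cell $D_\sigma$ is $D_{K,\sigma}\cup D_{L,\sigma}$ if $\sigma=K|L$, and $D_{K,\sigma}$ if $\sigma$ is an external face of $K$. The faces of $K$ correspond to those of the reference segment, square or cube, and inside $K$ there is one dual face $\epsilon=\sigma|\sigma'$ between $D_{K,\sigma}$ and $D_{K,\sigma'}$ for each pair of distinct non-opposite faces of $K$ if $d\ge2$, and for the two end points of $K$ if $d=1$. Denote by $\mathcal E(D_\sigma)$ the set of the dual faces $\epsilon=\sigma|\sigma'$ so obtained (in the one or two cells adjacent to $\sigma$). *Discrete unknowns and fluxes.* Let $N\ge1$, $\delta t=T/N$, $t_n=n\,\delta t$. Given reals $\rho_K^n$ and $z_\sigma^n$ and vectors $u_\sigma^n\in\mathbb R^d$, let $\rho_\sigma^n$ be a convex combination of $\rho_K^n$ and $\rho_L^n$ for $\sigma=K|L$, and let $z_\epsilon^n$ be a convex combination of $z_\sigma^n$ and $z_{\sigma'}^n$ for $\epsilon=\sigma|\sigma'$.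 The primal mass flux is $F_{K,\sigma}^n=|\sigma|\,\rho_\sigma^n\,u_\sigma^n\cdot n_{K,\sigma}$ if $\sigma$ is internal, and $0$ if $\sigma$ is external. The dual mass fluxes are, for $\epsilon\subset K$, $\epsilon\in\mathcal E(D_\sigma)$, of the form $F_{\sigma,\epsilon}^n=\sum_{\sigma'\in\mathcal E(K)}\xi_{\sigma,\epsilon,\sigma'}F^n_{K,\sigma'}$, where the real coefficients $\xi$ depend only on the corresponding faces of the reference cell (neither on $K$, nor on the mesh, nor on $n$); they are assumed to be conservative, $F_{\sigma,\epsilon}^n=-F_{\sigma',\epsilon}^n$ for $\epsilon=\sigma|\sigma'$, and to satisfy, for all $K$ and $\sigma\in\mathcal E(K)$, $$F_{K,\sigma}^n+\sum_{\epsilon\in\mathcal E(D_\sigma),\,\epsilon\subset K}F_{\sigma,\epsilon}^n=\frac1\zeta\sum_{\sigma'\in\mathcal E(K)}F_{K,\sigma'}^n .$$ The fluxes of the convection operator reconstructed on the primal mesh are $$G_{K,\sigma}^n=-\frac12\sum_{\epsilon\in\mathcal E(D_\sigma),\,\epsilon\subset K}F_{\sigma,\epsilon}^n z_\epsilon^n+\frac12\sum_{\epsilon\in\mathcal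 E(D_\sigma),\,\epsilon\not\subset K}F_{\sigma,\epsilon}^n z_\epsilon^n .$$ *Statement.* Let $\theta>0$ and let $(\mathcal M^{(m)})_{m\in\mathbb N}$ be a sequence of meshes of $\Omega$ such that $\max(\theta_{\mathcal M^{(m)},1},\theta_{\mathcal M^{(m)},2})\le\theta$ for all $m$ and $h_{\mathcal M^{(m)}}\to0$. Let $N^{(m)}\ge 1$ be such that $\delta t^{(m)}=T/N^{(m)}\to0$. For each $m$ let discrete unknowns and fluxes as above be given, the coefficients $\xi$ being independent of $m$, and let $$\rho^{(m)}=\sum_{n=0}^{N^{(m)}-1}\sum_{K}\rho_K^n\,1_{K\times[t_n,t_{n+1})},\quad z^{(m)}=\sum_{n=0}^{N^{(m)}-1}\sum_{\sigma}z_\sigma^n\,1_{D_\sigma\times[t_n,t_{n+1})},\quad u^{(m)}=\sum_{n=0}^{N^{(m)}-1}\sum_{\sigma}u_\sigma^n\,1_{D_\sigma\times[t_n,t_{n+1})}.$$ Suppose that $\rho^{(m)}\to\bar\rho$ and $z^{(m)}\to\bar z$ in $L^1(\Omega\times(0,T))$ and $u^{(m)}\to\bar u$ in $L^1(\Omega\times(0,T))^d$,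 and that these three sequences are bounded in $L^\infty$. Let $\varphi\in C_c^\infty(\Omega\times[0,T))$, let $x_K\in K$ be an arbitrary point of each cell, $\varphi_K^n=\varphi(x_K,t_n)$, and $$T_{\rm div}^{(m)}=\sum_{n=0}^{N^{(m)}-1}\delta t^{(m)}\sum_{K\in\mathcal M^{(m)}}\varphi_K^n\sum_{\sigma\in\mathcal E(K)}G_{K,\sigma}^n .$$ Then $\bar\rho\,\bar z\,\bar u\cdot\nabla\varphi$ is integrable on $\Omega\times(0,T)$ and $$\lim_{m\to+\infty}T_{\rm div}^{(m)}=-\int_0^T\int_\Omega\bar\rho\,\bar z\,\bar u\cdot\nabla\varphi\,dx\,dt,$$ where $\nabla$ is the gradient with respect to $x$. -/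

import Mathlib

open MeasureTheory Filter Topology
open scoped NNReal ENNReal ContDiff

noncomputable section

namespace StaggeredFV

/-- The Euclidean space `ℝ^d`. -/
abbrev Space (d : ℕ) : Type := EuclideanSpace ℝ (Fin d)

/-- The `2 d` faces of the reference cell (segment, square, cube): `(i, false)` and `(i, true)` are
the two opposite faces orthogonal to the `i`-th axis. -/
abbrev LocalFace (d : ℕ) : Type := Fin d × Bool

/-- Two half-diamond cells of the same primal cell are separated by a dual face if and only if the
cones of the reference cell (with apex at its centre) based on the corresponding faces are:
for `d ≥ 2` this happens for distinct non-opposite faces, for `d = 1` for the two end points. -/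
def DualAdj {d : ℕ} (a b : LocalFace d) : Prop :=
  a ≠ b ∧ (d = 1 ∨ a.1 ≠ b.1)

instance {d : ℕ} (a b : LocalFace d) : Decidable (DualAdj a b) := by
  unfold DualAdj; infer_instance

/-- The `(d-1)`-dimensional Lebesgue measure of the orthogonal projection of `A` on the hyperplane
`n^⊥`. If `A` lies in a hyperplane orthogonal to `n`, this is the `(d-1)`-dimensional Lebesgue
measure of `A` (equal to `1` for a point if `d = 1`). -/
def area {d : ℕ} (n : Space d) (A : Set (Space d)) : ℝ≥0∞ :=
  volume {v : (Submodule.span ℝ {n})ᗮ | ∃ t : ℝ, (v : Space d) + t • n ∈ A}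

/-- `A` is part of a hyperplane orthogonal to the unit vector `n`, and near almost every point of
`A` (for the `(d-1)`-dimensional measure) the set `K` is the half-space with outward normal `n`. -/
structure IsOutwardNormal {d : ℕ} (K A : Set (Space d)) (n : Space d) : Prop where
  norm_eq_one : ‖n‖ = 1
  planar : ∃ c : ℝ, ∀ x ∈ A, inner ℝ n x = c
  outward : area n {x ∈ A | ¬ ∃ r > 0, ∀ y ∈ Metric.ball x r,
    (y ∈ K ↔ inner ℝ n y ≤ inner ℝ n x)} = 0

/-- The boundary of `Ω` is contained in a finite union of hyperplanes. -/
def IsPolyhedral {d : ℕ} (Ω : Set (Space d)) : Prop :=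
  ∃ H : Finset (Space d × ℝ), (∀ h ∈ H, h.1 ≠ 0) ∧
    ∀ x ∈ frontier Ω, ∃ h ∈ H, inner ℝ h.1 x = h.2

/-- A conforming mesh of `Ω` by segments, quadrangles or hexahedra, with an associated dual mesh.
Cells and faces are indexed by `Fin numCells` and `Fin numFaces`; `face K a` is the index of the
face of the cell `K` which corresponds to the face `a` of the reference cell. -/
structure Mesh (d : ℕ) (Ω : Set (Space d)) where
  numCells : ℕ
  numFaces : ℕ
  /-- the cells, as subsets of `ℝ^d` -/
  cell : Fin numCells → Set (Space d)
  /-- the faces, as subsets of `ℝ^d` -/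
  faceSet : Fin numFaces → Set (Space d)
  face : Fin numCells → LocalFace d → Fin numFaces
  /-- the unit normal vector to the face `face K a`, outward `K` -/
  normal : Fin numCells → LocalFace d → Space d
  /-- the half-diamond cell of `K` associated to its face `face K a` -/
  half : Fin numCells → LocalFace d → Set (Space d)
  isCompact_cell : ∀ K, IsCompact (cell K)
  isConnected_cell : ∀ K, IsConnected (cell K)
  iUnion_cell : ⋃ K, cell K = closure Ω
  disjoint_interior : ∀ K L, K ≠ L → Disjoint (interior (cell K)) (interior (cell L))
  isCompact_face : ∀ σ, IsCompact (faceSet σ)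
  /-- every face is a face of some cell -/
  exists_cell : ∀ σ, ∃ K a, face K a = σ
  face_injective : ∀ K, Function.Injective (face K)
  frontier_cell : ∀ K, frontier (cell K) = ⋃ a, faceSet (face K a)
  isOutwardNormal : ∀ K a, IsOutwardNormal (cell K) (faceSet (face K a)) (normal K a)
  /-- faces are not degenerate -/
  area_pos : ∀ K a, 0 < area (normal K a) (faceSet (face K a))
  /-- the faces of a cell meet as those of the reference cell do: exactly the opposite ones are
  disjoint -/
  faces_meet : ∀ K a b, a ≠ b →
    ((faceSet (face K a) ∩ faceSet (face K b)).Nonempty ↔ a.1 ≠ b.1)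
  /-- conformity: distinct faces overlap at most along a set of zero `(d-1)`-dimensional measure,
  so that cells which meet along more than vertices and edges share a whole face -/
  conforming : ∀ K a τ, τ ≠ face K a →
    area (normal K a) (faceSet (face K a) ∩ faceSet τ) = 0
  measurableSet_half : ∀ K a, MeasurableSet (half K a)
  half_subset : ∀ K a, half K a ⊆ cell K
  /-- `|D_{K,σ}| = |K| / ζ`, where `ζ = 2 d` is the number of faces of `K` -/
  volume_half : ∀ K a, volume (half K a) = volume (cell K) / (2 * (d : ℝ≥0∞))
  /-- the half-diamond cells of `K` form, up to null sets, a partition of `K` (they cover `K` up to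
  a null set since their volumes add up to the volume of `K`) -/
  half_disjoint : ∀ K a b, a ≠ b → volume (half K a ∩ half K b) = 0

namespace Mesh

variable {d : ℕ} {Ω : Set (Space d)} (M : Mesh d Ω)

/-- `|K|` -/
def vol (K : Fin M.numCells) : ℝ := (volume (M.cell K)).toReal

/-- `h_K` -/
def diam (K : Fin M.numCells) : ℝ := Metric.diam (M.cell K)

/-- `h_M`, the maximum of the diameters of the cells. -/
def size : ℝ := ⨆ K, M.diam K

/-- `|σ|`, for the face `σ` of `K` with local index `a`. -/
def faceArea (K : Fin M.numCells) (a : LocalFace d) : ℝ :=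
  (area (M.normal K a) (M.faceSet (M.face K a))).toReal

/-- `σ = K|L`: the face `σ` is internal and separates the cells `K` and `L`. -/
def Separates (σ : Fin M.numFaces) (K L : Fin M.numCells) : Prop :=
  K ≠ L ∧ (∃ a, M.face K a = σ) ∧ ∃ b, M.face L b = σ

/-- `σ` is an internal face. -/
def IsInternal (σ : Fin M.numFaces) : Prop := ∃ K L, M.Separates σ K L

/-- The dual (diamond) cell `D_σ`, the union of the half-diamond cells associated to `σ`. -/
def dualCell (σ : Fin M.numFaces) : Set (Space d) :=
  ⋃ (K) (a) (_ : M.face K a = σ), M.half K a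

open Classical in
/-- `θ_{M,1}`, the maximum of `|K|/|L|` over (ordered) pairs of cells sharing a face. -/
def theta1 : ℝ :=
  ⨆ q : Fin M.numCells × Fin M.numCells,
    if ∃ σ, M.Separates σ q.1 q.2 then M.vol q.1 / M.vol q.2 else 0

open Classical in
/-- `θ_{M,2}`, the maximum over the cells `K` of
`(∑_{σ' ∈ E(K)} |σ'|) / |K| * max_{σ = K|L ∈ E(K)} (h_K + h_L)`. -/
def theta2 : ℝ :=
  ⨆ K : Fin M.numCells, (∑ a, M.faceArea K a) / M.vol K *
    ⨆ L : Fin M.numCells, if ∃ σ, M.Separates σ K L then M.diam K + M.diam L else 0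

/-- The function of space and time equal to `v n i` on `A i × [t_n, t_{n+1})`, `0 ≤ n < N`, where
`t_n = n T / N` and `A` is a finite family of subsets of `ℝ^d`. -/
def discreteFun {ι V : Type} [Fintype ι] [AddCommMonoid V] (A : ι → Set (Space d))
    (T : ℝ) (N : ℕ) (v : ℕ → ι → V) (p : Space d × ℝ) : V :=
  ∑ n ∈ Finset.range N, ∑ i,
    (A i ×ˢ Set.Ico (n * (T / N)) ((n + 1) * (T / N))).indicator (fun _ => v n i) p

end Mesh

/-- The discrete quantities entering the scheme on a mesh; the first argument `n : ℕ` is the index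
of the time step. -/
structure Unknowns {d : ℕ} {Ω : Set (Space d)} (M : Mesh d Ω) where
  /-- the densities `ρ_K^n` -/
  rho : ℕ → Fin M.numCells → ℝ
  /-- the velocities `u_σ^n` -/
  u : ℕ → Fin M.numFaces → Space d
  /-- the transported variable `z_σ^n` -/
  z : ℕ → Fin M.numFaces → ℝ
  /-- the densities `ρ_σ^n` at the (internal) faces -/
  rhoFace : ℕ → Fin M.numFaces → ℝ
  /-- the values `z_ε^n` at the dual faces: `zDual n K a b` is the value at the dual face
  `ε = σ|σ'` included in `K`, with `σ = face K a` and `σ' = face K b` -/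
  zDual : ℕ → Fin M.numCells → LocalFace d → LocalFace d → ℝ

namespace Unknowns

variable {d : ℕ} {Ω : Set (Space d)} {M : Mesh d Ω} (U : Unknowns M)

open Classical in
/-- The primal mass flux `F_{K,σ}^n = |σ| ρ_σ^n u_σ^n · n_{K,σ}` for an internal face
`σ = face K a`, and `0` for an external face. -/
def massFlux (n : ℕ) (K : Fin M.numCells) (a : LocalFace d) : ℝ :=
  if M.IsInternal (M.face K a) then
    M.faceArea K a * U.rhoFace n (M.face K a) * inner ℝ (U.u n (M.face K a)) (M.normal K a)
  else 0

/-- The dual mass flux `F_{σ,ε}^n`, outward `D_σ`, through the dual face `ε = σ|σ'` included in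
`K`, with `σ = face K a` and `σ' = face K b`: a linear combination of the primal mass fluxes
through the faces of `K`. -/
def dualFlux (ξ : LocalFace d → LocalFace d → LocalFace d → ℝ) (n : ℕ) (K : Fin M.numCells)
    (a b : LocalFace d) : ℝ :=
  ∑ c, ξ a b c * U.massFlux n K c

/-- The assumptions on the discretization, at the time steps `0 ≤ n < N`. -/
structure IsAdmissible (ξ : LocalFace d → LocalFace d → LocalFace d → ℝ) (N : ℕ) : Prop where
  /-- `ρ_σ^n` is a convex combination of `ρ_K^n` and `ρ_L^n` for `σ = K|L` -/
  rhoFace_mem : ∀ n < N, ∀ σ K L, M.Separates σ K L →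
    U.rhoFace n σ ∈ segment ℝ (U.rho n K) (U.rho n L)
  /-- `z_ε^n` is a convex combination of `z_σ^n` and `z_{σ'}^n` for `ε = σ|σ'` -/
  zDual_mem : ∀ n < N, ∀ K a b, DualAdj a b →
    U.zDual n K a b ∈ segment ℝ (U.z n (M.face K a)) (U.z n (M.face K b))
  /-- there is one value `z_ε^n` per dual face -/
  zDual_symm : ∀ n < N, ∀ K a b, DualAdj a b → U.zDual n K a b = U.zDual n K b a
  /-- the dual mass fluxes are conservative -/
  dualFlux_antisymm : ∀ n < N, ∀ K a b, DualAdj a b →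
    U.dualFlux ξ n K a b = - U.dualFlux ξ n K b a
  /-- mass balance over the half-diamond cells, whose faces are `σ` itself and the dual faces -/
  mass_balance : ∀ n < N, ∀ K a,
    U.massFlux n K a + ∑ b with DualAdj a b, U.dualFlux ξ n K a b =
      1 / (2 * (d : ℝ)) * ∑ c, U.massFlux n K c

/-- For `σ = face L a`, the sum of `F_{σ,ε}^n z_ε^n` over the dual faces `ε` of `D_σ` which are
included in the cell `L`. -/
def dualSum (ξ : LocalFace d → LocalFace d → LocalFace d → ℝ) (n : ℕ) (L : Fin M.numCells)
    (a : LocalFace d) : ℝ :=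
  ∑ b with DualAdj a b, U.dualFlux ξ n L a b * U.zDual n L a b

/-- The flux `G_{K,σ}^n` of the convection operator reconstructed on the primal mesh:
`-1/2` times the sum of `F_{σ,ε}^n z_ε^n` over the dual faces `ε` of `D_σ` included in `K`, plus
`1/2` times the same sum over the other dual faces of `D_σ`. (The fluxes through the dual faces
lying on the boundary of `Ω` vanish.) -/
def G (ξ : LocalFace d → LocalFace d → LocalFace d → ℝ) (n : ℕ) (K : Fin M.numCells)
    (σ : Fin M.numFaces) : ℝ :=
  -(1 / 2) * (∑ a with M.face K a = σ, U.dualSum ξ n K a)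
    + 1 / 2 * ∑ L with L ≠ K, ∑ a with M.face L a = σ, U.dualSum ξ n L a

/-- The divergence term `∑_n δt ∑_K φ(x_K, t_n) ∑_{σ ∈ E(K)} G_{K,σ}^n`, with `δt = T / N`. -/
def divTerm (ξ : LocalFace d → LocalFace d → LocalFace d → ℝ) (T : ℝ) (N : ℕ)
    (xc : Fin M.numCells → Space d) (φ : Space d × ℝ → ℝ) : ℝ :=
  ∑ n ∈ Finset.range N, (T / N) *
    ∑ K, φ (xc K, n * (T / N)) * ∑ a, U.G ξ n K (M.face K a)

end Unknowns

/-- `C_c^∞(Ω × [0,T))`: smooth functions whose (compact) support is contained in `Ω × (-∞,T)`;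
only their restriction to `t ≥ 0` matters. -/
structure IsTestFunction {d : ℕ} (Ω : Set (Space d)) (T : ℝ) (φ : Space d × ℝ → ℝ) : Prop where
  smooth : ContDiff ℝ ∞ φ
  compact : HasCompactSupport φ
  support_subset : tsupport φ ⊆ Ω ×ˢ Set.Iio T

/-- Lebesgue measure on `Ω × (0,T)`. -/
def spaceTime {d : ℕ} (Ω : Set (Space d)) (T : ℝ) : Measure (Space d × ℝ) :=
  volume.restrict (Ω ×ˢ Set.Ioo 0 T)

/-- Convergence in `L¹(Ω × (0,T))` of `f m` to `g ∈ L¹(Ω × (0,T))`, the sequence being moreover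
bounded in `L^∞(Ω × (0,T))`. -/
structure ConvergesBounded {d : ℕ} {V : Type} [NormedAddCommGroup V] (Ω : Set (Space d)) (T : ℝ)
    (f : ℕ → Space d × ℝ → V) (g : Space d × ℝ → V) : Prop where
  integrable : Integrable g (spaceTime Ω T)
  tendsto : Tendsto (fun m => eLpNorm (f m - g) 1 (spaceTime Ω T)) atTop (𝓝 0)
  bounded : ∃ C : ℝ≥0, ∀ m, eLpNorm (f m) ⊤ (spaceTime Ω T) ≤ C

end StaggeredFV

end

/-! The proof rests on an exact identity at each time step. Write `q = (K, σ)` for a cell and one of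
its faces, and `opp q` for the same face seen from the other side. Let `g = φ(·, t_n)`, assumed to
vanish in the cells with an external face, and let `w_K = g(x_K)`. The dual fluxes are antisymmetric
and each dual face carries a single value `z_ε`, so the sums `∑_ε F_{σ,ε} z_ε` attached to the faces
of one cell add up to zero. A discrete summation by parts then turns `∑_K w_K ∑_σ G_{K,σ}` into half
the sum over `q` of the jump of `w` times such a sum. The mass balance on half-diamonds splits this
sum into `-z_σ F_{K,σ}`, a multiple of the discrete divergence `∑_σ F_{K,σ}`, and terms with `z_ε -
z_σ`.

The leading part is compared with `∫_K ∇g · f_K`, where `f_K = ρ_K z u` is evaluated at one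
reference face of `K`. By the divergence theorem this integral is `∑_σ (f_K · n) ∫_σ g`, while `∑_σ
|σ| n = 0`. Quantities equal on both sides of a face cancel against the antisymmetric mass fluxes,
so face means of `g` may be inserted freely. What remains is `(|σ| g(x_K) - ∫_σ g)` times the
difference of two normal fluxes (`sum_mul_sum_G_add_integral`).

Each remainder contains a difference of values of `g`, of order `h`, and a factor bounded by `∑_σ
|σ|` times an oscillation of the unknowns inside `K` or across its faces; for the divergence this
again uses `∑_σ |σ| n = 0`. The bound on `theta2` converts `h ∑_σ |σ|` into a multiple of `|K|`
(`abs_sum_mul_sum_G_add_integral_le`).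

The resulting weighted sum of oscillations tends to zero (`tendsto_sum_osc`): an `L¹` convergent
sequence of piecewise constant functions is close to one fixed uniformly continuous function, whose
variation between nearby pieces is small. The bound on `theta1` allows the error on a neighbouring
cell to be charged to that cell. Finally, the products `ρ z u` converge in `L¹` because the factors
are bounded, and the consistent part converges to the integral. Cells with external faces are
harmless: they contain a point outside `Ω`, so on a fine mesh `φ` vanishes on them and at the chosen
points of their neighbours.

The divergence theorem on a cell is obtained by slicing along lines: almost every line in a given
direction meets the boundary only at good points of non-parallel faces, where the one-dimensional
fundamental theorem of calculus applies. -/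

namespace StaggeredFV

/-! ### Measure on hyperplanes and projection along a direction -/

variable {d : ℕ}

/-- The affine parametrization `v ↦ v + c n` of the hyperplane `{x | ⟪n, x⟫ = c}` (for a unit
vector `n`) by the vectors orthogonal to `n`. -/
def planeMap (n : Space d) (c : ℝ) (v : (Submodule.span ℝ {n})ᗮ) : Space d := (v : Space d) + c • n

/-- The `(d-1)`-dimensional Lebesgue measure on the hyperplane `{x | ⟪n, x⟫ = c}`. -/
noncomputable def planeMeasure (n : Space d) (c : ℝ) : Measure (Space d) :=
  Measure.map (planeMap n c) volume

theorem measurable_planeMap (n : Space d) (c : ℝ) : Measurable (planeMap n c) := by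
  unfold planeMap; fun_prop

theorem inner_coe_orthogonal (n : Space d) (v : (Submodule.span ℝ {n})ᗮ) :
    inner ℝ n (v : Space d) = 0 :=
  Submodule.mem_orthogonal_singleton_iff_inner_right.1 v.2

/-- Fubini along the direction `n`: the orthogonal decomposition is an isometry, and `span {n}` is
isometric to `ℝ`. -/
theorem measurePreserving_add_smul {n : Space d} (hn : ‖n‖ = 1) :
    MeasurePreserving (fun p : (Submodule.span ℝ {n})ᗮ × ℝ => (p.1 : Space d) + p.2 • n)
      (volume.prod volume) volume := by
  let S := Submodule.span ℝ {n}
  have h1 : MeasurePreserving (fun t : ℝ => LinearIsometryEquiv.toSpanUnitSingleton n hn t) :=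
    LinearIsometryEquiv.measurePreserving _
  have h2 : MeasurePreserving (fun p : Sᗮ × ℝ =>
      ((LinearIsometryEquiv.toSpanUnitSingleton n hn p.2 : S), p.1))
      (volume.prod volume) (volume.prod volume) :=
    (h1.prod (MeasurePreserving.id (volume : Measure Sᗮ))).comp Measure.measurePreserving_swap
  have h3 := WithLp.volume_preserving_toLp S Sᗮ
  have h4 := S.orthogonalDecomposition.symm.measurePreserving
  have h5 : (fun p : Sᗮ × ℝ => (p.1 : Space d) + p.2 • n) =
      (S.orthogonalDecomposition.symm ∘ WithLp.toLp 2) ∘ fun p : Sᗮ × ℝ =>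
        ((LinearIsometryEquiv.toSpanUnitSingleton n hn p.2 : S), p.1) := by
    ext1 p
    refine Eq.trans ?_ (DFunLike.congr_fun (Submodule.coe_orthogonalDecomposition_symm (K := S))
      (WithLp.toLp 2 ((LinearIsometryEquiv.toSpanUnitSingleton n hn p.2 : S), p.1))).symm
    simp [add_comm]
  rw [h5]
  exact (h4.comp h3).comp h2

theorem inner_add_smul_self {n : Space d} (hn : ‖n‖ = 1) (v : (Submodule.span ℝ {n})ᗮ) (t : ℝ) :
    inner ℝ n ((v : Space d) + t • n) = t := by
  rw [inner_add_right, inner_coe_orthogonal, inner_smul_right, real_inner_self_eq_norm_sq, hn]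
  simp

theorem area_eq_volume_preimage {n : Space d} (hn : ‖n‖ = 1) {c : ℝ} {A : Set (Space d)}
    (hA : ∀ x ∈ A, inner ℝ n x = c) : area n A = volume (planeMap n c ⁻¹' A) := by
  unfold area
  congr 1
  ext v
  simp only [Set.mem_ofPred_eq, Set.mem_preimage, planeMap]
  constructor
  · rintro ⟨t, ht⟩
    have := hA _ ht
    rw [inner_add_smul_self hn] at this
    rwa [← this]
  · exact fun h => ⟨c, h⟩

theorem area_eq_planeMeasure {n : Space d} (hn : ‖n‖ = 1) {c : ℝ} {A : Set (Space d)}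
    (hA : ∀ x ∈ A, inner ℝ n x = c) (hm : MeasurableSet A) : area n A = planeMeasure n c A := by
  rw [area_eq_volume_preimage hn hA, planeMeasure, Measure.map_apply (measurable_planeMap n c) hm]

theorem area_mono (n : Space d) {A B : Set (Space d)} (h : A ⊆ B) : area n A ≤ area n B :=
  measure_mono fun _ ⟨t, ht⟩ => ⟨t, h ht⟩

theorem area_empty (n : Space d) : area n ∅ = 0 := by simp [area]

theorem area_union_le (n : Space d) (A B : Set (Space d)) :
    area n (A ∪ B) ≤ area n A + area n B := by
  refine le_trans (measure_mono ?_) (measure_union_le _ _)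
  rintro v ⟨t, ht | ht⟩
  exacts [Or.inl ⟨t, ht⟩, Or.inr ⟨t, ht⟩]

theorem area_iUnion_null {ι : Type*} [Countable ι] (n : Space d) {A : ι → Set (Space d)}
    (h : ∀ i, area n (A i) = 0) : area n (⋃ i, A i) = 0 := by
  refine measure_mono_null ?_ (measure_iUnion_null h)
  rintro v ⟨t, ht⟩
  obtain ⟨i, hi⟩ := Set.mem_iUnion.1 ht
  exact Set.mem_iUnion.2 ⟨i, t, hi⟩

theorem area_lt_top {n : Space d} (hn : ‖n‖ = 1) {A : Set (Space d)}
    (hA : Bornology.IsBounded A) : area n A < ⊤ := by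
  obtain ⟨R, hR⟩ := hA.exists_norm_le
  refine lt_of_le_of_lt (measure_mono (t := Metric.closedBall 0 R) ?_)
    measure_closedBall_lt_top
  rintro v ⟨t, ht⟩
  have h1 := hR _ ht
  have h2 : ‖(v : Space d) + t • n‖ ^ 2 = ‖(v : Space d)‖ ^ 2 + t ^ 2 := by
    rw [norm_add_sq_real, inner_smul_right, real_inner_comm, inner_coe_orthogonal, norm_smul, hn]
    simp
  have h3 : ‖(v : Space d)‖ ≤ ‖(v : Space d) + t • n‖ :=
    abs_le_of_sq_le_sq' (by nlinarith [sq_nonneg t]) (norm_nonneg _) |>.2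
  simpa using h3.trans h1

theorem volume_plane_unit {n : Space d} (hn : ‖n‖ = 1) (c : ℝ) :
    volume {x : Space d | inner ℝ n x = c} = 0 := by
  have hm : MeasurableSet {x : Space d | inner ℝ n x = c} :=
    (isClosed_eq (by fun_prop) continuous_const).measurableSet
  rw [← (measurePreserving_add_smul hn).measure_preimage hm.nullMeasurableSet]
  have : (fun p : (Submodule.span ℝ {n})ᗮ × ℝ => (p.1 : Space d) + p.2 • n) ⁻¹'
      {x : Space d | inner ℝ n x = c} = Set.univ ×ˢ {c} := by
    ext p; simp [inner_add_smul_self hn]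
  rw [this, Measure.prod_prod]
  simp

theorem volume_plane {h : Space d} (hh : h ≠ 0) (c : ℝ) :
    volume {x : Space d | inner ℝ h x = c} = 0 := by
  have hn : ‖h‖ ≠ 0 := by simpa using hh
  have : {x : Space d | inner ℝ h x = c} = {x | inner ℝ (‖h‖⁻¹ • h) x = ‖h‖⁻¹ * c} := by
    ext x; simp [inner_smul_left, hn]
  rw [this]
  exact volume_plane_unit (by simp [norm_smul, hn]) _

/-- The point of the hyperplane `{x | ⟪n, x⟫ = c}` on the line through `y` directed by `e`. -/
noncomputable def planeProj (n e : Space d) (c : ℝ) (y : Space d) : Space d :=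
  y + ((c - inner ℝ n y) / inner ℝ n e) • e

theorem continuous_planeProj (n e : Space d) (c : ℝ) : Continuous (planeProj n e c) := by
  unfold planeProj; fun_prop

theorem volume_affine_unitInterval {k : ℝ} (hk : k ≠ 0) (c : ℝ) :
    volume {t : ℝ | (t - c) / k ∈ Set.Icc (0 : ℝ) 1} = ENNReal.ofReal |k| := by
  rcases lt_or_gt_of_ne hk with h | h
  · have : {t : ℝ | (t - c) / k ∈ Set.Icc (0 : ℝ) 1} = Set.Icc (c + k) c := by
      ext t
      simp only [Set.mem_Icc, Set.mem_ofPred_eq, div_nonneg_iff, div_le_one_of_neg h]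
      constructor
      · rintro ⟨h1 | h1, h2⟩ <;> constructor <;> linarith
      · rintro ⟨h1, h2⟩
        exact ⟨Or.inr ⟨by linarith, h.le⟩, by linarith⟩
    rw [this, Real.volume_Icc, abs_of_neg h]; congr 1; ring
  · have : {t : ℝ | (t - c) / k ∈ Set.Icc (0 : ℝ) 1} = Set.Icc c (c + k) := by
      ext t
      simp only [Set.mem_Icc, Set.mem_ofPred_eq, div_nonneg_iff, div_le_one h]
      constructor
      · rintro ⟨h1 | h1, h2⟩ <;> constructor <;> linarith
      · rintro ⟨h1, h2⟩
        exact ⟨Or.inl ⟨by linarith, h.le⟩, by linarith⟩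
    rw [this, Real.volume_Icc, abs_of_pos h]; congr 1; ring

/-- Change of variables from `e^⊥` to the hyperplane `{x | ⟪n, x⟫ = c}`, along the lines directed
by `e`. -/
theorem map_planeProj {n e : Space d} (hn : ‖n‖ = 1) (he : ‖e‖ = 1) (c : ℝ)
    (hne : inner ℝ n e ≠ 0) :
    Measure.map (fun y : (Submodule.span ℝ {e})ᗮ => planeProj n e c y) volume =
      ENNReal.ofReal |inner ℝ n e| • planeMeasure n c := by
  have hTm : Measurable (fun y : (Submodule.span ℝ {e})ᗮ => planeProj n e c y) :=
    (continuous_planeProj n e c).measurable.comp measurable_subtype_coe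
  ext B hB
  set k := inner ℝ n e with hk
  -- The oblique cylinder over `B` with generator `e`. Its volume is computed twice by Fubini: along
  -- `e`, where each nonempty fibre is a unit interval, and along `n`, where each slice is a
  -- translate of `B` and the height is `|⟪n, e⟫|`.
  let B' : Set (Space d) := {x | (inner ℝ n x - c) / k ∈ Set.Icc (0 : ℝ) 1 ∧
    x - ((inner ℝ n x - c) / k) • e ∈ B}
  have hf : Measurable (fun x : Space d => (inner ℝ n x - c) / k) := by fun_prop
  have hB' : MeasurableSet B' :=
    (hf measurableSet_Icc).inter (MeasurableSet.preimage hB (by fun_prop))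
  have key1 : volume B' = volume ((fun y : (Submodule.span ℝ {e})ᗮ => planeProj n e c y) ⁻¹' B) := by
    rw [← (measurePreserving_add_smul he).measure_preimage hB'.nullMeasurableSet,
      Measure.prod_apply ((measurePreserving_add_smul he).measurable hB')]
    rw [← lintegral_indicator_one (hTm hB)]
    congr 1
    ext y
    have hs : Prod.mk y ⁻¹' ((fun p : (Submodule.span ℝ {e})ᗮ × ℝ => (p.1 : Space d) + p.2 • e)
        ⁻¹' B') = {t : ℝ | t - (c - inner ℝ n (y : Space d)) / k ∈ Set.Icc (0:ℝ) 1 ∧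
          planeProj n e c y ∈ B} := by
      ext t
      have h1 : (inner ℝ n ((y : Space d) + t • e) - c) / k =
          t - (c - inner ℝ n (y : Space d)) / k := by
        rw [inner_add_right, inner_smul_right, ← hk]; field_simp; ring
      simp only [B', Set.mem_preimage, Set.mem_ofPred_eq, h1]
      rw [planeProj, ← hk]
      refine and_congr_right fun _ => ?_
      rw [sub_smul]
      refine iff_of_eq (congrArg (· ∈ B) ?_)
      abel
    rw [hs]
    by_cases hy : planeProj n e c y ∈ B
    · have : {t : ℝ | t - (c - inner ℝ n (y : Space d)) / k ∈ Set.Icc (0:ℝ) 1 ∧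
          planeProj n e c y ∈ B} = {t : ℝ | (t - (c - inner ℝ n (y : Space d)) / k) / 1 ∈
            Set.Icc (0:ℝ) 1} := by simp [hy]
      rw [this, volume_affine_unitInterval one_ne_zero]
      simp [Set.indicator, hy]
    · simp [Set.indicator, hy]
  have key2 : volume B' = ENNReal.ofReal |k| * planeMeasure n c B := by
    rw [← (measurePreserving_add_smul hn).measure_preimage hB'.nullMeasurableSet,
      Measure.prod_apply_symm ((measurePreserving_add_smul hn).measurable hB')]
    have hs : ∀ t : ℝ, volume ((fun v => (v, t)) ⁻¹'
        ((fun p : (Submodule.span ℝ {n})ᗮ × ℝ => (p.1 : Space d) + p.2 • n) ⁻¹' B')) =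
        {t : ℝ | (t - c) / k ∈ Set.Icc (0:ℝ) 1}.indicator (fun _ => planeMeasure n c B) t := by
      intro t
      by_cases ht : (t - c) / k ∈ Set.Icc (0:ℝ) 1
      · rw [Set.indicator_of_mem (by exact ht)]
        -- The slice at height `t` is the base translated by this vector of `n^⊥`; its component
        -- along `n` is `t - (t - c) - c = 0`.
        have hw : t • n - ((t - c) / k) • e - c • n ∈ (Submodule.span ℝ {n})ᗮ := by
          rw [Submodule.mem_orthogonal_singleton_iff_inner_right, inner_sub_right, inner_sub_right,
            inner_smul_right, inner_smul_right, inner_smul_right, real_inner_self_eq_norm_sq, hn,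
            ← hk]
          field_simp; ring
        rw [planeMeasure, Measure.map_apply (measurable_planeMap n c) hB,
          ← measure_preimage_add_right volume ⟨_, hw⟩ (planeMap n c ⁻¹' B)]
        congr 1
        ext v
        simp only [B', Set.mem_preimage, Set.mem_ofPred_eq, inner_add_smul_self hn, ht, true_and,
          planeMap, Submodule.coe_add]
        refine iff_of_eq (congrArg (· ∈ B) ?_)
        abel
      · rw [Set.indicator_of_notMem (by exact ht)]
        convert measure_empty (μ := volume)
        ext v
        simp only [B', Set.mem_preimage, Set.mem_ofPred_eq, inner_add_smul_self hn]
        simp only [ht, false_and, Set.mem_empty_iff_false]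
    simp_rw [hs]
    rw [lintegral_indicator_const, volume_affine_unitInterval hne, mul_comm]
    exact MeasurableSet.preimage (t := Set.Icc (0:ℝ) 1) measurableSet_Icc (by fun_prop)
  rw [Measure.map_apply hTm hB, ← key1, key2]
  simp

/-- The cosine rule for projected areas. In the degenerate case `⟪n, e⟫ = 0` the null hyperplane
containing `A` is the product of its projection and a whole line, so the projection is itself null.
-/
theorem area_change {n e : Space d} (hn : ‖n‖ = 1) (he : ‖e‖ = 1) {c : ℝ} {A : Set (Space d)}
    (hA : ∀ x ∈ A, inner ℝ n x = c) (hm : MeasurableSet A) :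
    area e A = ENNReal.ofReal |inner ℝ n e| * area n A := by
  by_cases hne : inner ℝ n e = 0
  · rw [hne, abs_zero, ENNReal.ofReal_zero, zero_mul]
    have h0 := volume_plane_unit hn c
    have hP : MeasurableSet {x : Space d | inner ℝ n x = c} :=
      (isClosed_eq (by fun_prop) continuous_const).measurableSet
    rw [← (measurePreserving_add_smul he).measure_preimage hP.nullMeasurableSet] at h0
    have hs : (fun p : (Submodule.span ℝ {e})ᗮ × ℝ => (p.1 : Space d) + p.2 • e) ⁻¹'
        {x : Space d | inner ℝ n x = c} =
        {v : (Submodule.span ℝ {e})ᗮ | inner ℝ n (v : Space d) = c} ×ˢ Set.univ := by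
      ext p; simp [inner_add_right, inner_smul_right, hne]
    rw [hs, Measure.prod_prod] at h0
    refine measure_mono_null ?_ (by simpa using h0)
    rintro v ⟨t, ht⟩
    have := hA _ ht
    simpa [inner_add_right, inner_smul_right, hne] using this
  · have h := congrArg (fun μ => μ A) (map_planeProj hn he c hne)
    have hTm : Measurable (fun y : (Submodule.span ℝ {e})ᗮ => planeProj n e c y) :=
      (continuous_planeProj n e c).measurable.comp measurable_subtype_coe
    simp only [Measure.map_apply hTm hm, Measure.smul_apply, smul_eq_mul] at h
    rw [area_eq_planeMeasure hn hA hm, ← h]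
    unfold area
    congr 1
    ext v
    simp only [Set.mem_ofPred_eq, Set.mem_preimage]
    constructor
    · rintro ⟨t, ht⟩
      have h1 := hA _ ht
      rw [inner_add_right, inner_smul_right] at h1
      have : planeProj n e c v = (v : Space d) + t • e := by
        rw [planeProj, ← h1]; congr 2; field_simp; ring
      rwa [this]
    · exact fun h => ⟨_, h⟩

theorem planeMeasure_neg {n : Space d} (hn : ‖n‖ = 1) (c : ℝ) :
    planeMeasure (-n) (-c) = planeMeasure n c := by
  -- Projecting along `-n` has factor `|⟪n, -n⟫| = 1`, and starts directly from the parameter space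
  -- of the opposite normal.
  have h := map_planeProj (n := n) (e := -n) hn (by simpa using hn) c (by simp [hn])
  rw [inner_neg_right, real_inner_self_eq_norm_sq, hn] at h
  simp only [one_pow, abs_neg, abs_one, ENNReal.ofReal_one, one_smul] at h
  rw [← h, planeMeasure]
  congr 1
  ext1 v
  have : inner ℝ n (v : Space d) = 0 := by
    have := inner_coe_orthogonal _ v
    rwa [inner_neg_left, neg_eq_zero] at this
  simp [planeMap, planeProj, this, hn, div_neg]

end StaggeredFV

/-! ### The fundamental theorem of calculus on a one-dimensional section -/

namespace StaggeredFV

variable {d : ℕ}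

/-- The step function with unit jumps at the point `p`: a jump downwards after `p` if `0 < k`, a jump
upwards at `p` otherwise. -/
noncomputable def jump (k p s : ℝ) : ℝ :=
  if 0 < k then (if s ≤ p then 1 else 0) else -(if s < p then 1 else 0)

theorem jump_eventually_const {k p s₀ : ℝ} (h : s₀ ≠ p) :
    ∀ᶠ s in 𝓝 s₀, jump k p s = jump k p s₀ := by
  rcases lt_or_gt_of_ne h with h | h
  · filter_upwards [gt_mem_nhds h] with s hs
    simp [jump, hs, hs.le, h, h.le]
  · filter_upwards [lt_mem_nhds h] with s hs
    simp [jump, hs.not_ge, hs.le.not_gt, h.not_ge, h.le.not_gt]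

/-- The difference of the two sides is locally constant, since the jumps match at each boundary
point, and it vanishes near `+∞`. The choice of `≤` or `<` in `jump` makes the equality hold at the
boundary points too, which local constancy requires. -/
theorem indicator_eq_sum_jump {ι : Type*} (S : Finset ι) (C : Set ℝ) (hC : IsCompact C)
    (p k : ι → ℝ) (hinj : Set.InjOn p S) (hfr : ∀ s ∈ frontier C, ∃ a ∈ S, p a = s)
    (hk : ∀ a ∈ S, k a ≠ 0)
    (hloc : ∀ a ∈ S, ∀ᶠ s in 𝓝 (p a), (s ∈ C ↔ k a * (s - p a) ≤ 0)) (s : ℝ) :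
    C.indicator (fun _ => (1 : ℝ)) s = ∑ a ∈ S, jump (k a) (p a) s := by
  classical
  let D : ℝ → ℝ := fun s => C.indicator (fun _ => (1 : ℝ)) s - ∑ a ∈ S, jump (k a) (p a) s
  have hsum : ∀ s₀ : ℝ, ∀ S' ⊆ S, (∀ a ∈ S', s₀ ≠ p a) →
      ∀ᶠ s in 𝓝 s₀, ∑ a ∈ S', jump (k a) (p a) s = ∑ a ∈ S', jump (k a) (p a) s₀ := by
    intro s₀ S' hS' h
    have : ∀ᶠ s in 𝓝 s₀, ∀ a ∈ S', jump (k a) (p a) s = jump (k a) (p a) s₀ :=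
      (Filter.eventually_all_finset S').2 fun a ha => jump_eventually_const (h a ha)
    filter_upwards [this] with s hs using Finset.sum_congr rfl hs
  have hD : IsLocallyConstant D := by
    rw [IsLocallyConstant.iff_eventually_eq]
    intro s₀
    by_cases hs₀ : ∃ b ∈ S, p b = s₀
    · obtain ⟨b, hb, rfl⟩ := hs₀
      have h1 := hsum (p b) (S.erase b) (Finset.erase_subset _ _) fun a ha hab =>
        (Finset.mem_erase.1 ha).1 (hinj (Finset.mem_erase.1 ha).2 hb hab.symm)
      have h2 : ∀ᶠ s in 𝓝 (p b), C.indicator (fun _ => (1 : ℝ)) s - jump (k b) (p b) s =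
          if 0 < k b then 0 else 1 := by
        filter_upwards [hloc b hb] with s hs
        by_cases hkb : 0 < k b
        · have : s ∈ C ↔ s ≤ p b := by
            rw [hs]
            constructor
            · intro h; by_contra! h'; nlinarith
            · intro h; nlinarith
          by_cases h : s ≤ p b <;> simp [jump, hkb, this, Set.indicator, h]
        · have hkb' : k b < 0 := lt_of_le_of_ne (not_lt.1 hkb) (hk b hb)
          have : s ∈ C ↔ ¬ s < p b := by
            rw [hs, not_lt]
            constructor
            · intro h; by_contra! h'; nlinarith
            · intro h; nlinarith
          by_cases h : s < p b <;> simp [jump, hkb, this, Set.indicator, h]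
      have h3 := h2.self_of_nhds
      filter_upwards [h1, h2] with s h1s h2s
      simp only [D]
      rw [← Finset.add_sum_erase S _ hb, ← Finset.add_sum_erase S _ hb, h1s]
      linarith
    · push Not at hs₀
      have h1 := hsum s₀ S subset_rfl fun a ha => (hs₀ a ha).symm
      have h2 : ∀ᶠ s in 𝓝 s₀, (s ∈ C ↔ s₀ ∈ C) := by
        have hnf : s₀ ∉ frontier C := fun h => by
          obtain ⟨a, ha, h'⟩ := hfr _ h
          exact hs₀ a ha h'
        by_cases hsC : s₀ ∈ C
        · have : s₀ ∈ interior C := by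
            by_contra h; exact hnf ⟨subset_closure hsC, h⟩
          filter_upwards [mem_interior_iff_mem_nhds.1 this] with s hs
          simp [hs, hsC]
        · filter_upwards [hC.isClosed.isOpen_compl.mem_nhds hsC] with s hs
          simp only [hsC, iff_false]; exact hs
      filter_upwards [h1, h2] with s h1s h2s
      simp only [D, h1s, Set.indicator, h2s]
  have hconst : D s = 0 := by
    have hev : ∀ᶠ x in atTop, D x = 0 := by
      have h1 : ∀ᶠ x in atTop, x ∉ C := by
        obtain ⟨R, hR⟩ := hC.isBounded.bddAbove
        filter_upwards [eventually_gt_atTop R] with x hx hxC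
        exact absurd (hR hxC) hx.not_ge
      have h2 : ∀ᶠ x in atTop, ∀ a ∈ S, p a < x :=
        (Filter.eventually_all_finset S).2 fun a _ => eventually_gt_atTop _
      filter_upwards [h1, h2] with x hx hx'
      simp only [D, Set.indicator, hx, if_false, zero_sub, neg_eq_zero]
      refine Finset.sum_eq_zero fun a ha => ?_
      simp [jump, (hx' a ha).not_ge, (hx' a ha).le]
    obtain ⟨x, hx⟩ := hev.exists
    rw [← hx]
    exact hD.apply_eq_of_isPreconnected isPreconnected_univ (Set.mem_univ _) (Set.mem_univ _)
  simp only [D] at hconst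
  linarith

/-- The fundamental theorem of calculus on a compact set which is a half-line near each of its
finitely many boundary points. -/
theorem setIntegral_deriv_eq_sum_sign {ι : Type*} (S : Finset ι) (C : Set ℝ) (hC : IsCompact C)
    (p k : ι → ℝ) (hinj : Set.InjOn p S) (hfr : ∀ s ∈ frontier C, ∃ a ∈ S, p a = s)
    (hk : ∀ a ∈ S, k a ≠ 0)
    (hloc : ∀ a ∈ S, ∀ᶠ s in 𝓝 (p a), (s ∈ C ↔ k a * (s - p a) ≤ 0))
    {g g' : ℝ → ℝ} (hg : ∀ s, HasDerivAt g (g' s) s) (hg' : Continuous g') :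
    ∫ s in C, g' s = ∑ a ∈ S, Real.sign (k a) * g (p a) := by
  classical
  obtain ⟨R, hR⟩ : ∃ R : ℝ, (∀ s ∈ C, -R < s ∧ s < R) ∧ ∀ a ∈ S, -R < p a ∧ p a < R := by
    have hb : Bornology.IsBounded (C ∪ p '' (S : Set ι)) :=
      hC.isBounded.union (S.finite_toSet.image p).isBounded
    obtain ⟨R, hR⟩ := hb.exists_norm_le
    refine ⟨R + 1, fun s hs => ?_, fun a ha => ?_⟩
    · have := abs_le.1 (hR s (Or.inl hs)); constructor <;> linarith
    · have := abs_le.1 (hR _ (Or.inr ⟨a, ha, rfl⟩)); constructor <;> linarith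
  have hJ := indicator_eq_sum_jump S C hC p k hinj hfr hk hloc
  -- To the left of every boundary point the indicator is zero while each jump equals its sign. This
  -- removes the terms `g (-R)` at the end.
  have hsgn : ∑ a ∈ S, Real.sign (k a) = 0 := by
    have h := hJ (-R)
    rw [Set.indicator_of_notMem (fun h => lt_irrefl _ (hR.1 _ h).1)] at h
    rw [h]
    refine Finset.sum_congr rfl fun a ha => ?_
    rcases lt_or_gt_of_ne (hk a ha) with h' | h'
    · simp [jump, Real.sign_of_neg h', h'.le.not_gt, (hR.2 a ha).1]
    · simp [jump, Real.sign_of_pos h', h', (hR.2 a ha).1.le]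
  -- The bound `R` may be negative, but only if there are neither points nor jumps.
  by_cases hR0 : -R ≤ R
  swap
  · have hCe : C = ∅ := by
      ext s; simp only [Set.mem_empty_iff_false, iff_false]
      intro hs; have := hR.1 s hs; linarith
    have hSe : S = ∅ := by
      ext a; simp only [Finset.notMem_empty, iff_false]
      intro hs; have := hR.2 a hs; linarith
    simp [hCe, hSe]
  have h1 : ∫ s in C, g' s = ∫ s in (-R)..R, ∑ a ∈ S, jump (k a) (p a) s * g' s := by
    rw [intervalIntegral.integral_of_le hR0, ← integral_indicator hC.measurableSet,
      ← integral_indicator measurableSet_Ioc]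
    congr 1
    ext s
    by_cases hs : s ∈ Set.Ioc (-R) R
    · rw [Set.indicator_of_mem hs, ← Finset.sum_mul, ← hJ s]
      by_cases h : s ∈ C <;> simp [h]
    · have : s ∉ C := fun h => hs ⟨(hR.1 s h).1, (hR.1 s h).2.le⟩
      simp [hs, this]
  have hint : ∀ a b : ℝ, IntervalIntegrable g' volume a b := fun a b => hg'.intervalIntegrable a b
  have hFTC : ∀ a b : ℝ, ∫ s in a..b, g' s = g b - g a := fun a b =>
    intervalIntegral.integral_eq_sub_of_hasDerivAt (fun x _ => hg x) (hint a b)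
  have hterm : ∀ a ∈ S, IntervalIntegrable (fun s => jump (k a) (p a) s * g' s) volume (-R) R ∧
      ∫ s in (-R)..R, jump (k a) (p a) s * g' s = Real.sign (k a) * (g (p a) - g (-R)) := by
    intro a ha
    obtain ⟨ha1, ha2⟩ := hR.2 a ha
    have heq : (fun s => jump (k a) (p a) s * g' s) =ᵐ[volume]
        (Set.Iic (p a)).indicator (fun s => Real.sign (k a) * g' s) := by
      have : ∀ᵐ s : ℝ, s ≠ p a := by simp [ae_iff]
      filter_upwards [this] with s hs
      by_cases hsp : s ≤ p a
      · have hsp' : s < p a := lt_of_le_of_ne hsp hs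
        rcases lt_or_gt_of_ne (hk a ha) with h' | h'
        · simp [jump, Real.sign_of_neg h', h'.le.not_gt, hsp, hsp']
        · simp [jump, Real.sign_of_pos h', h', hsp]
      · have hsp' : ¬ s < p a := fun h => hsp h.le
        simp [jump, hsp, hsp']
    constructor
    · rw [intervalIntegrable_iff]
      refine Integrable.congr ?_ (ae_restrict_of_ae heq.symm)
      exact (((hint (-R) R).const_mul _).def').indicator measurableSet_Iic
    · rw [intervalIntegral.integral_congr_ae (heq.mono fun s hs _ => hs),
        intervalIntegral.integral_of_le hR0, integral_indicator measurableSet_Iic,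
        Measure.restrict_restrict measurableSet_Iic]
      have : Set.Iic (p a) ∩ Set.Ioc (-R) R = Set.Ioc (-R) (p a) := by
        ext s; simp only [Set.mem_inter_iff, Set.mem_Iic, Set.mem_Ioc]
        constructor
        · rintro ⟨h1, h2, _⟩; exact ⟨h2, h1⟩
        · rintro ⟨h1, h2⟩; exact ⟨h2, h1, by linarith⟩
      rw [this, ← intervalIntegral.integral_of_le ha1.le, intervalIntegral.integral_const_mul, hFTC]
  rw [h1, intervalIntegral.integral_finsetSum fun a ha => (hterm a ha).1,
    Finset.sum_congr rfl fun a ha => (hterm a ha).2]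
  simp_rw [mul_sub]
  rw [Finset.sum_sub_distrib, ← Finset.sum_mul, hsgn]
  ring

end StaggeredFV

/-! ### The divergence theorem on a cell with planar faces -/

namespace StaggeredFV

variable {d : ℕ}

/-- Being a half-space nearby is an open condition on the point of the hyperplane. Closedness gives
the measurability needed to apply `area_change` to the exceptional set. -/
theorem isClosed_not_locally_halfSpace {K A : Set (Space d)} {n : Space d} {c : ℝ}
    (hA : IsClosed A) (hc : ∀ x ∈ A, inner ℝ n x = c) :
    IsClosed {x ∈ A | ¬ ∃ r > 0, ∀ y ∈ Metric.ball x r,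
      (y ∈ K ↔ inner ℝ n y ≤ inner ℝ n x)} := by
  have : {x ∈ A | ¬ ∃ r > 0, ∀ y ∈ Metric.ball x r, (y ∈ K ↔ inner ℝ n y ≤ inner ℝ n x)} =
      A ∩ (⋃ (z : Space d) (r : ℝ) (_ : ∀ y ∈ Metric.ball z r, (y ∈ K ↔ inner ℝ n y ≤ c)),
        Metric.ball z r)ᶜ := by
    ext x
    simp only [Set.mem_ofPred_eq, Set.mem_inter_iff, Set.mem_compl_iff, Set.mem_iUnion, not_exists]
    refine and_congr_right fun hx => ?_
    rw [hc x hx]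
    constructor
    · intro h z r hzr hxz
      obtain ⟨s, hs, hsub⟩ := Metric.isOpen_iff.1 Metric.isOpen_ball x hxz
      exact h s ⟨hs, fun y hy => hzr y (hsub hy)⟩
    · rintro h r ⟨hr, hy⟩
      exact h x r hy (Metric.mem_ball_self hr)
  rw [this]
  refine hA.inter (isOpen_iUnion fun z => isOpen_iUnion fun r => isOpen_iUnion fun _ =>
    Metric.isOpen_ball).isClosed_compl

theorem integrableOn_planeMeasure {n : Space d} {c : ℝ} (hn : ‖n‖ = 1) {A : Set (Space d)}
    (hA : IsCompact A) (hc : ∀ x ∈ A, inner ℝ n x = c) {V : Type*} [NormedAddCommGroup V]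
    {g : Space d → V} (hg : Continuous g) :
    IntegrableOn g A (planeMeasure n c) := by
  obtain ⟨R, hR⟩ := (hA.image hg).isBounded.exists_norm_le
  refine Measure.integrableOn_of_bounded (M := R) ?_ ?_ ?_
  · rw [← area_eq_planeMeasure hn hc hA.measurableSet]
    exact (area_lt_top hn hA.isBounded).ne
  · exact hg.aestronglyMeasurable
  · filter_upwards [ae_restrict_mem hA.measurableSet] with x hx using hR _ ⟨x, hx, rfl⟩

/-- The divergence theorem in a direction `e`, on a compact set whose boundary is made of planar
faces. -/
theorem integral_fderiv_eq_sum_faces {ι : Type*} [Fintype ι] {K : Set (Space d)} (hK : IsCompact K)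
    (A : ι → Set (Space d)) (n : ι → Space d) (c : ι → ℝ) (hA : ∀ a, IsCompact (A a))
    (hN : ∀ a, IsOutwardNormal K (A a) (n a)) (hc : ∀ a, ∀ x ∈ A a, inner ℝ (n a) x = c a)
    (hfr : frontier K ⊆ ⋃ a, A a) (hdisj : ∀ a b, a ≠ b → area (n a) (A a ∩ A b) = 0)
    {e : Space d} (he : ‖e‖ = 1) {g : Space d → ℝ} (hg : ContDiff ℝ 1 g) :
    ∫ x in K, fderiv ℝ g x e =
      ∑ a, inner ℝ (n a) e * ∫ x in A a, g x ∂planeMeasure (n a) (c a) := by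
  classical
  have hn := fun a => (hN a).norm_eq_one
  have hF : Continuous (fun x => fderiv ℝ g x e) :=
    (hg.continuous_fderiv one_ne_zero).clm_apply continuous_const
  have hmp := measurePreserving_add_smul he
  have hKi : Integrable (K.indicator fun x => fderiv ℝ g x e) volume :=
    (integrable_indicator_iff hK.measurableSet).2 (hF.continuousOn.integrableOn_compact hK)
  let B : ι → Set (Space d) := fun a => {x ∈ A a | ¬ ∃ r > 0, ∀ y ∈ Metric.ball x r,
    (y ∈ K ↔ inner ℝ (n a) y ≤ inner ℝ (n a) x)}
  have hnull : ∀ (a : ι) (E : Set (Space d)), E ⊆ A a → IsClosed E →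
      (inner ℝ (n a) e = 0 ∨ area (n a) E = 0) →
      ∀ᵐ y : (Submodule.span ℝ {e})ᗮ, ∀ t : ℝ, (y : Space d) + t • e ∉ E := by
    intro a E hE hEc h0
    have : area e E = 0 := by
      rw [area_change (hn a) he (fun x hx => hc a x (hE hx)) hEc.measurableSet]
      rcases h0 with h0 | h0 <;> simp [h0]
    rw [area, measure_eq_zero_iff_ae_notMem] at this
    filter_upwards [this] with y hy t ht using hy ⟨t, ht⟩
  -- Almost every line directed by `e` avoids the faces parallel to `e`, the points where `K` is not
  -- locally a half-space, and the overlaps of faces: all these sets have null projection along `e`.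
  have hae : ∀ᵐ y : (Submodule.span ℝ {e})ᗮ,
      (∀ a, inner ℝ (n a) e = 0 → ∀ t : ℝ, (y : Space d) + t • e ∉ A a) ∧
      (∀ a, ∀ t : ℝ, (y : Space d) + t • e ∉ B a) ∧
      (∀ a b, a ≠ b → ∀ t : ℝ, (y : Space d) + t • e ∉ A a ∩ A b) := by
    refine Filter.Eventually.and ?_ (Filter.Eventually.and ?_ ?_)
    · refine ae_all_iff.2 fun a => ?_
      by_cases h : inner ℝ (n a) e = 0
      · filter_upwards [hnull a _ subset_rfl (hA a).isClosed (Or.inl h)] with y hy _ using hy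
      · exact ae_of_all _ fun y h' => absurd h' h
    · exact ae_all_iff.2 fun a => hnull a _ (Set.sep_subset _ _)
        (isClosed_not_locally_halfSpace (hA a).isClosed (hc a)) (Or.inr (hN a).outward)
    · refine ae_all_iff.2 fun a => ae_all_iff.2 fun b => ?_
      by_cases h : a = b
      · exact ae_of_all _ fun y h' => absurd h h'
      · filter_upwards [hnull a _ Set.inter_subset_left ((hA a).isClosed.inter (hA b).isClosed)
          (Or.inr (hdisj a b h))] with y hy _ using hy
  let T : ι → (Submodule.span ℝ {e})ᗮ → Space d := fun a y => planeProj (n a) e (c a) y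
  let G : ι → (Submodule.span ℝ {e})ᗮ → ℝ := fun a y =>
    if inner ℝ (n a) e = 0 then 0 else
      Real.sign (inner ℝ (n a) e) * (A a).indicator g (T a y)
  have hTm : ∀ a, Measurable (T a) := fun a =>
    (continuous_planeProj (n a) e (c a)).measurable.comp measurable_subtype_coe
  have hline : ∀ᵐ y : (Submodule.span ℝ {e})ᗮ,
      ∫ t : ℝ, K.indicator (fun x => fderiv ℝ g x e) ((y : Space d) + t • e) = ∑ a, G a y := by
    filter_upwards [hae] with y hy
    obtain ⟨hy1, hy2, hy3⟩ := hy
    let ℓ : ℝ → Space d := fun t => (y : Space d) + t • e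
    have hℓ : Continuous ℓ := by fun_prop
    have hC : IsCompact (ℓ ⁻¹' K) := by
      refine Metric.isCompact_of_isClosed_isBounded (hK.isClosed.preimage hℓ) ?_
      obtain ⟨R, hR⟩ := hK.isBounded.exists_norm_le
      refine isBounded_iff_forall_norm_le.2 ⟨R + ‖(y : Space d)‖, fun t ht => ?_⟩
      have h1 := hR _ ht
      have h2 : ‖t‖ = ‖ℓ t - (y : Space d)‖ := by simp [ℓ, norm_smul, he]
      rw [h2]
      exact (norm_sub_le _ _).trans (by linarith)
    -- The faces which the line crosses; being transverse, each is crossed at exactly one parameter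
    -- `p a`.
    let S : Finset ι := Finset.univ.filter fun a => inner ℝ (n a) e ≠ 0 ∧ T a y ∈ A a
    let p : ι → ℝ := fun a => (c a - inner ℝ (n a) (y : Space d)) / inner ℝ (n a) e
    have hTp : ∀ a, T a y = ℓ (p a) := fun a => rfl
    have hmem : ∀ a (t : ℝ), ℓ t ∈ A a → a ∈ S ∧ p a = t := by
      intro a t ht
      have hne : inner ℝ (n a) e ≠ 0 := fun h => hy1 a h t ht
      have h1 := hc a _ ht
      have hpt : p a = t := by
        simp only [ℓ, inner_add_right, inner_smul_right] at h1
        simp only [p, ← h1]; field_simp; ring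
      refine ⟨?_, hpt⟩
      simp only [S, Finset.mem_filter, Finset.mem_univ, true_and]
      exact ⟨hne, by rw [hTp, hpt]; exact ht⟩
    have hSmem : ∀ a ∈ S, inner ℝ (n a) e ≠ 0 ∧ ℓ (p a) ∈ A a := by
      intro a ha
      simp only [S, Finset.mem_filter, Finset.mem_univ, true_and] at ha
      exact ha
    have h := setIntegral_deriv_eq_sum_sign S (ℓ ⁻¹' K) hC p (fun a => inner ℝ (n a) e)
      (by
        intro a ha b hb hab
        by_contra hne
        have h2 := (hSmem b hb).2
        rw [← hab] at h2
        exact hy3 a b hne (p a) ⟨(hSmem a ha).2, h2⟩)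
      (by
        intro s hs
        have := hfr (hℓ.frontier_preimage_subset K hs)
        obtain ⟨a, ha⟩ := Set.mem_iUnion.1 this
        exact ⟨a, hmem a s ha⟩)
      (fun a ha => (hSmem a ha).1)
      (by
        intro a ha
        obtain ⟨hne, hpa⟩ := hSmem a ha
        have hgood : ∃ r > 0, ∀ x ∈ Metric.ball (ℓ (p a)) r,
            (x ∈ K ↔ inner ℝ (n a) x ≤ inner ℝ (n a) (ℓ (p a))) := by
          by_contra h
          exact hy2 a (p a) ⟨hpa, h⟩
        obtain ⟨r, hr, hball⟩ := hgood
        filter_upwards [hℓ.continuousAt.preimage_mem_nhds (Metric.ball_mem_nhds (ℓ (p a)) hr)]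
          with s hs
        have h1 := hball _ hs
        rw [Set.mem_preimage, h1]
        simp only [ℓ, inner_add_right, inner_smul_right]
        constructor <;> intro h <;> nlinarith)
      (g := fun t => g (ℓ t)) (g' := fun t => fderiv ℝ g (ℓ t) e)
      (fun s => by
        have h1 : HasDerivAt ℓ e s := by
          simpa [ℓ] using ((hasDerivAt_id s).smul_const e).const_add (y : Space d)
        exact ((hg.differentiable one_ne_zero _).hasFDerivAt).comp_hasDerivAt s h1)
      (hF.comp hℓ)
    rw [← integral_indicator (hK.measurableSet.preimage hℓ.measurable)] at h
    refine Eq.trans ?_ (h.trans ?_)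
    · rfl
    · rw [Finset.sum_filter]
      refine Finset.sum_congr rfl fun a _ => ?_
      simp only [G]
      by_cases hne : inner ℝ (n a) e = 0
      · simp [hne]
      · by_cases hTa : T a y ∈ A a
        · simp [hne, hTa, ← hTp]
        · simp [hne, hTa]
  -- Integrating over the lines brings the Jacobian `|⟪n, e⟫|` of the projection, and the sign of
  -- the crossing restores `⟪n, e⟫`.
  have hG : ∀ a, Integrable (G a) volume ∧ ∫ y, G a y =
      inner ℝ (n a) e * ∫ x in A a, g x ∂planeMeasure (n a) (c a) := by
    intro a
    by_cases hne : inner ℝ (n a) e = 0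
    · simp [G, hne]
    · have hmap := map_planeProj (hn a) he (c a) hne
      have hi : Integrable ((A a).indicator g) (planeMeasure (n a) (c a)) :=
        (integrable_indicator_iff (hA a).measurableSet).2
          (integrableOn_planeMeasure (hn a) (hA a) (hc a) hg.continuous)
      have hi2 : Integrable ((A a).indicator g) (Measure.map (T a) volume) := by
        rw [hmap]; exact hi.smul_measure ENNReal.ofReal_ne_top
      have hi3 := (integrable_map_measure hi2.aestronglyMeasurable (hTm a).aemeasurable).1 hi2
      simp only [G, hne, if_false]
      refine ⟨hi3.const_mul _, ?_⟩
      rw [integral_const_mul]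
      have h1 := integral_map (hTm a).aemeasurable hi2.aestronglyMeasurable
      rw [← h1, hmap, integral_smul_measure, ENNReal.toReal_ofReal (abs_nonneg _),
        integral_indicator (hA a).measurableSet, smul_eq_mul, ← mul_assoc]
      congr 1
      rcases lt_or_gt_of_ne hne with h | h
      · rw [Real.sign_of_neg h, abs_of_neg h]; ring
      · rw [Real.sign_of_pos h, abs_of_pos h]; ring
  rw [← integral_indicator hK.measurableSet, ← hmp.map_eq,
    integral_map hmp.aemeasurable (by rw [hmp.map_eq]; exact hKi.aestronglyMeasurable)]
  refine (integral_prod _ ((hmp.integrable_comp hKi.aestronglyMeasurable).2 hKi)).trans ?_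
  refine (integral_congr_ae hline).trans ?_
  rw [integral_finsetSum _ fun a _ => (hG a).1]
  exact Finset.sum_congr rfl fun a _ => (hG a).2

end StaggeredFV

/-! ### The two sides of a face -/

namespace StaggeredFV

variable {d : ℕ} {Ω : Set (Space d)}

/-- A face of positive area cannot be exhausted by a null set and by its exceptional points. This
turns the almost-everywhere definition of the normal into a usable point, with freedom to avoid
further null sets. -/
theorem IsOutwardNormal.exists_good {K A : Set (Space d)} {n : Space d}
    (h : IsOutwardNormal K A n) (hA : 0 < area n A) {N : Set (Space d)} (hN : area n N = 0) :
    ∃ x ∈ A, x ∉ N ∧ ∃ r > 0, ∀ y ∈ Metric.ball x r, (y ∈ K ↔ inner ℝ n y ≤ inner ℝ n x) := by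
  by_contra! hcon
  refine hA.ne' (le_antisymm ?_ bot_le)
  refine (area_mono n (B := N ∪ {x ∈ A | ¬ ∃ r > 0, ∀ y ∈ Metric.ball x r,
    (y ∈ K ↔ inner ℝ n y ≤ inner ℝ n x)}) fun x hx => ?_).trans ((area_union_le n _ _).trans ?_)
  · by_cases hxN : x ∈ N
    · exact Or.inl hxN
    · refine Or.inr ⟨hx, ?_⟩
      rintro ⟨r, hr, hball⟩
      obtain ⟨y, hy, hy'⟩ := hcon x hx hxN r hr
      have := hball y hy
      rcases hy' with ⟨h1, h2⟩ | ⟨h1, h2⟩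
      · exact absurd (this.1 h1) h2.not_ge
      · exact h1 (this.2 h2)
  · rw [hN, h.outward, zero_add]

theorem exists_mem_ball_inner_lt {n : Space d} (hn : ‖n‖ = 1) (x : Space d) {r : ℝ} (hr : 0 < r) :
    ∃ y ∈ Metric.ball x r, inner ℝ n y < inner ℝ n x := by
  refine ⟨x - (r / 2) • n, ?_, ?_⟩
  · rw [Metric.mem_ball, dist_eq_norm, sub_sub_cancel_left, norm_neg, norm_smul, hn,
      Real.norm_of_nonneg (by positivity)]
    linarith
  · rw [inner_sub_right, inner_smul_right, real_inner_self_eq_norm_sq, hn]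
    linarith

theorem mem_interior_of_halfBall {K : Set (Space d)} {n x y : Space d} {r : ℝ}
    (h : ∀ y ∈ Metric.ball x r, (y ∈ K ↔ inner ℝ n y ≤ inner ℝ n x)) (hy : y ∈ Metric.ball x r)
    (hlt : inner ℝ n y < inner ℝ n x) : y ∈ interior K := by
  have hopen : IsOpen (Metric.ball x r ∩ {y | inner ℝ n y < inner ℝ n x}) :=
    Metric.isOpen_ball.inter (isOpen_lt (by fun_prop) continuous_const)
  exact interior_maximal (fun z hz => (h z hz.1).2 (le_of_lt hz.2)) hopen ⟨hy, hlt⟩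

namespace Mesh

variable (M : Mesh d Ω)

theorem norm_normal (K : Fin M.numCells) (a : LocalFace d) : ‖M.normal K a‖ = 1 :=
  (M.isOutwardNormal K a).norm_eq_one

/-- The value of `⟪n, x⟫` for `x` in the face `a` of `K`, where `n` is its normal vector. -/
noncomputable def offset (K : Fin M.numCells) (a : LocalFace d) : ℝ :=
  (M.isOutwardNormal K a).planar.choose

theorem inner_normal (K : Fin M.numCells) (a : LocalFace d) :
    ∀ x ∈ M.faceSet (M.face K a), inner ℝ (M.normal K a) x = M.offset K a :=
  (M.isOutwardNormal K a).planar.choose_spec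

theorem exists_good (K : Fin M.numCells) (a : LocalFace d) {N : Set (Space d)}
    (hN : area (M.normal K a) N = 0) :
    ∃ x ∈ M.faceSet (M.face K a), x ∉ N ∧ ∃ r > 0, ∀ y ∈ Metric.ball x r,
      (y ∈ M.cell K ↔ inner ℝ (M.normal K a) y ≤ inner ℝ (M.normal K a) x) :=
  (M.isOutwardNormal K a).exists_good (M.area_pos K a) hN

theorem faceSet_subset_cell (K : Fin M.numCells) (a : LocalFace d) :
    M.faceSet (M.face K a) ⊆ M.cell K := by
  refine subset_trans ?_ (M.isCompact_cell K).isClosed.frontier_subset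
  rw [M.frontier_cell K]
  exact Set.subset_iUnion (fun a => M.faceSet (M.face K a)) a

theorem faceSet_nonempty (K : Fin M.numCells) (a : LocalFace d) :
    (M.faceSet (M.face K a)).Nonempty := by
  obtain ⟨x, hx, _⟩ := M.exists_good K a (area_empty _)
  exact ⟨x, hx⟩

theorem area_ne_top (K : Fin M.numCells) (a : LocalFace d) :
    area (M.normal K a) (M.faceSet (M.face K a)) ≠ ⊤ :=
  (area_lt_top (M.norm_normal K a) (M.isCompact_face _).isBounded).ne

theorem faceArea_pos (K : Fin M.numCells) (a : LocalFace d) : 0 < M.faceArea K a :=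
  ENNReal.toReal_pos (M.area_pos K a).ne' (M.area_ne_top K a)

theorem volume_cell_pos (hd : 1 ≤ d) (K : Fin M.numCells) : 0 < volume (M.cell K) := by
  obtain ⟨x, _, _, r, hr, hball⟩ := M.exists_good K (⟨0, hd⟩, false) (area_empty _)
  obtain ⟨y, hy, hlt⟩ := exists_mem_ball_inner_lt (M.norm_normal K (⟨0, hd⟩, false)) x hr
  have := mem_interior_of_halfBall hball hy hlt
  exact lt_of_lt_of_le (isOpen_interior.measure_pos volume ⟨y, this⟩)
    (measure_mono interior_subset)

theorem volume_cell_ne_top (K : Fin M.numCells) : volume (M.cell K) ≠ ⊤ :=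
  (M.isCompact_cell K).measure_lt_top.ne

theorem vol_pos (hd : 1 ≤ d) (K : Fin M.numCells) : 0 < M.vol K :=
  ENNReal.toReal_pos (M.volume_cell_pos hd K).ne' (M.volume_cell_ne_top K)

theorem volume_frontier_cell (K : Fin M.numCells) : volume (frontier (M.cell K)) = 0 := by
  rw [M.frontier_cell K]
  refine measure_iUnion_null fun a => measure_mono_null (fun x hx => M.inner_normal K a x hx)
    (volume_plane_unit (M.norm_normal K a) _)

theorem volume_cell_inter {K L : Fin M.numCells} (h : K ≠ L) :
    volume (M.cell K ∩ M.cell L) = 0 := by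
  refine measure_mono_null (t := frontier (M.cell K) ∪ frontier (M.cell L)) ?_
    (measure_union_null (M.volume_frontier_cell K) (M.volume_frontier_cell L))
  rintro x ⟨hK, hL⟩
  by_contra hcon
  rw [Set.mem_union, not_or] at hcon
  have h1 : x ∈ interior (M.cell K) := by
    by_contra h; exact hcon.1 ⟨subset_closure hK, h⟩
  have h2 : x ∈ interior (M.cell L) := by
    by_contra h; exact hcon.2 ⟨subset_closure hL, h⟩
  exact (M.disjoint_interior K L h).le_bot ⟨h1, h2⟩

/-- With `k` the inner product, the two areas of the common face are each `|k|` times the other; as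
they are positive and finite, `|k|² = 1`. -/
theorem inner_normal_normal {K L : Fin M.numCells} {a b : LocalFace d}
    (h : M.face L b = M.face K a) :
    |inner ℝ (M.normal K a) (M.normal L b)| = 1 := by
  set k := inner ℝ (M.normal K a) (M.normal L b) with hk
  have hm : MeasurableSet (M.faceSet (M.face K a)) := (M.isCompact_face _).measurableSet
  have h1 := area_change (M.norm_normal K a) (M.norm_normal L b) (M.inner_normal K a) hm
  have h2 := area_change (M.norm_normal L b) (M.norm_normal K a)
    (by rw [← h]; exact M.inner_normal L b) hm
  rw [real_inner_comm, ← hk] at h2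
  rw [← hk] at h1
  rw [h1] at h2
  have h3 := congrArg ENNReal.toReal h2
  simp only [ENNReal.toReal_mul, ENNReal.toReal_ofReal (abs_nonneg k)] at h3
  have h4 := M.faceArea_pos K a
  unfold faceArea at h4
  have h5 : |k| * |k| = 1 := by
    have : (|k| * |k| - 1) * (area (M.normal K a) (M.faceSet (M.face K a))).toReal = 0 := by
      linarith
    rcases mul_eq_zero.1 this with h | h
    · linarith
    · exact absurd h h4.ne'
  nlinarith [abs_nonneg k]

/-- At a point which is good for both cells, equal normals would place the same half-ball in both
interiors. -/
theorem normal_eq_neg {K L : Fin M.numCells} {a b : LocalFace d} (hKL : K ≠ L)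
    (h : M.face L b = M.face K a) : M.normal L b = -M.normal K a := by
  have hm : MeasurableSet (M.faceSet (M.face K a)) := (M.isCompact_face _).measurableSet
  have hk := M.inner_normal_normal h
  have hL := M.isOutwardNormal L b
  have hbad := isClosed_not_locally_halfSpace (K := M.cell L) (M.isCompact_face _).isClosed
    (M.inner_normal L b)
  have h0 := area_change (M.norm_normal L b) (M.norm_normal K a)
    (fun x hx => M.inner_normal L b x hx.1) hbad.measurableSet
  rw [hL.outward, mul_zero] at h0
  obtain ⟨x, hx, hxN, r, hr, hball⟩ := M.exists_good K a h0
  rw [Set.mem_ofPred_eq, not_and, not_not] at hxN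
  obtain ⟨s, hs, hball'⟩ := hxN (by rw [h]; exact hx)
  rcases eq_or_eq_neg_of_abs_eq hk with hk | hk
  · have heq := (inner_eq_one_iff_of_norm_eq_one (M.norm_normal K a) (M.norm_normal L b)).1 hk
    exfalso
    obtain ⟨y, hy, hlt⟩ := exists_mem_ball_inner_lt (M.norm_normal K a) x (lt_min hr hs)
    have h1 := mem_interior_of_halfBall hball (Metric.ball_subset_ball (min_le_left _ _) hy) hlt
    have h2 := mem_interior_of_halfBall hball' (Metric.ball_subset_ball (min_le_right _ _) hy)
      (by rwa [← heq])
    exact (M.disjoint_interior K L hKL).le_bot ⟨h1, h2⟩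
  · have : inner ℝ (M.normal K a) (-M.normal L b) = (1 : ℝ) := by rw [inner_neg_right, hk]; simp
    have heq := (inner_eq_one_iff_of_norm_eq_one (M.norm_normal K a)
      (by rw [norm_neg]; exact M.norm_normal L b)).1 this
    rw [heq, neg_neg]

/-- A face has at most two sides: three cells would give three pairwise opposite unit normals. -/
theorem eq_of_face_eq {K L L' : Fin M.numCells} {a b b' : LocalFace d} (hL : K ≠ L) (hL' : K ≠ L')
    (h : M.face L b = M.face K a) (h' : M.face L' b' = M.face K a) : L = L' := by
  by_contra hne
  have h1 := M.normal_eq_neg hL h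
  have h2 := M.normal_eq_neg hL' h'
  have h3 := M.normal_eq_neg hne (h'.trans h.symm)
  rw [h1, h2, neg_neg] at h3
  have h4 := M.norm_normal K a
  have h5 : M.normal K a = 0 := by
    have : (2 : ℝ) • M.normal K a = 0 := by
      rw [two_smul]; nth_rewrite 1 [← h3]; exact neg_add_cancel _
    exact (smul_eq_zero.1 this).resolve_left two_ne_zero
  rw [h5, norm_zero] at h4
  exact zero_ne_one h4

open Classical in
/-- For a pair `q` made of a cell and of a local face, the other pair which corresponds to
the same face, if this face is internal; otherwise the pair itself. -/
noncomputable def opp (q : Fin M.numCells × LocalFace d) : Fin M.numCells × LocalFace d :=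
  if h : ∃ q' : Fin M.numCells × LocalFace d, q'.1 ≠ q.1 ∧ M.face q'.1 q'.2 = M.face q.1 q.2 then
    h.choose else q

variable {M}

theorem isInternal_iff {q : Fin M.numCells × LocalFace d} :
    M.IsInternal (M.face q.1 q.2) ↔
      ∃ q' : Fin M.numCells × LocalFace d, q'.1 ≠ q.1 ∧ M.face q'.1 q'.2 = M.face q.1 q.2 := by
  constructor
  · rintro ⟨K, L, hKL, ⟨a, ha⟩, b, hb⟩
    by_cases h : K = q.1
    · exact ⟨(L, b), by rw [← h]; exact hKL.symm, hb⟩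
    · exact ⟨(K, a), h, ha⟩
  · rintro ⟨q', h, h'⟩
    exact ⟨q'.1, q.1, h, ⟨q'.2, h'⟩, q.2, rfl⟩

theorem opp_of_not_isInternal {q : Fin M.numCells × LocalFace d}
    (h : ¬ M.IsInternal (M.face q.1 q.2)) : M.opp q = q := by
  rw [isInternal_iff] at h
  rw [opp, dif_neg h]

theorem opp_spec {q : Fin M.numCells × LocalFace d} (h : M.IsInternal (M.face q.1 q.2)) :
    (M.opp q).1 ≠ q.1 ∧ M.face (M.opp q).1 (M.opp q).2 = M.face q.1 q.2 := by
  rw [isInternal_iff] at h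
  rw [opp, dif_pos h]
  exact h.choose_spec

theorem face_opp (q : Fin M.numCells × LocalFace d) :
    M.face (M.opp q).1 (M.opp q).2 = M.face q.1 q.2 := by
  by_cases h : M.IsInternal (M.face q.1 q.2)
  · exact (opp_spec h).2
  · rw [opp_of_not_isInternal h]

theorem eq_opp {q q' : Fin M.numCells × LocalFace d} (h : q'.1 ≠ q.1)
    (h' : M.face q'.1 q'.2 = M.face q.1 q.2) : q' = M.opp q := by
  have hi : M.IsInternal (M.face q.1 q.2) := isInternal_iff.2 ⟨q', h, h'⟩
  obtain ⟨h1, h2⟩ := opp_spec hi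
  have h3 : q'.1 = (M.opp q).1 := M.eq_of_face_eq h.symm h1.symm h' h2
  refine Prod.ext h3 (M.face_injective q'.1 ?_)
  rw [h', ← h2, h3]

theorem opp_opp (q : Fin M.numCells × LocalFace d) : M.opp (M.opp q) = q := by
  by_cases h : M.IsInternal (M.face q.1 q.2)
  · obtain ⟨h1, h2⟩ := opp_spec h
    exact (eq_opp h1.symm h2.symm).symm
  · rw [opp_of_not_isInternal h, opp_of_not_isInternal h]

/-- Since external pairs are fixed, this is an involution of all pairs, and sums over pairs can be
reindexed without separating the boundary. -/
theorem opp_involutive : Function.Involutive M.opp := opp_opp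

theorem separates_opp {q : Fin M.numCells × LocalFace d} (h : M.IsInternal (M.face q.1 q.2)) :
    M.Separates (M.face q.1 q.2) q.1 (M.opp q).1 := by
  obtain ⟨h1, h2⟩ := opp_spec h
  exact ⟨h1.symm, ⟨_, rfl⟩, _, h2⟩

theorem normal_opp {q : Fin M.numCells × LocalFace d} (h : M.IsInternal (M.face q.1 q.2)) :
    M.normal (M.opp q).1 (M.opp q).2 = -M.normal q.1 q.2 := by
  obtain ⟨h1, h2⟩ := opp_spec h
  exact M.normal_eq_neg h1.symm h2

theorem offset_opp {q : Fin M.numCells × LocalFace d} (h : M.IsInternal (M.face q.1 q.2)) :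
    M.offset (M.opp q).1 (M.opp q).2 = -M.offset q.1 q.2 := by
  obtain ⟨x, hx⟩ := M.faceSet_nonempty q.1 q.2
  rw [← M.inner_normal q.1 q.2 x hx, ← M.inner_normal _ _ x (by rw [face_opp]; exact hx),
    normal_opp h, inner_neg_left]

variable (M)

/-- The integral of `g` over the face `a` of `K`. -/
noncomputable def faceIntegral (K : Fin M.numCells) (a : LocalFace d) (g : Space d → ℝ) : ℝ :=
  ∫ x in M.faceSet (M.face K a), g x ∂planeMeasure (M.normal K a) (M.offset K a)

theorem faceArea_eq (K : Fin M.numCells) (a : LocalFace d) :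
    M.faceArea K a =
      (planeMeasure (M.normal K a) (M.offset K a)).real (M.faceSet (M.face K a)) := by
  rw [faceArea, area_eq_planeMeasure (M.norm_normal K a) (M.inner_normal K a)
    (M.isCompact_face _).measurableSet]
  rfl

theorem faceIntegral_const (K : Fin M.numCells) (a : LocalFace d) (r : ℝ) :
    M.faceIntegral K a (fun _ => r) = M.faceArea K a * r := by
  rw [faceIntegral, setIntegral_const, faceArea_eq, smul_eq_mul]

variable {M}

theorem faceIntegral_opp {q : Fin M.numCells × LocalFace d} (g : Space d → ℝ) :
    M.faceIntegral (M.opp q).1 (M.opp q).2 g = M.faceIntegral q.1 q.2 g := by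
  by_cases h : M.IsInternal (M.face q.1 q.2)
  · rw [faceIntegral, face_opp, normal_opp h, offset_opp h, planeMeasure_neg (M.norm_normal _ _)]
    rfl
  · rw [opp_of_not_isInternal h]

theorem faceArea_opp (q : Fin M.numCells × LocalFace d) :
    M.faceArea (M.opp q).1 (M.opp q).2 = M.faceArea q.1 q.2 := by
  have := faceIntegral_opp (q := q) (fun _ => 1)
  simpa [faceIntegral_const] using this

variable (M)

theorem integral_cell_fderiv (K : Fin M.numCells) {g : Space d → ℝ} (hg : ContDiff ℝ 1 g)
    (v : Space d) :
    ∫ x in M.cell K, fderiv ℝ g x v =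
      ∑ a, inner ℝ (M.normal K a) v * M.faceIntegral K a g := by
  by_cases hv : v = 0
  · simp [hv]
  have hv' : ‖v‖ ≠ 0 := by simpa using hv
  have h := integral_fderiv_eq_sum_faces (M.isCompact_cell K) (fun a => M.faceSet (M.face K a))
    (M.normal K) (M.offset K) (fun a => M.isCompact_face _) (M.isOutwardNormal K) (M.inner_normal K)
    (M.frontier_cell K).le
    (fun a b hab => M.conforming K a _ fun h => hab (M.face_injective K h).symm)
    (e := ‖v‖⁻¹ • v) (by rw [norm_smul, norm_inv, norm_norm, inv_mul_cancel₀ hv']) hg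
  simp only [map_smul, smul_eq_mul, inner_smul_right] at h
  rw [integral_const_mul] at h
  simp only [mul_assoc] at h
  rw [← Finset.mul_sum] at h
  exact mul_left_cancel₀ (inv_ne_zero hv') h

theorem sum_faceArea_inner_normal (K : Fin M.numCells) (v : Space d) :
    ∑ a, M.faceArea K a * inner ℝ v (M.normal K a) = 0 := by
  have h := M.integral_cell_fderiv K (g := fun _ => (1 : ℝ)) contDiff_const v
  simp only [faceIntegral_const, mul_one] at h
  rw [show (fun x : Space d => fderiv ℝ (fun _ : Space d => (1 : ℝ)) x v) = fun _ => 0 by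
    ext x; simp, integral_zero] at h
  rw [h]
  refine Finset.sum_congr rfl fun a _ => ?_
  rw [real_inner_comm]; ring

/-- A cell with an external face is not included in `Ω`. -/
theorem exists_notMem_of_not_isInternal {K : Fin M.numCells} {a : LocalFace d} (hΩ : IsOpen Ω)
    (h : ¬ M.IsInternal (M.face K a)) : ∃ x ∈ M.faceSet (M.face K a), x ∉ Ω := by
  have hN : area (M.normal K a) (⋃ τ : {τ // τ ≠ M.face K a},
      M.faceSet (M.face K a) ∩ M.faceSet τ.1) = 0 :=
    area_iUnion_null _ fun τ => M.conforming K a τ.1 τ.2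
  obtain ⟨x, hx, hxN, r, hr, hball⟩ := M.exists_good K a hN
  -- Suppose that a good point `x`, lying on no other face, belongs to `Ω`. Points of `Ω`
  -- arbitrarily close to `x` on the outer side belong to other cells; these are finitely many and
  -- closed, so one of them contains `x`. It can only do so through a face, which must be the same
  -- one, and the face is internal.
  refine ⟨x, hx, fun hxΩ => h ?_⟩
  have hcl : IsClosed (⋃ L : {L // L ≠ K}, M.cell L.1) :=
    isClosed_iUnion_of_finite fun L => (M.isCompact_cell L.1).isClosed
  have hxcl : x ∈ ⋃ L : {L // L ≠ K}, M.cell L.1 := by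
    rw [← hcl.closure_eq, mem_closure_iff_nhds]
    intro t ht
    obtain ⟨s, hs, hst⟩ := Metric.mem_nhds_iff.1
      (Filter.inter_mem (Filter.inter_mem ht (hΩ.mem_nhds hxΩ)) (Metric.ball_mem_nhds x hr))
    obtain ⟨y, hy, hlt⟩ := exists_mem_ball_inner_lt (n := -M.normal K a)
      (by rw [norm_neg]; exact M.norm_normal K a) x hs
    rw [inner_neg_left, inner_neg_left, neg_lt_neg_iff] at hlt
    obtain ⟨⟨hyt, hyΩ⟩, hyr⟩ := hst hy
    refine ⟨y, hyt, ?_⟩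
    have hyc : y ∈ ⋃ L, M.cell L := by rw [M.iUnion_cell]; exact subset_closure hyΩ
    obtain ⟨L, hL⟩ := Set.mem_iUnion.1 hyc
    have hLK : L ≠ K := by
      rintro rfl
      exact absurd ((hball y hyr).1 hL) hlt.not_ge
    exact Set.mem_iUnion.2 ⟨⟨L, hLK⟩, hL⟩
  obtain ⟨⟨L, hLK⟩, hL⟩ := Set.mem_iUnion.1 hxcl
  -- If `x` were interior to `L`, the half-ball of `K` at `x` would meet the interior of `L`.
  have hxf : x ∈ frontier (M.cell L) := by
    refine ⟨subset_closure hL, fun hint => ?_⟩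
    obtain ⟨s, hs, hsub⟩ := Metric.mem_nhds_iff.1 (isOpen_interior.mem_nhds hint)
    obtain ⟨y, hy, hlt⟩ := exists_mem_ball_inner_lt (M.norm_normal K a) x (lt_min hr hs)
    have h1 := mem_interior_of_halfBall hball (Metric.ball_subset_ball (min_le_left _ _) hy) hlt
    exact (M.disjoint_interior L K hLK).le_bot
      ⟨hsub (Metric.ball_subset_ball (min_le_right _ _) hy), h1⟩
  rw [M.frontier_cell L] at hxf
  obtain ⟨b, hb⟩ := Set.mem_iUnion.1 hxf
  have hface : M.face L b = M.face K a := by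
    by_contra hne
    exact hxN (Set.mem_iUnion.2 ⟨⟨_, hne⟩, hx, hb⟩)
  exact ⟨L, K, hLK, ⟨b, hface⟩, a, rfl⟩

end Mesh

end StaggeredFV

/-! ### Discrete summation by parts -/

namespace StaggeredFV

variable {d : ℕ} {Ω : Set (Space d)}

theorem DualAdj.symm {a b : LocalFace d} (h : DualAdj a b) : DualAdj b a :=
  ⟨h.1.symm, h.2.imp id fun h => h.symm⟩

namespace Unknowns

variable {M : Mesh d Ω} (U : Unknowns M)

/-- The cells other than `K` contribute only through `opp q`. The subtracted term corrects the
external case, where `opp q = q` although there is no second cell. -/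
theorem G_eq (ξ : LocalFace d → LocalFace d → LocalFace d → ℝ) (n : ℕ)
    (q : Fin M.numCells × LocalFace d) :
    U.G ξ n q.1 (M.face q.1 q.2) = -(1 / 2) * U.dualSum ξ n q.1 q.2 +
      (1 / 2) * (U.dualSum ξ n (M.opp q).1 (M.opp q).2 -
        if M.opp q = q then U.dualSum ξ n q.1 q.2 else 0) := by
  classical
  unfold G
  congr 2
  · rw [Finset.sum_filter, Finset.sum_eq_single q.2]
    · simp
    · intro b _ hb
      rw [if_neg fun h => hb (M.face_injective _ h)]
    · simp
  · have h1 : ∑ L with L ≠ q.1, ∑ a with M.face L a = M.face q.1 q.2, U.dualSum ξ n L a =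
        ∑ q' : Fin M.numCells × LocalFace d,
          if q'.1 ≠ q.1 ∧ M.face q'.1 q'.2 = M.face q.1 q.2 then
            U.dualSum ξ n q'.1 q'.2 else 0 := by
      rw [Fintype.sum_prod_type, Finset.sum_filter]
      refine Finset.sum_congr rfl fun L _ => ?_
      by_cases hL : L = q.1
      · simp [hL]
      · simp [hL, Finset.sum_filter]
    convert h1.trans ?_ using 1
    · rw [Finset.sum_eq_single (M.opp q)]
      · by_cases hi : M.IsInternal (M.face q.1 q.2)
        · have h := Mesh.opp_spec hi
          have : M.opp q ≠ q := fun h' => h.1 (by rw [h'])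
          simp [h.1, h.2, this]
        · rw [Mesh.opp_of_not_isInternal hi]; simp
      · intro q' _ hq'
        rw [if_neg fun h => hq' (Mesh.eq_opp h.1 h.2)]
      · simp

variable {U} {ξ : LocalFace d → LocalFace d → LocalFace d → ℝ} {N : ℕ}

/-- Each dual face inside `K` is counted from its two sides, with opposite fluxes and the same value
of `z`. -/
theorem IsAdmissible.sum_dualSum (hU : U.IsAdmissible ξ N) {n : ℕ} (hn : n < N)
    (K : Fin M.numCells) : ∑ a, U.dualSum ξ n K a = 0 := by
  have h : ∑ a, U.dualSum ξ n K a = -∑ a, U.dualSum ξ n K a := by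
    simp only [dualSum, Finset.sum_filter]
    conv_lhs => rw [Finset.sum_comm]
    rw [← Finset.sum_neg_distrib]
    refine Finset.sum_congr rfl fun a _ => ?_
    rw [← Finset.sum_neg_distrib]
    refine Finset.sum_congr rfl fun b _ => ?_
    by_cases hab : DualAdj a b
    · rw [if_pos hab, if_pos hab.symm, hU.dualFlux_antisymm n hn K a b hab,
        hU.zDual_symm n hn K a b hab]
      ring
    · rw [if_neg hab, if_neg fun h => hab h.symm, neg_zero]
  linarith

/-- Replacing `z_ε` by `z_σ` makes the total dual flux appear, and the mass balance expresses it by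
primal fluxes. -/
theorem IsAdmissible.dualSum_eq (hU : U.IsAdmissible ξ N) {n : ℕ} (hn : n < N)
    (K : Fin M.numCells) (a : LocalFace d) :
    U.dualSum ξ n K a =
      U.z n (M.face K a) * (1 / (2 * (d : ℝ)) * ∑ c, U.massFlux n K c - U.massFlux n K a) +
      ∑ b with DualAdj a b, U.dualFlux ξ n K a b * (U.zDual n K a b - U.z n (M.face K a)) := by
  rw [← hU.mass_balance n hn K a]
  simp_rw [mul_sub, dualSum]
  rw [Finset.sum_sub_distrib, ← Finset.sum_mul]
  ring

theorem massFlux_opp (n : ℕ) (q : Fin M.numCells × LocalFace d) :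
    U.massFlux n (M.opp q).1 (M.opp q).2 = -U.massFlux n q.1 q.2 := by
  unfold massFlux
  rw [Mesh.face_opp]
  by_cases h : M.IsInternal (M.face q.1 q.2)
  · rw [if_pos h, if_pos h, Mesh.normal_opp h, Mesh.faceArea_opp, inner_neg_right]
    ring
  · rw [if_neg h, if_neg h, neg_zero]

/-- Conservativity of the primal fluxes: weights independent of the side of the face are killed. -/
theorem sum_mul_massFlux_eq_zero (n : ℕ) (w : Fin M.numCells × LocalFace d → ℝ)
    (hw : ∀ q, w (M.opp q) = w q) : ∑ q, w q * U.massFlux n q.1 q.2 = 0 := by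
  have h : ∑ q, w q * U.massFlux n q.1 q.2 = ∑ q, w (M.opp q) * U.massFlux n (M.opp q).1 (M.opp q).2 :=
    (Equiv.sum_comp (Mesh.opp_involutive (M := M)).toPerm
      fun q => w q * U.massFlux n q.1 q.2).symm
  simp only [hw, massFlux_opp, mul_neg, Finset.sum_neg_distrib] at h
  linarith

/-- The own-side part of `G` sums to zero in every cell by `sum_dualSum`, and the opposite part is
reindexed by `opp`. The same cancellation then allows `w q.1` to be subtracted, which produces the
jump. The vanishing of `w` near external faces disposes of the correction in `G_eq`. -/
theorem IsAdmissible.sum_mul_sum_G (hU : U.IsAdmissible ξ N) {n : ℕ} (hn : n < N)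
    (w : Fin M.numCells → ℝ)
    (hw : ∀ q : Fin M.numCells × LocalFace d, ¬ M.IsInternal (M.face q.1 q.2) → w q.1 = 0) :
    ∑ K, w K * ∑ a, U.G ξ n K (M.face K a) =
      ∑ q : Fin M.numCells × LocalFace d,
        1 / 2 * ((w (M.opp q).1 - w q.1) * U.dualSum ξ n q.1 q.2) := by
  have h0 : ∑ q : Fin M.numCells × LocalFace d, w q.1 * U.dualSum ξ n q.1 q.2 = 0 := by
    rw [Fintype.sum_prod_type]
    simp_rw [← Finset.mul_sum, hU.sum_dualSum hn]
    simp
  have h1 : ∑ q : Fin M.numCells × LocalFace d,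
      w q.1 * U.dualSum ξ n (M.opp q).1 (M.opp q).2 =
      ∑ q : Fin M.numCells × LocalFace d, w (M.opp q).1 * U.dualSum ξ n q.1 q.2 := by
    rw [← Equiv.sum_comp (Mesh.opp_involutive (M := M)).toPerm]
    simp [Mesh.opp_opp]
  have h2 : ∑ K, w K * ∑ a, U.G ξ n K (M.face K a) =
      ∑ q : Fin M.numCells × LocalFace d, w q.1 * U.G ξ n q.1 (M.face q.1 q.2) := by
    rw [Fintype.sum_prod_type]
    simp_rw [Finset.mul_sum]
  have h3 : ∀ q : Fin M.numCells × LocalFace d, w q.1 * U.G ξ n q.1 (M.face q.1 q.2) =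
      -(1 / 2) * (w q.1 * U.dualSum ξ n q.1 q.2) +
        1 / 2 * (w q.1 * U.dualSum ξ n (M.opp q).1 (M.opp q).2) := by
    intro q
    rw [G_eq]
    by_cases hi : M.IsInternal (M.face q.1 q.2)
    · have h := Mesh.opp_spec hi
      have : M.opp q ≠ q := fun h' => h.1 (by rw [h'])
      rw [if_neg this]; ring
    · rw [hw q hi]; ring
  rw [h2, Finset.sum_congr rfl fun q _ => h3 q, Finset.sum_add_distrib, ← Finset.mul_sum,
    ← Finset.mul_sum, h0, h1, ← Finset.mul_sum]
  simp_rw [sub_mul]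
  rw [Finset.sum_sub_distrib, h0]
  ring

/-- The mass flux per unit area. -/
noncomputable def normalFlux (U : Unknowns M) (n : ℕ) (q : Fin M.numCells × LocalFace d) : ℝ :=
  open Classical in
  if M.IsInternal (M.face q.1 q.2) then
    U.rhoFace n (M.face q.1 q.2) * inner ℝ (U.u n (M.face q.1 q.2)) (M.normal q.1 q.2)
  else 0

theorem massFlux_eq (n : ℕ) (q : Fin M.numCells × LocalFace d) :
    U.massFlux n q.1 q.2 = M.faceArea q.1 q.2 * U.normalFlux n q := by
  unfold massFlux normalFlux
  split_ifs
  · ring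
  · ring

/-- The reconstructed convection operator tested against `g`, as a sum over the faces of the cells:
a consistent part, and remainders. -/
theorem IsAdmissible.sum_mul_sum_G_add_integral (hU : U.IsAdmissible ξ N) {n : ℕ}
    (hn : n < N) {g : Space d → ℝ} (hg : ContDiff ℝ 1 g) (xc : Fin M.numCells → Space d)
    (hext : ∀ q : Fin M.numCells × LocalFace d, ¬ M.IsInternal (M.face q.1 q.2) → g (xc q.1) = 0)
    (f : Fin M.numCells → Space d) :
    ∑ K, g (xc K) * ∑ a, U.G ξ n K (M.face K a) + ∑ K, ∫ x in M.cell K, fderiv ℝ g x (f K) =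
      ∑ q : Fin M.numCells × LocalFace d, (
        (M.faceArea q.1 q.2 * g (xc q.1) - M.faceIntegral q.1 q.2 g) *
          (U.z n (M.face q.1 q.2) * U.normalFlux n q - inner ℝ (f q.1) (M.normal q.1 q.2)) +
        1 / 2 * ((g (xc (M.opp q).1) - g (xc q.1)) * (U.z n (M.face q.1 q.2) *
          (1 / (2 * (d : ℝ)) * ∑ c, U.massFlux n q.1 c))) +
        1 / 2 * ((g (xc (M.opp q).1) - g (xc q.1)) *
          ∑ b with DualAdj q.2 b, U.dualFlux ξ n q.1 q.2 b *
            (U.zDual n q.1 q.2 b - U.z n (M.face q.1 q.2)))) := by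
  rw [hU.sum_mul_sum_G hn (fun K => g (xc K)) hext]
  have h1 : ∑ K, ∫ x in M.cell K, fderiv ℝ g x (f K) =
      ∑ q : Fin M.numCells × LocalFace d,
        inner ℝ (f q.1) (M.normal q.1 q.2) * M.faceIntegral q.1 q.2 g := by
    rw [Fintype.sum_prod_type]
    refine Finset.sum_congr rfl fun K _ => ?_
    rw [M.integral_cell_fderiv K hg]
    exact Finset.sum_congr rfl fun a _ => by rw [real_inner_comm]
  have h2 : ∑ q : Fin M.numCells × LocalFace d,
      g (xc q.1) * (M.faceArea q.1 q.2 * inner ℝ (f q.1) (M.normal q.1 q.2)) = 0 := by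
    rw [Fintype.sum_prod_type]
    refine Finset.sum_eq_zero fun K _ => ?_
    have h := M.sum_faceArea_inner_normal K (f K)
    dsimp only
    rw [← Finset.mul_sum, h, mul_zero]
  have h3 := U.sum_mul_massFlux_eq_zero n
    (fun q => (g (xc (M.opp q).1) + g (xc q.1)) * U.z n (M.face q.1 q.2))
    (fun q => by rw [Mesh.opp_opp, Mesh.face_opp]; ring)
  have h4 := U.sum_mul_massFlux_eq_zero n
    (fun q => M.faceIntegral q.1 q.2 g / M.faceArea q.1 q.2 * U.z n (M.face q.1 q.2))
    (fun q => by rw [Mesh.faceIntegral_opp, Mesh.faceArea_opp, Mesh.face_opp])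
  rw [h1, ← sub_eq_zero, ← Finset.sum_add_distrib, ← Finset.sum_sub_distrib]
  -- This combination of three vanishing sums makes the identity hold term by term: the first
  -- subtracts a constant flux in each cell, the second replaces the half jump of `g (xc ·)` by its
  -- value in the cell, and the third inserts the mean of `g` over the face.
  have h5 : (0 : ℝ) = ∑ q : Fin M.numCells × LocalFace d,
      g (xc q.1) * (M.faceArea q.1 q.2 * inner ℝ (f q.1) (M.normal q.1 q.2)) -
      1 / 2 * ∑ q : Fin M.numCells × LocalFace d,
        (g (xc (M.opp q).1) + g (xc q.1)) * U.z n (M.face q.1 q.2) * U.massFlux n q.1 q.2 +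
      ∑ q : Fin M.numCells × LocalFace d, M.faceIntegral q.1 q.2 g / M.faceArea q.1 q.2 *
        U.z n (M.face q.1 q.2) * U.massFlux n q.1 q.2 := by
    rw [h2, h3, h4]; ring
  rw [h5, Finset.mul_sum, ← Finset.sum_sub_distrib, ← Finset.sum_add_distrib]
  refine Finset.sum_congr rfl fun q _ => ?_
  rw [hU.dualSum_eq hn, massFlux_eq]
  have := (M.faceArea_pos q.1 q.2).ne'
  field_simp
  ring

end Unknowns

end StaggeredFV

/-! ### Bounding the remainders by the oscillation of the unknowns -/

namespace StaggeredFV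

variable {d : ℕ} {Ω : Set (Space d)}

theorem abs_sub_le_of_mem_segment {a b x : ℝ} (h : x ∈ segment ℝ a b) : |x - a| ≤ |b - a| := by
  obtain ⟨s, t, hs, ht, hst, rfl⟩ := h
  have : s • a + t • b - a = t * (b - a) := by
    simp only [smul_eq_mul]; rw [← eq_sub_iff_add_eq] at hst; rw [hst]; ring
  rw [this, abs_mul, abs_of_nonneg ht]
  exact mul_le_of_le_one_left (abs_nonneg _) (by linarith)

theorem abs_le_of_mem_segment {a b x C : ℝ} (h : x ∈ segment ℝ a b) (ha : |a| ≤ C) (hb : |b| ≤ C) :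
    |x| ≤ C := by
  have hx := (convex_Icc (-C) C).segment_subset (abs_le.1 ha) (abs_le.1 hb) h
  exact abs_le.2 hx

namespace Unknowns

variable {M : Mesh d Ω}

/-- The oscillation of the discrete unknowns near the face `q.2` of the cell `q.1`. -/
noncomputable def osc (U : Unknowns M) (a₀ : LocalFace d) (n : ℕ)
    (q : Fin M.numCells × LocalFace d) : ℝ :=
  |U.rho n (M.opp q).1 - U.rho n q.1| + |U.z n (M.face q.1 q.2) - U.z n (M.face q.1 a₀)| +
    ‖U.u n (M.face q.1 q.2) - U.u n (M.face q.1 a₀)‖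

variable {U : Unknowns M} {ξ : LocalFace d → LocalFace d → LocalFace d → ℝ} {N : ℕ}

theorem osc_nonneg (a₀ : LocalFace d) (n : ℕ) (q : Fin M.numCells × LocalFace d) :
    0 ≤ U.osc a₀ n q := by unfold osc; positivity

theorem osc_le_sum (a₀ : LocalFace d) (n : ℕ) (K : Fin M.numCells) (a : LocalFace d) :
    U.osc a₀ n (K, a) ≤ ∑ b, U.osc a₀ n (K, b) :=
  Finset.single_le_sum (f := fun b => U.osc a₀ n (K, b)) (fun _ _ => osc_nonneg _ _ _)
    (Finset.mem_univ a)

theorem IsAdmissible.abs_normalFlux_sub_le (hU : U.IsAdmissible ξ N) {n : ℕ} (hn : n < N) {C : ℝ}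
    (hC : 0 ≤ C) (hρ : ∀ K, |U.rho n K| ≤ C) (hu : ∀ σ, ‖U.u n σ‖ ≤ C) (a₀ : LocalFace d)
    {q : Fin M.numCells × LocalFace d} (hq : M.IsInternal (M.face q.1 q.2)) :
    |U.normalFlux n q - U.rho n q.1 * inner ℝ (U.u n (M.face q.1 a₀)) (M.normal q.1 q.2)| ≤
      C * (|U.rho n (M.opp q).1 - U.rho n q.1| +
        ‖U.u n (M.face q.1 q.2) - U.u n (M.face q.1 a₀)‖) := by
  have hr := hU.rhoFace_mem n hn _ _ _ (Mesh.separates_opp hq)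
  have h1 := abs_sub_le_of_mem_segment hr
  have hin : ∀ v : Space d, |inner ℝ v (M.normal q.1 q.2)| ≤ ‖v‖ := fun v => by
    have := abs_real_inner_le_norm v (M.normal q.1 q.2)
    rwa [M.norm_normal, mul_one] at this
  rw [normalFlux, if_pos hq]
  have h2 : U.rhoFace n (M.face q.1 q.2) * inner ℝ (U.u n (M.face q.1 q.2)) (M.normal q.1 q.2) -
      U.rho n q.1 * inner ℝ (U.u n (M.face q.1 a₀)) (M.normal q.1 q.2) =
      (U.rhoFace n (M.face q.1 q.2) - U.rho n q.1) *
        inner ℝ (U.u n (M.face q.1 q.2)) (M.normal q.1 q.2) +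
      U.rho n q.1 *
        inner ℝ (U.u n (M.face q.1 q.2) - U.u n (M.face q.1 a₀)) (M.normal q.1 q.2) := by
    rw [inner_sub_left]; ring
  rw [h2]
  refine (abs_add_le _ _).trans ?_
  rw [abs_mul, abs_mul, mul_add]
  refine add_le_add ?_ (mul_le_mul (hρ _) (hin _) (abs_nonneg _) hC)
  rw [mul_comm]
  exact mul_le_mul ((hin _).trans (hu _)) h1 (abs_nonneg _) hC

theorem IsAdmissible.abs_normalFlux_le (hU : U.IsAdmissible ξ N) {n : ℕ} (hn : n < N) {C : ℝ}
    (hC : 0 ≤ C) (hρ : ∀ K, |U.rho n K| ≤ C) (hu : ∀ σ, ‖U.u n σ‖ ≤ C)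
    (q : Fin M.numCells × LocalFace d) : |U.normalFlux n q| ≤ C * C := by
  unfold normalFlux
  split_ifs with hq
  · rw [abs_mul]
    refine mul_le_mul (abs_le_of_mem_segment (hU.rhoFace_mem n hn _ _ _ (Mesh.separates_opp hq))
      (hρ _) (hρ _)) ?_ (abs_nonneg _) hC
    have := abs_real_inner_le_norm (U.u n (M.face q.1 q.2)) (M.normal q.1 q.2)
    rw [M.norm_normal, mul_one] at this
    exact this.trans (hu _)
  · rw [abs_zero]; positivity

theorem IsAdmissible.abs_dualFlux_le (hU : U.IsAdmissible ξ N) {n : ℕ} (hn : n < N) {C X : ℝ}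
    (hC : 0 ≤ C) (hρ : ∀ K, |U.rho n K| ≤ C) (hu : ∀ σ, ‖U.u n σ‖ ≤ C)
    (hξ : ∀ a b c, |ξ a b c| ≤ X) (K : Fin M.numCells) (a b : LocalFace d) :
    |U.dualFlux ξ n K a b| ≤ X * C ^ 2 * ∑ c, M.faceArea K c := by
  unfold dualFlux
  refine (Finset.abs_sum_le_sum_abs _ _).trans ?_
  rw [Finset.mul_sum]
  refine Finset.sum_le_sum fun c _ => ?_
  have h1 := massFlux_eq (U := U) n (K, c)
  dsimp only at h1
  rw [h1, abs_mul, abs_mul, abs_of_pos (M.faceArea_pos K c)]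
  have h2 := hU.abs_normalFlux_le hn hC hρ hu (K, c)
  have hX := hξ a b c
  have h3 : |ξ a b c| * (M.faceArea K c * |U.normalFlux n (K, c)|) ≤
      X * (M.faceArea K c * (C * C)) := by
    have := (M.faceArea_pos K c).le
    gcongr
    exact (abs_nonneg _).trans hX
  linarith

/-- In a cell without external faces, the discrete divergence of the mass flux is controlled by the
oscillation of the unknowns. -/
theorem IsAdmissible.abs_sum_massFlux_le (hU : U.IsAdmissible ξ N) {n : ℕ} (hn : n < N) {C : ℝ}
    (hC : 0 ≤ C) (hρ : ∀ K, |U.rho n K| ≤ C) (hu : ∀ σ, ‖U.u n σ‖ ≤ C) (a₀ : LocalFace d)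
    {K : Fin M.numCells} (hK : ∀ a, M.IsInternal (M.face K a)) :
    |∑ c, U.massFlux n K c| ≤
      C * (∑ c, M.faceArea K c) * ∑ b, U.osc a₀ n (K, b) := by
  -- The constant flux `ρ_K u`, with `u` taken at the reference face `a₀`, has zero discrete
  -- divergence and can be subtracted from the mass flux.
  have h0 := M.sum_faceArea_inner_normal K (U.u n (M.face K a₀))
  have h1 : ∑ c, U.massFlux n K c = ∑ c, M.faceArea K c * (U.normalFlux n (K, c) -
      U.rho n K * inner ℝ (U.u n (M.face K a₀)) (M.normal K c)) := by
    simp_rw [mul_sub]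
    rw [Finset.sum_sub_distrib]
    have : ∑ c, M.faceArea K c *
        (U.rho n K * inner ℝ (U.u n (M.face K a₀)) (M.normal K c)) = 0 := by
      have h2 : ∀ c, M.faceArea K c *
        (U.rho n K * inner ℝ (U.u n (M.face K a₀)) (M.normal K c)) = U.rho n K *
          (M.faceArea K c * inner ℝ (U.u n (M.face K a₀)) (M.normal K c)) := fun c => by ring
      simp_rw [h2]
      rw [← Finset.mul_sum, h0, mul_zero]
    rw [this, sub_zero]
    exact Finset.sum_congr rfl fun c _ => massFlux_eq (U := U) n (K, c)
  rw [h1]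
  refine (Finset.abs_sum_le_sum_abs _ _).trans ?_
  rw [mul_right_comm, mul_comm, Finset.sum_mul]
  refine Finset.sum_le_sum fun c _ => ?_
  rw [abs_mul, abs_of_pos (M.faceArea_pos K c)]
  have h2 := hU.abs_normalFlux_sub_le hn hC hρ hu a₀ (hK c) (q := (K, c))
  have h3 : |U.rho n (M.opp (K, c)).1 - U.rho n K| +
        ‖U.u n (M.face K c) - U.u n (M.face K a₀)‖ ≤ U.osc a₀ n (K, c) := by
    unfold osc
    have := abs_nonneg (U.z n (M.face K c) - U.z n (M.face K a₀))
    dsimp only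
    linarith
  have h4 := h3.trans (osc_le_sum a₀ n K c)
  refine mul_le_mul_of_nonneg_left (h2.trans ?_) (M.faceArea_pos K c).le
  exact mul_le_mul_of_nonneg_left h4 hC

theorem abs_faceArea_mul_sub_faceIntegral_le {g : Space d → ℝ} (hg : Continuous g) {Λ : ℝ}
    (hLip : ∀ x y, |g x - g y| ≤ Λ * dist x y) (hΛ : 0 ≤ Λ) (K : Fin M.numCells)
    (a : LocalFace d) {x : Space d} (hx : x ∈ M.cell K) :
    |M.faceArea K a * g x - M.faceIntegral K a g| ≤ Λ * M.diam K * M.faceArea K a := by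
  have hA := M.isCompact_face (M.face K a)
  have h1 : M.faceArea K a * g x - M.faceIntegral K a g =
      ∫ y in M.faceSet (M.face K a), (g x - g y) ∂planeMeasure (M.normal K a) (M.offset K a) := by
    rw [← M.faceIntegral_const K a (g x), Mesh.faceIntegral, Mesh.faceIntegral, ← integral_sub]
    · exact integrableOn_planeMeasure (M.norm_normal K a) hA (M.inner_normal K a) continuous_const
    · exact integrableOn_planeMeasure (M.norm_normal K a) hA (M.inner_normal K a) hg
  rw [h1, M.faceArea_eq, ← Real.norm_eq_abs]
  refine norm_setIntegral_le_of_norm_le_const ?_ fun y hy => ?_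
  · rw [← area_eq_planeMeasure (M.norm_normal K a) (M.inner_normal K a) hA.measurableSet]
    exact (M.area_ne_top K a).lt_top
  · refine (hLip x y).trans (mul_le_mul_of_nonneg_left ?_ hΛ)
    exact Metric.dist_le_diam_of_mem (M.isCompact_cell K).isBounded hx
      (M.faceSet_subset_cell K a hy)

theorem dist_opp_le {q : Fin M.numCells × LocalFace d} {x y : Space d} (hx : x ∈ M.cell (M.opp q).1)
    (hy : y ∈ M.cell q.1) : dist x y ≤ M.diam q.1 + M.diam (M.opp q).1 := by
  obtain ⟨z, hz⟩ := M.faceSet_nonempty q.1 q.2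
  have h1 := M.faceSet_subset_cell q.1 q.2 hz
  have h2 := M.faceSet_subset_cell (M.opp q).1 (M.opp q).2 (by rw [Mesh.face_opp]; exact hz)
  have h3 := Metric.dist_le_diam_of_mem (M.isCompact_cell _).isBounded hx h2
  have h4 := Metric.dist_le_diam_of_mem (M.isCompact_cell _).isBounded h1 hy
  have := dist_triangle x z y
  unfold Mesh.diam
  linarith

theorem IsAdmissible.abs_z_mul_normalFlux_sub_le (hU : U.IsAdmissible ξ N) {n : ℕ}
    (hn : n < N) {C : ℝ} (hC : 0 ≤ C) (hρ : ∀ K, |U.rho n K| ≤ C)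
    (hz : ∀ σ, |U.z n σ| ≤ C) (hu : ∀ σ, ‖U.u n σ‖ ≤ C) (a₀ : LocalFace d) {K : Fin M.numCells}
    (hK : ∀ a, M.IsInternal (M.face K a)) (a : LocalFace d) :
    |U.z n (M.face K a) * U.normalFlux n (K, a) -
      inner ℝ ((U.rho n K * U.z n (M.face K a₀)) • U.u n (M.face K a₀)) (M.normal K a)| ≤
      C ^ 2 * U.osc a₀ n (K, a) := by
  have h2 := hU.abs_normalFlux_sub_le hn hC hρ hu a₀ (hK a) (q := (K, a))
  dsimp only at h2
  rw [inner_smul_left]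
  have hin0 : |inner ℝ (U.u n (M.face K a₀)) (M.normal K a)| ≤ C := by
    have := abs_real_inner_le_norm (U.u n (M.face K a₀)) (M.normal K a)
    rw [M.norm_normal, mul_one] at this
    exact this.trans (hu _)
  have e1 : U.z n (M.face K a) * U.normalFlux n (K, a) -
      (U.rho n K * U.z n (M.face K a₀)) *
        inner ℝ (U.u n (M.face K a₀)) (M.normal K a) =
      U.z n (M.face K a) * (U.normalFlux n (K, a) -
        U.rho n K * inner ℝ (U.u n (M.face K a₀)) (M.normal K a)) +
      (U.z n (M.face K a) - U.z n (M.face K a₀)) *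
        (U.rho n K * inner ℝ (U.u n (M.face K a₀)) (M.normal K a)) := by ring
  simp only [conj_trivial]
  rw [e1]
  refine (abs_add_le _ _).trans ?_
  rw [abs_mul, abs_mul]
  have e2 : |U.rho n K * inner ℝ (U.u n (M.face K a₀)) (M.normal K a)| ≤ C * C := by
    rw [abs_mul]; exact mul_le_mul (hρ _) hin0 (abs_nonneg _) hC
  have e3 := mul_le_mul (hz (M.face K a)) h2 (abs_nonneg _) hC
  have e4 := mul_le_mul_of_nonneg_left e2
    (abs_nonneg (U.z n (M.face K a) - U.z n (M.face K a₀)))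
  unfold osc
  dsimp only
  nlinarith

/-- By convexity `|z_ε - z_σ| ≤ |z_σ' - z_σ|`, which is compared with the reference face. The factor
`2 * d` bounds the number of dual faces, and the dual fluxes have size at most `X C² ∑ |σ|`. -/
theorem IsAdmissible.abs_sum_dualFlux_mul_le (hU : U.IsAdmissible ξ N) {n : ℕ} (hn : n < N)
    {C X : ℝ} (hC : 0 ≤ C) (hX : 0 ≤ X) (hρ : ∀ K, |U.rho n K| ≤ C) (hu : ∀ σ, ‖U.u n σ‖ ≤ C)
    (hξ : ∀ a b c, |ξ a b c| ≤ X) (a₀ : LocalFace d) (K : Fin M.numCells) (a : LocalFace d) :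
    |∑ b with DualAdj a b, U.dualFlux ξ n K a b * (U.zDual n K a b - U.z n (M.face K a))| ≤
      (∑ c, M.faceArea K c) * (X * C ^ 2 * (2 * d) * ∑ b, U.osc a₀ n (K, b)) := by
  have hO : 0 ≤ ∑ b, U.osc a₀ n (K, b) := Finset.sum_nonneg fun b _ => osc_nonneg _ _ _
  have hS0 : 0 ≤ ∑ c, M.faceArea K c := Finset.sum_nonneg fun b _ => (M.faceArea_pos K b).le
  refine (Finset.abs_sum_le_sum_abs _ _).trans ?_
  refine (Finset.sum_le_card_nsmul _ _
    (X * C ^ 2 * (∑ c, M.faceArea K c) * ∑ b, U.osc a₀ n (K, b)) fun b hb => ?_).trans ?_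
  · have hab : DualAdj a b := (Finset.mem_filter.1 hb).2
    rw [abs_mul]
    refine mul_le_mul (hU.abs_dualFlux_le hn hC hρ hu hξ K a b) ?_ (abs_nonneg _)
      (by positivity)
    refine (abs_sub_le_of_mem_segment (hU.zDual_mem n hn K a b hab)).trans ?_
    have h2 : U.osc a₀ n (K, a) + U.osc a₀ n (K, b) ≤ ∑ b, U.osc a₀ n (K, b) := by
      rw [← Finset.sum_pair (f := fun b => U.osc a₀ n (K, b)) hab.1]
      exact Finset.sum_le_sum_of_subset_of_nonneg (Finset.subset_univ _)
        fun _ _ _ => osc_nonneg _ _ _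
    refine le_trans ?_ h2
    have h3 := abs_sub_le (U.z n (M.face K b)) (U.z n (M.face K a₀)) (U.z n (M.face K a))
    rw [abs_sub_comm (U.z n (M.face K a₀))] at h3
    unfold osc
    dsimp only
    have := abs_nonneg (U.rho n (M.opp (K, a)).1 - U.rho n K)
    have := abs_nonneg (U.rho n (M.opp (K, b)).1 - U.rho n K)
    have := norm_nonneg (U.u n (M.face K a) - U.u n (M.face K a₀))
    have := norm_nonneg (U.u n (M.face K b) - U.u n (M.face K a₀))
    linarith
  · rw [nsmul_eq_mul]
    have hle : ((Finset.univ.filter fun b => DualAdj a b).card : ℝ) ≤ 2 * d := by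
      have : (Finset.univ.filter fun b => DualAdj a b).card ≤ 2 * d := by
        have hcard : Fintype.card (LocalFace d) = 2 * d := by simp [LocalFace, mul_comm]
        rw [← hcard]; exact Finset.card_le_univ _
      exact_mod_cast this
    refine (mul_le_mul_of_nonneg_right hle (by positivity)).trans (le_of_eq ?_)
    ring

/-- The common shape of the three remainders: `x` is a difference of values of `g`, of size `Λ H`,
and `y` has size perimeter `S` times oscillation `O`. Regularity turns `S * H` into a multiple of
the volume `v`. -/
theorem abs_mul_le_of_mul_le {x y Λ H S B O θ v : ℝ} (hx : |x| ≤ Λ * H) (hy : |y| ≤ S * (B * O))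
    (h : S * H ≤ θ * v) (hΛ : 0 ≤ Λ) (hB : 0 ≤ B) (hO : 0 ≤ O) :
    |x * y| ≤ B * (Λ * θ * (v * O)) := by
  rw [abs_mul]
  calc |x| * |y| ≤ (Λ * H) * (S * (B * O)) :=
        mul_le_mul hx hy (abs_nonneg _) ((abs_nonneg _).trans hx)
    _ = Λ * B * O * (S * H) := by ring
    _ ≤ Λ * B * O * (θ * v) := mul_le_mul_of_nonneg_left h (by positivity)
    _ = _ := by ring

/-- In `hin`, a cell either has only internal faces, where the oscillation bounds apply, or
contributes nothing. In the constant, `1`, `1 / (2 * (2 * d))` and `X * (2 * d) / 2` come from the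
face mean, the divergence and the dual interpolation respectively. -/
theorem IsAdmissible.abs_sum_mul_sum_G_add_integral_le (hd : 1 ≤ d) (hU : U.IsAdmissible ξ N)
    {n : ℕ} (hn : n < N) {g : Space d → ℝ} (hg : ContDiff ℝ 1 g) (xc : Fin M.numCells → Space d)
    (hxc : ∀ K, xc K ∈ M.cell K) {Λ C X θ : ℝ} (hΛ : 0 ≤ Λ) (hC : 0 ≤ C) (hθ0 : 0 ≤ θ)
    (hLip : ∀ x y, |g x - g y| ≤ Λ * dist x y)
    (hρ : ∀ K, |U.rho n K| ≤ C) (hz : ∀ σ, |U.z n σ| ≤ C) (hu : ∀ σ, ‖U.u n σ‖ ≤ C)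
    (hξ : ∀ a b c, |ξ a b c| ≤ X)
    (hin : ∀ K, (∀ a, M.IsInternal (M.face K a)) ∨
      ((∀ x ∈ M.cell K, g x = 0) ∧ ∀ a, g (xc (M.opp (K, a)).1) = 0))
    (hθ : ∀ q : Fin M.numCells × LocalFace d, M.IsInternal (M.face q.1 q.2) →
      (∑ a, M.faceArea q.1 a) * (M.diam q.1 + M.diam (M.opp q).1) ≤ θ * M.vol q.1)
    (a₀ : LocalFace d) :
    |∑ K, g (xc K) * ∑ a, U.G ξ n K (M.face K a) +
      ∑ K, ∫ x in M.cell K, fderiv ℝ g x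
        ((U.rho n K * U.z n (M.face K a₀)) • U.u n (M.face K a₀))| ≤
      Λ * C ^ 2 * θ * (2 * d * (1 + 1 / (2 * (2 * d)) + X * (2 * d) / 2)) *
        ∑ q : Fin M.numCells × LocalFace d, M.vol q.1 * U.osc a₀ n q := by
  have hcard : Fintype.card (LocalFace d) = 2 * d := by
    simp [LocalFace, mul_comm]
  have hX : 0 ≤ X := (abs_nonneg _).trans (hξ a₀ a₀ a₀)
  rw [hU.sum_mul_sum_G_add_integral hn hg xc]
  swap
  · intro q hq
    rcases hin q.1 with h | h
    · exact absurd (h q.2) hq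
    · exact h.1 _ (hxc _)
  refine (Finset.abs_sum_le_sum_abs _ _).trans ?_
  have hdp : (0 : ℝ) < d := by exact_mod_cast hd
  have key : ∀ q : Fin M.numCells × LocalFace d, |(
        (M.faceArea q.1 q.2 * g (xc q.1) - M.faceIntegral q.1 q.2 g) *
          (U.z n (M.face q.1 q.2) * U.normalFlux n q -
            inner ℝ ((U.rho n q.1 * U.z n (M.face q.1 a₀)) • U.u n (M.face q.1 a₀))
              (M.normal q.1 q.2)) +
        1 / 2 * ((g (xc (M.opp q).1) - g (xc q.1)) * (U.z n (M.face q.1 q.2) *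
          (1 / (2 * (d : ℝ)) * ∑ c, U.massFlux n q.1 c))) +
        1 / 2 * ((g (xc (M.opp q).1) - g (xc q.1)) *
          ∑ b with DualAdj q.2 b, U.dualFlux ξ n q.1 q.2 b *
            (U.zDual n q.1 q.2 b - U.z n (M.face q.1 q.2))))| ≤
      Λ * C ^ 2 * θ * (1 + 1 / (2 * (2 * d)) + X * (2 * d) / 2) *
        (M.vol q.1 * ∑ b, U.osc a₀ n (q.1, b)) := by
    rintro ⟨K, a⟩
    dsimp only
    have hO : 0 ≤ ∑ b, U.osc a₀ n (K, b) := Finset.sum_nonneg fun b _ => osc_nonneg _ _ _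
    have hvol : 0 < M.vol K := M.vol_pos hd K
    set O := ∑ b, U.osc a₀ n (K, b) with hOdef
    set S := ∑ a, M.faceArea K a with hS
    have hS0 : 0 ≤ S := Finset.sum_nonneg fun b _ => (M.faceArea_pos K b).le
    have haS : M.faceArea K a ≤ S :=
      Finset.single_le_sum (f := fun b => M.faceArea K b) (fun b _ => (M.faceArea_pos K b).le)
        (Finset.mem_univ a)
    have hSpos : 0 < S := (M.faceArea_pos K a).trans_le haS
    have hdiam : ∀ L, 0 ≤ M.diam L := fun L => Metric.diam_nonneg
    rcases hin K with hK | ⟨hK1, hK2⟩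
    swap
    · have h1 : M.faceIntegral K a g = 0 := by
        rw [Mesh.faceIntegral]
        refine setIntegral_eq_zero_of_forall_eq_zero fun x hx =>
          hK1 x (M.faceSet_subset_cell K a hx)
      have h2 := hK1 _ (hxc K)
      have h3 := hK2 a
      rw [h1, h2, h3]
      simp only [mul_zero, sub_zero, zero_mul, add_zero, abs_zero]
      positivity
    · have hθK := hθ (K, a) (hK a)
      dsimp only at hθK
      rw [← hS] at hθK
      set H := M.diam K + M.diam (M.opp (K, a)).1 with hH
      have hHK : M.diam K ≤ H := by have := hdiam (M.opp (K, a)).1; linarith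
      have hH0 : 0 ≤ H := (hdiam K).trans hHK
      have hw : |g (xc (M.opp (K, a)).1) - g (xc K)| ≤ Λ * H :=
        (hLip _ _).trans (mul_le_mul_of_nonneg_left
          (dist_opp_le (q := (K, a)) (hxc (M.opp (K, a)).1) (hxc K)) hΛ)
      have ha := osc_le_sum (U := U) a₀ n K a
      -- Here the perimeter sits in the factor containing `g`, so it is moved to the other factor by
      -- dividing and multiplying by `S`.
      have hR3 := abs_mul_le_of_mul_le
        (x := (M.faceArea K a * g (xc K) - M.faceIntegral K a g) / S)
        (y := S * (U.z n (M.face K a) * U.normalFlux n (K, a) -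
            inner ℝ ((U.rho n K * U.z n (M.face K a₀)) • U.u n (M.face K a₀)) (M.normal K a)))
        (B := C ^ 2) (O := O) (by
          have h1 := abs_faceArea_mul_sub_faceIntegral_le hg.continuous hLip hΛ K a (hxc K)
          rw [abs_div, abs_of_pos hSpos, div_le_iff₀ hSpos]
          refine h1.trans (mul_le_mul (mul_le_mul_of_nonneg_left hHK hΛ) haS
            (M.faceArea_pos K a).le (by positivity))) (by
          rw [abs_mul, abs_of_pos hSpos]
          refine mul_le_mul_of_nonneg_left ?_ hS0
          exact (hU.abs_z_mul_normalFlux_sub_le hn hC hρ hz hu a₀ hK a).trans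
            (mul_le_mul_of_nonneg_left ha (by positivity))) hθK hΛ (by positivity) hO
      rw [div_mul_eq_mul_div, mul_div_assoc, mul_div_cancel_left₀ _ hSpos.ne'] at hR3
      have hR1 := abs_mul_le_of_mul_le (y := U.z n (M.face K a) *
          (1 / (2 * (d : ℝ)) * ∑ c, U.massFlux n K c)) (B := C ^ 2 * (1 / (2 * d))) (O := O) hw (by
          have h1 := hU.abs_sum_massFlux_le hn hC hρ hu a₀ hK
          rw [← hS, ← hOdef] at h1
          have hd2 : (0 : ℝ) < 1 / (2 * d) := by positivity
          rw [abs_mul, abs_mul, abs_of_pos hd2]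
          refine (mul_le_mul (hz _) (mul_le_mul_of_nonneg_left h1 hd2.le) (by positivity)
            hC).trans (le_of_eq ?_)
          ring) hθK hΛ (by positivity) hO
      have hR2 := abs_mul_le_of_mul_le hw
        (hU.abs_sum_dualFlux_mul_le hn hC hX hρ hu hξ a₀ K a) hθK hΛ (by positivity) hO
      refine (abs_add_le _ _).trans ((add_le_add_left (abs_add_le _ _) _).trans ?_)
      rw [abs_mul (1 / 2 : ℝ), abs_mul (1 / 2 : ℝ), abs_of_pos (by norm_num : (0 : ℝ) < 1 / 2)]
      refine (add_le_add (add_le_add hR3 (mul_le_mul_of_nonneg_left hR1 (by norm_num)))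
        (mul_le_mul_of_nonneg_left hR2 (by norm_num))).trans (le_of_eq ?_)
      rw [← hOdef]
      ring
  -- The bound for a face involves the oscillation of the whole cell, which is thus counted once per
  -- face: hence the factor `2 * d`.
  refine (Finset.sum_le_sum fun q _ => key q).trans (le_of_eq ?_)
  rw [← Finset.mul_sum, Fintype.sum_prod_type, Fintype.sum_prod_type]
  simp only [Finset.sum_const, Finset.card_univ, hcard, nsmul_eq_mul, ← Finset.mul_sum]
  push_cast
  ring

end Unknowns

end StaggeredFV

/-! ### Bounded `L¹` convergence and oscillation of piecewise constant functions -/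

namespace StaggeredFV

variable {d : ℕ} {Ω : Set (Space d)} {T : ℝ}

section Convergence

variable {V : Type} [NormedAddCommGroup V] {f : ℕ → Space d × ℝ → V} {g : Space d × ℝ → V}

theorem ae_norm_le_of_eLpNorm_top_le {α : Type*} [MeasurableSpace α] {μ : Measure α} {h : α → V}
    {C : ℝ≥0} (hC : eLpNorm h ⊤ μ ≤ C) : ∀ᵐ x ∂μ, ‖h x‖ ≤ C := by
  rw [eLpNorm_exponent_top] at hC
  filter_upwards [ae_le_eLpNormEssSup (f := h) (μ := μ)] with x hx
  have := hx.trans hC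
  rwa [enorm_le_coe] at this

/-- A subsequence converges almost everywhere, so the limit inherits the bound. -/
theorem ConvergesBounded.ae_norm_le (h : ConvergesBounded Ω T f g)
    (hf : ∀ m, AEStronglyMeasurable (f m) (spaceTime Ω T)) {C : ℝ≥0}
    (hC : ∀ m, eLpNorm (f m) ⊤ (spaceTime Ω T) ≤ C) : ∀ᵐ p ∂spaceTime Ω T, ‖g p‖ ≤ C := by
  have h1 := tendstoInMeasure_of_tendsto_eLpNorm one_ne_zero hf h.integrable.aestronglyMeasurable
    h.tendsto
  obtain ⟨ns, _, hns⟩ := h1.exists_seq_tendsto_ae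
  have h2 : ∀ᵐ p ∂spaceTime Ω T, ∀ m, ‖f m p‖ ≤ C :=
    ae_all_iff.2 fun m => ae_norm_le_of_eLpNorm_top_le (hC m)
  filter_upwards [hns, h2] with p hp hp2
  exact le_of_tendsto hp.norm (Eventually.of_forall fun k => hp2 _)

/-- Products pass to the limit through `a f - b g = a (f - g) + (a - b) g`, with `a` and the limit
`g` bounded. -/
theorem ConvergesBounded.smul [NormedSpace ℝ V] {a : ℕ → Space d × ℝ → ℝ} {b : Space d × ℝ → ℝ}
    (ha : ConvergesBounded Ω T a b) (hf : ConvergesBounded Ω T f g)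
    (ham : ∀ m, AEStronglyMeasurable (a m) (spaceTime Ω T))
    (hfm : ∀ m, AEStronglyMeasurable (f m) (spaceTime Ω T)) :
    ConvergesBounded Ω T (fun m p => a m p • f m p) (fun p => b p • g p) := by
  obtain ⟨A, hA⟩ := ha.bounded
  obtain ⟨B, hB⟩ := hf.bounded
  have hb := ha.ae_norm_le ham hA
  have hg := hf.ae_norm_le hfm hB
  refine ⟨?_, ?_, ⟨A * B, fun m => ?_⟩⟩
  · exact hf.integrable.bdd_smul A ha.integrable.aestronglyMeasurable hb
  · have hlim : Tendsto (fun m => (A : ℝ≥0∞) * eLpNorm (f m - g) 1 (spaceTime Ω T) +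
        (B : ℝ≥0∞) * eLpNorm (a m - b) 1 (spaceTime Ω T)) atTop (𝓝 0) := by
      have h1 := ENNReal.Tendsto.const_mul (a := (A : ℝ≥0∞)) hf.tendsto
        (Or.inr ENNReal.coe_ne_top)
      have h2 := ENNReal.Tendsto.const_mul (a := (B : ℝ≥0∞)) ha.tendsto
        (Or.inr ENNReal.coe_ne_top)
      simpa using h1.add h2
    refine tendsto_of_tendsto_of_tendsto_of_le_of_le tendsto_const_nhds hlim
      (fun _ => bot_le) fun m => ?_
    have heq : ((fun p => a m p • f m p) - fun p => b p • g p) =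
        (fun p => a m p • (f m - g) p) + fun p => (a m - b) p • g p := by
      ext p
      simp only [Pi.sub_apply, Pi.add_apply, smul_sub, sub_smul]
      abel
    change eLpNorm ((fun p => a m p • f m p) - fun p => b p • g p) 1 (spaceTime Ω T) ≤ _
    rw [heq]
    refine (eLpNorm_add_le ((ham m).smul ((hfm m).sub hf.integrable.aestronglyMeasurable))
      (((ham m).sub ha.integrable.aestronglyMeasurable).smul hf.integrable.aestronglyMeasurable)
      le_rfl).trans (add_le_add ?_ ?_)
    · refine eLpNorm_le_nnreal_smul_eLpNorm_of_ae_le_mul ?_ 1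
      filter_upwards [ae_norm_le_of_eLpNorm_top_le (hA m)] with p hp
      rw [← NNReal.coe_le_coe, NNReal.coe_mul, coe_nnnorm, coe_nnnorm, Pi.smul_apply', norm_smul]
      gcongr
    · refine eLpNorm_le_nnreal_smul_eLpNorm_of_ae_le_mul ?_ 1
      filter_upwards [hg] with p hp
      rw [← NNReal.coe_le_coe, NNReal.coe_mul, coe_nnnorm, coe_nnnorm, Pi.smul_apply', norm_smul, mul_comm]
      gcongr
  · rw [eLpNorm_exponent_top]
    refine eLpNormEssSup_le_of_ae_bound ?_ |>.trans_eq (b := ENNReal.ofReal (A * B)) ?_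
    · filter_upwards [ae_norm_le_of_eLpNorm_top_le (hA m), ae_norm_le_of_eLpNorm_top_le (hB m)]
        with p h1 h2
      rw [norm_smul]
      gcongr
    · rw [← NNReal.coe_mul, ENNReal.ofReal_coe_nnreal]

theorem ConvergesBounded.tendsto_integral_norm_sub (h : ConvergesBounded Ω T f g)
    (hf : ∀ m, Integrable (f m) (spaceTime Ω T)) :
    Tendsto (fun m => ∫ p, ‖f m p - g p‖ ∂spaceTime Ω T) atTop (𝓝 0) := by
  have h1 := (ENNReal.tendsto_toReal ENNReal.zero_ne_top).comp h.tendsto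
  rw [ENNReal.toReal_zero] at h1
  refine h1.congr fun m => ?_
  simp only [Function.comp_apply]
  rw [eLpNorm_one_eq_lintegral_enorm, ← integral_norm_eq_lintegral_enorm
    ((hf m).sub h.integrable).aestronglyMeasurable]
  rfl

end Convergence

section Oscillation

variable {X V ι : Type*} [MeasurableSpace X] {ν μ : Measure X} [NormedAddCommGroup V]
  [Fintype ι] {E : ι → Set X}

theorem integral_eq_sum_setIntegral (hμ : μ = Measure.sum fun i => ν.restrict (E i))
    {V : Type*} [NormedAddCommGroup V] [NormedSpace ℝ V] {f : X → V} (hf : Integrable f μ) :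
    ∫ x, f x ∂μ = ∑ i, ∫ x in E i, f x ∂ν := by
  rw [Measure.sum_fintype] at hμ
  subst hμ
  refine integral_finsetSum_measure fun i _ => hf.mono_measure ?_
  rw [← Measure.sum_fintype]
  exact Measure.le_sum _ i

theorem sum_measureReal_mul_norm_sub_le [IsFiniteMeasure μ]
    (hμ : μ = Measure.sum fun i => ν.restrict (E i))
    (hE : ∀ i, MeasurableSet (E i)) {f ψ : X → V} {v c : ι → V} {κ : ℝ}
    (hv : ∀ i, ∀ᵐ x ∂ν.restrict (E i), f x = v i) (hψ : ∀ i, ∀ x ∈ E i, ‖ψ x - c i‖ ≤ κ)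
    (hfψ : Integrable (fun x => f x - ψ x) μ) :
    ∑ i, ν.real (E i) * ‖v i - c i‖ ≤ ∫ x, ‖f x - ψ x‖ ∂μ + κ * μ.real Set.univ := by
  have hle : ∀ i, ν.restrict (E i) ≤ μ := fun i => by rw [hμ]; exact Measure.le_sum _ i
  have h1 : ∫ x, (‖f x - ψ x‖ + κ) ∂μ = ∫ x, ‖f x - ψ x‖ ∂μ + κ * μ.real Set.univ := by
    rw [integral_add hfψ.norm (integrable_const _), integral_const, smul_eq_mul, mul_comm]
  rw [← h1]
  refine le_of_le_of_eq ?_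
    (integral_eq_sum_setIntegral hμ (hfψ.norm.add (integrable_const κ))).symm
  refine Finset.sum_le_sum fun i _ => ?_
  have hfin : IsFiniteMeasure (ν.restrict (E i)) := isFiniteMeasure_of_le μ (hle i)
  have h2 : ν.real (E i) * ‖v i - c i‖ = ∫ _ in E i, ‖v i - c i‖ ∂ν := by
    rw [setIntegral_const, smul_eq_mul]
  rw [h2]
  refine integral_mono_ae (integrable_const _)
    ((hfψ.mono_measure (hle i)).norm.add (integrable_const κ)) ?_
  filter_upwards [hv i, ae_restrict_mem (hE i)] with x hx hxE
  have h3 := hψ i x hxE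
  have h4 : v i - c i = (f x - ψ x) + (ψ x - c i) := by rw [hx]; abel
  change ‖v i - c i‖ ≤ ‖f x - ψ x‖ + κ
  rw [h4]
  exact (norm_add_le _ _).trans (by linarith)

/-- The difference `v i - v (π i)` is routed through samples `c` of a slowly varying `ψ`. Hypothesis
`hπ` bounds the weighted error at `π i` by `Θ` times the total error. -/
theorem sum_measureReal_mul_norm_sub_comp_le [IsFiniteMeasure μ]
    (hμ : μ = Measure.sum fun i => ν.restrict (E i))
    (hE : ∀ i, MeasurableSet (E i)) {f ψ : X → V} {v c : ι → V} {κ Θ : ℝ} (π : ι → ι) (hΘ : 0 ≤ Θ)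
    (hv : ∀ i, ∀ᵐ x ∂ν.restrict (E i), f x = v i) (hψ : ∀ i, ∀ x ∈ E i, ‖ψ x - c i‖ ≤ κ)
    (hfψ : Integrable (fun x => f x - ψ x) μ) (hc : ∀ i, ‖c i - c (π i)‖ ≤ κ)
    (hπ : ∀ h : ι → ℝ, (∀ i, 0 ≤ h i) →
      ∑ i, ν.real (E i) * h (π i) ≤ Θ * ∑ i, ν.real (E i) * h i) :
    ∑ i, ν.real (E i) * ‖v i - v (π i)‖ ≤
      (1 + Θ) * (∫ x, ‖f x - ψ x‖ ∂μ + κ * μ.real Set.univ) + κ * μ.real Set.univ := by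
  have h1 := sum_measureReal_mul_norm_sub_le hμ hE hv hψ hfψ
  have h2 := hπ (fun i => ‖v i - c i‖) fun i => norm_nonneg _
  have h3 : ∑ i, ν.real (E i) = μ.real Set.univ := by
    have := integral_eq_sum_setIntegral hμ (integrable_const (μ := μ) (1 : ℝ))
    simpa using this.symm
  have h4 : ∑ i, ν.real (E i) * ‖v i - v (π i)‖ ≤ ∑ i, (ν.real (E i) * ‖v i - c i‖ +
      ν.real (E i) * ‖v (π i) - c (π i)‖ + κ * ν.real (E i)) := by
    refine Finset.sum_le_sum fun i _ => ?_
    have h5 : v i - v (π i) = (v i - c i) - (v (π i) - c (π i)) + (c i - c (π i)) := by abel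
    have h6 : ‖v i - v (π i)‖ ≤ ‖v i - c i‖ + ‖v (π i) - c (π i)‖ + κ := by
      rw [h5]
      exact (norm_add_le _ _).trans (add_le_add (norm_sub_le _ _) (hc i))
    have := mul_le_mul_of_nonneg_left h6 (measureReal_nonneg (μ := ν) (s := E i))
    linarith
  rw [Finset.sum_add_distrib, Finset.sum_add_distrib, ← Finset.mul_sum, h3] at h4
  have h7 := mul_le_mul_of_nonneg_left h1 hΘ
  linarith

end Oscillation

/-- The oscillation of a sequence of piecewise constant functions which converges in `L¹` tends to
zero, as the diameter of the pieces tends to zero. -/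
theorem tendsto_sum_measureReal_mul_norm_sub {X V : Type*} [PseudoMetricSpace X]
    [LocallyCompactSpace X] [R1Space X] [NormalSpace X]
    [MeasurableSpace X] [BorelSpace X] {ν μ : Measure X} [IsFiniteMeasure μ] [μ.Regular]
    [NormedAddCommGroup V] [NormedSpace ℝ V]
    {ι : ℕ → Type} [∀ m, Fintype (ι m)] {E : ∀ m, ι m → Set X}
    (hμ : ∀ m, μ = Measure.sum fun i => ν.restrict (E m i))
    (hE : ∀ m i, MeasurableSet (E m i)) {f : ℕ → X → V} {g : X → V} {v : ∀ m, ι m → V}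
    (hv : ∀ m i, ∀ᵐ x ∂ν.restrict (E m i), f m x = v m i)
    (hf : ∀ m, Integrable (f m) μ) (hg : Integrable g μ)
    (hfg : Tendsto (fun m => ∫ x, ‖f m x - g x‖ ∂μ) atTop (𝓝 0))
    (π : ∀ m, ι m → ι m) {Θ : ℝ} (hΘ : 0 ≤ Θ)
    (hπ : ∀ m, ∀ h : ι m → ℝ, (∀ i, 0 ≤ h i) →
      ∑ i, ν.real (E m i) * h (π m i) ≤ Θ * ∑ i, ν.real (E m i) * h i)
    (p : ∀ m, ι m → X) {η : ℕ → ℝ} (hη : Tendsto η atTop (𝓝 0))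
    (hp : ∀ m i, ∀ x ∈ E m i, dist x (p m i) ≤ η m)
    (hpπ : ∀ m i, dist (p m i) (p m (π m i)) ≤ η m) :
    Tendsto (fun m => ∑ i, ν.real (E m i) * ‖v m i - v m (π m i)‖) atTop (𝓝 0) := by
  set W := μ.real Set.univ with hW
  have hW0 : 0 ≤ W := measureReal_nonneg
  refine tendsto_order.2 ⟨fun a ha => Eventually.of_forall fun m => lt_of_lt_of_le ha
    (Finset.sum_nonneg fun i _ => by positivity), fun ε hε => ?_⟩
  -- One `δ` for the distance from `f m` to `g`, one for that from `g` to a continuous `ψ`, and the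
  -- terms `δ * W` for the variation of `ψ` at the scale of the pieces.
  obtain ⟨δ, hδ, hδε⟩ : ∃ δ > 0, (1 + Θ) * ((δ + δ) + δ * W) + δ * W < ε := by
    refine ⟨ε / (2 * ((1 + Θ) * (2 + W) + W + 1)), by positivity, ?_⟩
    have hpos : 0 < (1 + Θ) * (2 + W) + W + 1 := by positivity
    have : (1 + Θ) * ((ε / (2 * ((1 + Θ) * (2 + W) + W + 1)) +
        ε / (2 * ((1 + Θ) * (2 + W) + W + 1))) +
        ε / (2 * ((1 + Θ) * (2 + W) + W + 1)) * W) +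
        ε / (2 * ((1 + Θ) * (2 + W) + W + 1)) * W =
        ε / 2 * (((1 + Θ) * (2 + W) + W) / ((1 + Θ) * (2 + W) + W + 1)) := by
      field_simp
      ring
    rw [this]
    have h1 : ((1 + Θ) * (2 + W) + W) / ((1 + Θ) * (2 + W) + W + 1) ≤ 1 := by
      rw [div_le_one hpos]; linarith
    nlinarith
  obtain ⟨ψ, hψc, hψ, hψcont, hψi⟩ := hg.exists_hasCompactSupport_integral_sub_le hδ
  have hunif := hψc.uniformContinuous_of_continuous hψcont
  obtain ⟨r, hr, hψr⟩ := Metric.uniformContinuous_iff.1 hunif δ hδ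
  filter_upwards [hη.eventually (gt_mem_nhds hr), hfg.eventually (gt_mem_nhds hδ)] with m hm1 hm2
  refine lt_of_le_of_lt (sum_measureReal_mul_norm_sub_comp_le (hμ m) (hE m) (c := fun i => ψ (p m i))
    (ψ := ψ) (κ := δ) (π m) hΘ (hv m) ?_ ((hf m).sub hψi) ?_ (hπ m)) (lt_of_le_of_lt ?_ hδε)
  · intro i x hx
    rw [← dist_eq_norm]
    exact (hψr ((hp m i x hx).trans_lt hm1)).le
  · intro i
    rw [← dist_eq_norm]
    exact (hψr ((hpπ m i).trans_lt hm1)).le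
  · have h1 : ∫ x, ‖f m x - ψ x‖ ∂μ ≤ ∫ x, (‖f m x - g x‖ + ‖g x - ψ x‖) ∂μ := by
      refine integral_mono ((hf m).sub hψi).norm (((hf m).sub hg).norm.add (hg.sub hψi).norm)
        fun x => ?_
      change ‖f m x - ψ x‖ ≤ ‖f m x - g x‖ + ‖g x - ψ x‖
      have h2 := norm_add_le (f m x - g x) (g x - ψ x)
      rwa [sub_add_sub_cancel] at h2
    have h2 : ∫ x, ‖f m x - ψ x‖ ∂μ ≤ δ + δ := h1.trans
      ((integral_add ((hf m).sub hg).norm (hg.sub hψi).norm).trans_le (add_le_add hm2.le hψ))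
    gcongr

end StaggeredFV

/-! ### The partition of space-time into half-diamonds times time steps -/

namespace StaggeredFV

variable {d : ℕ} {Ω : Set (Space d)}

theorem IsPolyhedral.volume_frontier (h : IsPolyhedral Ω) : volume (frontier Ω) = 0 := by
  obtain ⟨H, hH, hfr⟩ := h
  refine measure_mono_null (t := ⋃ h ∈ H, {x | inner ℝ h.1 x = h.2}) (fun x hx => ?_) ?_
  · obtain ⟨h, hh, hx⟩ := hfr x hx
    exact Set.mem_biUnion hh hx
  · exact (measure_biUnion_null_iff H.countable_toSet).2 fun h hh => volume_plane (hH h hh) _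

theorem isFiniteMeasure_spaceTime (hΩb : Bornology.IsBounded Ω) (T : ℝ) :
    IsFiniteMeasure (spaceTime Ω T) := by
  refine ⟨?_⟩
  rw [spaceTime, Measure.restrict_apply_univ, Measure.volume_eq_prod, Measure.prod_prod]
  exact ENNReal.mul_lt_top hΩb.measure_lt_top (by simp)

theorem notMem_Ico_of_ne {n n' : ℕ} (h : n ≠ n') {τ t : ℝ} (hτ : 0 < τ)
    (ht : t ∈ Set.Ico (n * τ) ((n + 1) * τ)) : t ∉ Set.Ico (n' * τ) ((n' + 1) * τ) := by
  intro ht'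
  have h1 : (n : ℝ) < n' + 1 := lt_of_mul_lt_mul_right (ht.1.trans_lt ht'.2) hτ.le
  have h2 : (n' : ℝ) < n + 1 := lt_of_mul_lt_mul_right (ht'.1.trans_lt ht.2) hτ.le
  have h3 : n < n' + 1 := by exact_mod_cast h1
  have h4 : n' < n + 1 := by exact_mod_cast h2
  omega

theorem iUnion_Ico_mul {τ : ℝ} (hτ : 0 < τ) (N : ℕ) :
    ⋃ n : Fin N, Set.Ico (n * τ) (((n : ℕ) + 1) * τ) = Set.Ico 0 (N * τ) := by
  ext t
  simp only [Set.mem_iUnion, Set.mem_Ico]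
  constructor
  · rintro ⟨n, h1, h2⟩
    refine ⟨le_trans (by positivity) h1, h2.trans_le ?_⟩
    have : ((n : ℕ) : ℝ) + 1 ≤ N := by exact_mod_cast n.2
    gcongr
  · rintro ⟨h1, h2⟩
    have h3 : 0 ≤ t / τ := by positivity
    refine ⟨⟨⌊t / τ⌋₊, (Nat.floor_lt h3).2 (by rwa [div_lt_iff₀ hτ])⟩, ?_, ?_⟩
    · exact (le_div_iff₀ hτ).1 (Nat.floor_le h3)
    · exact (div_lt_iff₀ hτ).1 (Nat.lt_floor_add_one _)

namespace Mesh

variable (M : Mesh d Ω)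

theorem volume_half_inter {q q' : Fin M.numCells × LocalFace d} (h : q ≠ q') :
    volume (M.half q.1 q.2 ∩ M.half q'.1 q'.2) = 0 := by
  obtain ⟨K, a⟩ := q
  obtain ⟨L, b⟩ := q'
  by_cases hKL : K = L
  · subst hKL
    exact M.half_disjoint K a b fun hab => h (by rw [hab])
  · exact measure_mono_null (Set.inter_subset_inter (M.half_subset K a) (M.half_subset L b))
      (M.volume_cell_inter hKL)

theorem volume_half_pos (hd : 1 ≤ d) (K : Fin M.numCells) (a : LocalFace d) :
    0 < volume (M.half K a) := by
  rw [M.volume_half]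
  exact ENNReal.div_pos (M.volume_cell_pos hd K).ne'
    (ENNReal.mul_ne_top (by simp) (ENNReal.natCast_ne_top d))

theorem volume_real_half (K : Fin M.numCells) (a : LocalFace d) :
    volume.real (M.half K a) = M.vol K / (2 * d) := by
  rw [Measure.real, M.volume_half, ENNReal.toReal_div, vol]
  simp

theorem volume_cell_diff_iUnion_half (hd : 1 ≤ d) (K : Fin M.numCells) :
    volume (M.cell K \ ⋃ a, M.half K a) = 0 := by
  have h1 : volume (⋃ a, M.half K a) = volume (M.cell K) := by
    rw [measure_iUnion₀ (fun a b hab => M.half_disjoint K a b hab)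
      fun a => (M.measurableSet_half K a).nullMeasurableSet, tsum_fintype]
    simp_rw [M.volume_half]
    rw [Finset.sum_const, Finset.card_univ, nsmul_eq_mul]
    have : (Fintype.card (LocalFace d) : ℝ≥0∞) = 2 * d := by
      simp [LocalFace, mul_comm]
    rw [this, ENNReal.mul_div_cancel]
    · simpa using (by omega : d ≠ 0)
    · exact ENNReal.mul_ne_top (by simp) (ENNReal.natCast_ne_top d)
  rw [measure_sdiff (Set.iUnion_subset fun a => M.half_subset K a)
    (MeasurableSet.iUnion fun a => M.measurableSet_half K a).nullMeasurableSet, h1, tsub_self]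
  rw [h1]; exact M.volume_cell_ne_top K

/-- The cells cover `closure Ω`, and the excess over the open set `Ω` lies in its frontier, which is
null because it is contained in finitely many hyperplanes. -/
theorem iUnion_half_ae_eq (hd : 1 ≤ d) (hΩo : IsOpen Ω) (hΩp : IsPolyhedral Ω) :
    (⋃ q : Fin M.numCells × LocalFace d, M.half q.1 q.2 : Set (Space d)) =ᵐ[volume] Ω := by
  rw [ae_eq_set]
  constructor
  · refine measure_mono_null (fun x hx => ?_) hΩp.volume_frontier
    obtain ⟨q, hq⟩ := Set.mem_iUnion.1 hx.1
    rw [hΩo.frontier_eq]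
    refine ⟨?_, hx.2⟩
    rw [← M.iUnion_cell]
    exact Set.mem_iUnion.2 ⟨q.1, M.half_subset _ _ hq⟩
  · refine measure_mono_null (t := ⋃ K, (M.cell K \ ⋃ a, M.half K a)) (fun x hx => ?_)
      (measure_iUnion_null fun K => M.volume_cell_diff_iUnion_half hd K)
    have h1 : x ∈ ⋃ K, M.cell K := by rw [M.iUnion_cell]; exact subset_closure hx.1
    obtain ⟨K, hK⟩ := Set.mem_iUnion.1 h1
    refine Set.mem_iUnion.2 ⟨K, hK, fun h => hx.2 ?_⟩
    obtain ⟨a, ha⟩ := Set.mem_iUnion.1 h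
    exact Set.mem_iUnion.2 ⟨(K, a), ha⟩

/-- The product of a half-diamond cell and of a time step. -/
def box (T : ℝ) (N : ℕ) (i : Fin N × (Fin M.numCells × LocalFace d)) : Set (Space d × ℝ) :=
  M.half i.2.1 i.2.2 ×ˢ Set.Ico (((i.1 : ℕ) : ℝ) * (T / N)) ((((i.1 : ℕ) : ℝ) + 1) * (T / N))

theorem measurableSet_box (T : ℝ) (N : ℕ) (i : Fin N × (Fin M.numCells × LocalFace d)) :
    MeasurableSet (M.box T N i) := (M.measurableSet_half _ _).prod measurableSet_Ico

variable {T : ℝ} {N : ℕ}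

theorem volume_box (i : Fin N × (Fin M.numCells × LocalFace d)) :
    volume (M.box T N i) = volume (M.half i.2.1 i.2.2) * ENNReal.ofReal (T / N) := by
  rw [box, Measure.volume_eq_prod, Measure.prod_prod, Real.volume_Ico]
  congr 2; ring

theorem volume_real_box (hT : 0 < T) (i : Fin N × (Fin M.numCells × LocalFace d)) :
    volume.real (M.box T N i) = M.vol i.2.1 / (2 * d) * (T / N) := by
  rw [Measure.real, volume_box, ENNReal.toReal_mul, ENNReal.toReal_ofReal (by positivity),
    ← volume_real_half M i.2.1 i.2.2]
  rfl

/-- On each box all discrete functions are almost everywhere constant, so this decomposition turns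
integrals over space-time into the sums of the scheme. -/
theorem spaceTime_eq_sum (hd : 1 ≤ d) (hΩo : IsOpen Ω) (hΩp : IsPolyhedral Ω) (hT : 0 < T)
    (hN : 0 < N) :
    spaceTime Ω T = Measure.sum fun i => volume.restrict (M.box T N i) := by
  have hN' : (0 : ℝ) < N := by exact_mod_cast hN
  have hτ : 0 < T / N := by positivity
  have h1 : ⋃ i, M.box T N i =
      (⋃ q : Fin M.numCells × LocalFace d, M.half q.1 q.2) ×ˢ Set.Ico 0 T := by
    have h2 := iUnion_Ico_mul hτ N
    rw [mul_div_cancel₀ T hN'.ne'] at h2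
    rw [← h2]
    ext p
    simp only [box, Set.mem_iUnion, Set.mem_prod]
    constructor
    · rintro ⟨i, h1, h2⟩; exact ⟨⟨i.2, h1⟩, i.1, h2⟩
    · rintro ⟨⟨q, h1⟩, n, h2⟩; exact ⟨(n, q), h1, h2⟩
  rw [← Measure.restrict_iUnion_ae, h1]
  · refine (Measure.restrict_congr_set ?_).symm
    exact Measure.set_prod_ae_eq (M.iUnion_half_ae_eq hd hΩo hΩp) Ioo_ae_eq_Ico.symm
  · intro i j hij
    by_cases hn : i.1 = j.1
    · have hq : i.2 ≠ j.2 := fun h => hij (Prod.ext hn h)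
      have hsub : M.box T N i ∩ M.box T N j ⊆
          (M.half i.2.1 i.2.2 ∩ M.half j.2.1 j.2.2) ×ˢ Set.univ :=
        fun p hp => ⟨⟨hp.1.1, hp.2.1⟩, trivial⟩
      refine measure_mono_null hsub ?_
      rw [Measure.volume_eq_prod, Measure.prod_prod, M.volume_half_inter hq, zero_mul]
    · have : M.box T N i ∩ M.box T N j = ∅ := by
        ext p
        simp only [Set.mem_inter_iff, Set.mem_empty_iff_false, iff_false]
        rintro ⟨h1, h2⟩
        exact notMem_Ico_of_ne (fun h => hn (Fin.ext h)) hτ h1.2 h2.2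
      change volume (M.box T N i ∩ M.box T N j) = 0
      rw [this, measure_empty]
  · exact fun i => (M.measurableSet_box T N i).nullMeasurableSet

theorem measurable_discreteFun {ι V : Type} [Fintype ι] [NormedAddCommGroup V]
    [MeasurableSpace V] [BorelSpace V] [SecondCountableTopology V] {A : ι → Set (Space d)}
    (hA : ∀ i, MeasurableSet (A i)) (v : ℕ → ι → V) :
    Measurable (discreteFun A T N v) := by
  unfold discreteFun
  refine Finset.measurable_fun_sum _ fun n _ => Finset.measurable_fun_sum _ fun i _ => ?_
  exact measurable_const.indicator ((hA i).prod measurableSet_Ico)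

theorem discreteFun_ae_eq {ι V : Type} [Fintype ι] [NormedAddCommGroup V] {A : ι → Set (Space d)}
    (hT : 0 < T) (v : ℕ → ι → V) (i : Fin N × (Fin M.numCells × LocalFace d)) (j : ι)
    (hj : M.half i.2.1 i.2.2 ⊆ A j)
    (h0 : ∀ k, k ≠ j → volume (M.half i.2.1 i.2.2 ∩ A k) = 0) :
    ∀ᵐ p ∂volume.restrict (M.box T N i), discreteFun A T N v p = v i.1 j := by
  have hN : 0 < N := i.1.pos
  have hN' : (0 : ℝ) < N := by exact_mod_cast hN
  have hτ : 0 < T / N := by positivity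
  have h1 : ∀ᵐ p ∂volume.restrict (M.box T N i), ∀ k, k ≠ j → p.1 ∉ A k := by
    refine ae_all_iff.2 fun k => ?_
    by_cases hk : k = j
    · exact ae_of_all _ fun p h => absurd hk h
    · rw [ae_restrict_iff' (M.measurableSet_box T N i)]
      have h2 : volume ((M.half i.2.1 i.2.2 ∩ A k) ×ˢ (Set.univ : Set ℝ)) = 0 := by
        rw [Measure.volume_eq_prod, Measure.prod_prod, h0 k hk, zero_mul]
      filter_upwards [measure_eq_zero_iff_ae_notMem.1 h2] with p hp hpi _ hpk
      exact hp ⟨⟨hpi.1, hpk⟩, trivial⟩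
  filter_upwards [h1, ae_restrict_mem (M.measurableSet_box T N i)] with p hp hpi
  unfold discreteFun
  rw [Finset.sum_eq_single (i.1 : ℕ), Finset.sum_eq_single j]
  · exact Set.indicator_of_mem (show p ∈ _ ×ˢ _ from ⟨hj hpi.1, hpi.2⟩) _
  · intro k _ hk
    exact Set.indicator_of_notMem (fun h => hp k hk h.1) _
  · simp
  · intro n _ hn
    refine Finset.sum_eq_zero fun k _ => Set.indicator_of_notMem (fun h => ?_) _
    exact notMem_Ico_of_ne hn hτ h.2 hpi.2
  · intro h; exact absurd (Finset.mem_range.2 i.1.2) h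

theorem discreteFun_cell_ae_eq {V : Type} [NormedAddCommGroup V] (hT : 0 < T)
    (v : ℕ → Fin M.numCells → V) (i : Fin N × (Fin M.numCells × LocalFace d)) :
    ∀ᵐ p ∂volume.restrict (M.box T N i), discreteFun M.cell T N v p = v i.1 i.2.1 :=
  M.discreteFun_ae_eq hT v i i.2.1 (M.half_subset _ _) fun _ hL =>
    measure_mono_null (Set.inter_subset_inter_left _ (M.half_subset _ _))
      (M.volume_cell_inter hL.symm)

theorem half_subset_dualCell (q : Fin M.numCells × LocalFace d) :
    M.half q.1 q.2 ⊆ M.dualCell (M.face q.1 q.2) := fun _ hx =>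
  Set.mem_iUnion.2 ⟨q.1, Set.mem_iUnion.2 ⟨q.2, Set.mem_iUnion.2 ⟨rfl, hx⟩⟩⟩

theorem measurableSet_dualCell (σ : Fin M.numFaces) : MeasurableSet (M.dualCell σ) :=
  MeasurableSet.iUnion fun K => MeasurableSet.iUnion fun a => MeasurableSet.iUnion fun _ =>
    M.measurableSet_half K a

theorem discreteFun_dualCell_ae_eq {V : Type} [NormedAddCommGroup V] (hT : 0 < T)
    (v : ℕ → Fin M.numFaces → V) (i : Fin N × (Fin M.numCells × LocalFace d)) :
    ∀ᵐ p ∂volume.restrict (M.box T N i),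
      discreteFun M.dualCell T N v p = v i.1 (M.face i.2.1 i.2.2) := by
  refine M.discreteFun_ae_eq hT v i _ (M.half_subset_dualCell i.2) fun σ hσ => ?_
  refine measure_mono_null (t := ⋃ q' : {q' // q' ≠ i.2},
    (M.half i.2.1 i.2.2 ∩ M.half q'.1.1 q'.1.2)) ?_
    (measure_iUnion_null fun q' => M.volume_half_inter q'.2.symm)
  rintro x ⟨hx, hxσ⟩
  simp only [dualCell, Set.mem_iUnion] at hxσ
  obtain ⟨K, a, hKa, hxK⟩ := hxσ
  refine Set.mem_iUnion.2 ⟨⟨(K, a), ?_⟩, hx, hxK⟩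
  rintro h
  exact hσ (by rw [← hKa, ← h])

/-- Boxes have positive measure, so an essential bound on a discrete function bounds every
individual unknown. -/
theorem norm_le_of_eLpNorm_le {V : Type} [NormedAddCommGroup V] (hd : 1 ≤ d) (hΩo : IsOpen Ω)
    (hΩp : IsPolyhedral Ω) (hT : 0 < T) {f : Space d × ℝ → V} {C : ℝ≥0}
    (hf : eLpNorm f ⊤ (spaceTime Ω T) ≤ C) (i : Fin N × (Fin M.numCells × LocalFace d)) {v : V}
    (hv : ∀ᵐ p ∂volume.restrict (M.box T N i), f p = v) : ‖v‖ ≤ C := by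
  have hN' : (0 : ℝ) < N := by exact_mod_cast i.1.pos
  have h1 := ae_norm_le_of_eLpNorm_top_le hf
  rw [M.spaceTime_eq_sum hd hΩo hΩp hT i.1.pos] at h1
  have h2 : ∀ᵐ p ∂volume.restrict (M.box T N i), ‖f p‖ ≤ C :=
    h1.filter_mono (ae_mono (Measure.le_sum _ i))
  have h3 : (volume.restrict (M.box T N i)) ≠ 0 := by
    rw [Ne, Measure.restrict_eq_zero, volume_box]
    refine mul_ne_zero (M.volume_half_pos hd _ _).ne' ?_
    rw [Ne, ENNReal.ofReal_eq_zero, not_le]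
    positivity
  have := ae_neBot.2 h3
  obtain ⟨p, hp1, hp2⟩ := (h2.and hv).exists
  rwa [← hp2]

end Mesh

end StaggeredFV

/-! ### Mesh regularity and vanishing oscillation -/

namespace StaggeredFV

variable {d : ℕ} {Ω : Set (Space d)}

namespace Mesh

variable (M : Mesh d Ω)

theorem diam_le_size (K : Fin M.numCells) : M.diam K ≤ M.size :=
  le_ciSup (Set.finite_range M.diam).bddAbove K

theorem diam_nonneg (K : Fin M.numCells) : 0 ≤ M.diam K := Metric.diam_nonneg

theorem size_nonneg : 0 ≤ M.size := Real.iSup_nonneg M.diam_nonneg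

theorem dist_le_size {K : Fin M.numCells} {x y : Space d} (hx : x ∈ M.cell K) (hy : y ∈ M.cell K) :
    dist x y ≤ M.size :=
  (Metric.dist_le_diam_of_mem (M.isCompact_cell K).isBounded hx hy).trans (M.diam_le_size K)

theorem dist_le_two_mul_size {q : Fin M.numCells × LocalFace d} {x y : Space d}
    (hx : x ∈ M.cell (M.opp q).1) (hy : y ∈ M.cell q.1) : dist x y ≤ 2 * M.size := by
  have := Unknowns.dist_opp_le hx hy
  have := M.diam_le_size q.1
  have := M.diam_le_size (M.opp q).1
  linarith

variable {M}

/-- The constant is `θ + 1` rather than `θ` because for an external face `opp q = q`, and `θ` alone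
could be smaller than `1`. -/
theorem vol_le_mul_vol_opp (hd : 1 ≤ d) {θ : ℝ} (hθ : M.theta1 ≤ θ) (hθ0 : 0 ≤ θ)
    (q : Fin M.numCells × LocalFace d) : M.vol q.1 ≤ (θ + 1) * M.vol (M.opp q).1 := by
  have hpos := M.vol_pos hd (M.opp q).1
  by_cases hq : M.IsInternal (M.face q.1 q.2)
  · have h1 := le_ciSup (f := fun q : Fin M.numCells × Fin M.numCells =>
      open Classical in if ∃ σ, M.Separates σ q.1 q.2 then M.vol q.1 / M.vol q.2 else 0)
      (Set.finite_range _).bddAbove (q.1, (M.opp q).1)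
    have h2 : ∃ σ, M.Separates σ q.1 (M.opp q).1 := ⟨_, separates_opp hq⟩
    dsimp only at h1
    rw [if_pos h2, div_le_iff₀ hpos] at h1
    refine h1.trans (mul_le_mul_of_nonneg_right ?_ hpos.le)
    change M.theta1 ≤ θ + 1
    linarith
  · rw [opp_of_not_isInternal hq] at hpos ⊢
    nlinarith

open Classical in
theorem sum_faceArea_mul_diam_le (hd : 1 ≤ d) {θ : ℝ} (hθ : M.theta2 ≤ θ)
    {q : Fin M.numCells × LocalFace d} (hq : M.IsInternal (M.face q.1 q.2)) :
    (∑ a, M.faceArea q.1 a) * (M.diam q.1 + M.diam (M.opp q).1) ≤ θ * M.vol q.1 := by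
  have hpos := M.vol_pos hd q.1
  have hS0 : 0 ≤ ∑ a, M.faceArea q.1 a :=
    Finset.sum_nonneg fun b _ => (M.faceArea_pos q.1 b).le
  let D : Fin M.numCells → Fin M.numCells → ℝ := fun K L =>
    if ∃ σ, M.Separates σ K L then M.diam K + M.diam L else 0
  let A : Fin M.numCells → ℝ := fun K => (∑ a, M.faceArea K a) / M.vol K * ⨆ L, D K L
  have h1 : D q.1 (M.opp q).1 ≤ ⨆ L, D q.1 L :=
    le_ciSup (Set.finite_range (D q.1)).bddAbove (M.opp q).1
  have h2 : D q.1 (M.opp q).1 = M.diam q.1 + M.diam (M.opp q).1 :=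
    if_pos ⟨_, separates_opp hq⟩
  have h3 : A q.1 ≤ ⨆ K, A K := le_ciSup (Set.finite_range A).bddAbove q.1
  have h4 : ⨆ K, A K = M.theta2 := rfl
  rw [h4] at h3
  have h5 : (∑ a, M.faceArea q.1 a) / M.vol q.1 * D q.1 (M.opp q).1 ≤ θ :=
    (mul_le_mul_of_nonneg_left h1 (div_nonneg hS0 hpos.le)).trans (h3.trans hθ)
  rwa [h2, div_mul_eq_mul_div, div_le_iff₀ hpos] at h5

variable {T : ℝ} {N : ℕ}

theorem dist_le_of_mem_box {i : Fin N × (Fin M.numCells × LocalFace d)} {p : Space d × ℝ}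
    (hp : p ∈ M.box T N i) {x : Space d} (hx : x ∈ M.cell i.2.1) :
    dist p (x, ((i.1 : ℕ) : ℝ) * (T / N)) ≤ M.size + T / N := by
  have h1 := M.dist_le_size (M.half_subset _ _ hp.1) hx
  have h2 := hp.2.1
  have h3 := hp.2.2
  have h4 := M.size_nonneg
  rw [Prod.dist_eq]
  refine max_le ?_ ?_
  · dsimp only; linarith
  · rw [Real.dist_eq, abs_le]; dsimp only; constructor <;> linarith

/-- After reindexing the right-hand side by `opp`, the inequality reduces to the comparison of
volumes of adjacent cells. -/
theorem sum_volume_real_box_mul_opp_le (hd : 1 ≤ d) (hT : 0 < T) {θ : ℝ} (hθ : M.theta1 ≤ θ)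
    (hθ0 : 0 ≤ θ) (h : Fin N × (Fin M.numCells × LocalFace d) → ℝ) (hh : ∀ i, 0 ≤ h i) :
    ∑ i, volume.real (M.box T N i) * h (i.1, M.opp i.2) ≤
      (θ + 1) * ∑ i, volume.real (M.box T N i) * h i := by
  let F : Fin N × (Fin M.numCells × LocalFace d) → ℝ := fun i => volume.real (M.box T N i) * h i
  have h1 : ∑ i, F i = ∑ i : Fin N × (Fin M.numCells × LocalFace d), F (i.1, M.opp i.2) :=
    (Equiv.sum_comp ((Equiv.refl (Fin N)).prodCongr (opp_involutive (M := M)).toPerm) F).symm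
  change _ ≤ (θ + 1) * ∑ i, F i
  rw [h1, Finset.mul_sum]
  refine Finset.sum_le_sum fun i _ => ?_
  simp only [F]
  rw [← mul_assoc, volume_real_box M hT, volume_real_box M hT]
  refine mul_le_mul_of_nonneg_right ?_ (hh _)
  have h2 := vol_le_mul_vol_opp hd hθ hθ0 i.2
  have h3 : (θ + 1) * (M.vol (M.opp i.2).1 / (2 * d) * (T / N)) =
      (θ + 1) * M.vol (M.opp i.2).1 / (2 * d) * (T / N) := by ring
  dsimp only
  rw [h3]
  gcongr

/-- The `2 * d` half-diamonds of a cell have equal volumes, so the reference one is repeated `2 * d`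
times. -/
theorem sum_volume_real_box_mul_const_le (hT : 0 < T) (a₀ : LocalFace d)
    (h : Fin N × (Fin M.numCells × LocalFace d) → ℝ) (hh : ∀ i, 0 ≤ h i) :
    ∑ i, volume.real (M.box T N i) * h (i.1, (i.2.1, a₀)) ≤
      (2 * d) * ∑ i, volume.real (M.box T N i) * h i := by
  have hcard : Fintype.card (LocalFace d) = 2 * d := by simp [LocalFace, mul_comm]
  simp only [volume_real_box M hT, Fintype.sum_prod_type]
  rw [Finset.mul_sum]
  refine Finset.sum_le_sum fun n _ => ?_
  rw [Finset.mul_sum]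
  refine Finset.sum_le_sum fun K _ => ?_
  have hw : 0 ≤ M.vol K / (2 * d) * (T / N) := by
    have : 0 ≤ M.vol K := ENNReal.toReal_nonneg
    positivity
  rw [Fintype.sum_prod_type' (f := fun _ _ => M.vol K / (2 * d) * (T / N) * h (n, K, a₀)) |>.symm,
    Finset.sum_const, Finset.card_univ, hcard, nsmul_eq_mul]
  push_cast
  refine mul_le_mul_of_nonneg_left ?_ (by positivity)
  have h2 := Finset.single_le_sum
    (f := fun a : LocalFace d => M.vol K / (2 * d) * (T / N) * h (n, K, a))
    (fun a _ => mul_nonneg hw (hh _)) (Finset.mem_univ a₀)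
  simpa [Fintype.sum_prod_type] using h2

end Mesh

section Sequence

variable {T : ℝ} {M : ℕ → Mesh d Ω} {N : ℕ → ℕ}

theorem regular_spaceTime (hΩb : Bornology.IsBounded Ω) (T : ℝ) : (spaceTime Ω T).Regular := by
  have := isFiniteMeasure_spaceTime hΩb T
  infer_instance

theorem integrable_discreteFun {V : Type} [NormedAddCommGroup V] [MeasurableSpace V] [BorelSpace V]
    [SecondCountableTopology V] (hΩb : Bornology.IsBounded Ω) {ι : Type} [Fintype ι]
    {A : ι → Set (Space d)} (hA : ∀ i, MeasurableSet (A i)) (N : ℕ) (v : ℕ → ι → V) {C : ℝ≥0}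
    (hC : eLpNorm (Mesh.discreteFun A T N v) ⊤ (spaceTime Ω T) ≤ C) :
    Integrable (Mesh.discreteFun A T N v) (spaceTime Ω T) := by
  have := isFiniteMeasure_spaceTime hΩb T
  exact Integrable.of_bound (Mesh.measurable_discreteFun hA v).aestronglyMeasurable C
    (ae_norm_le_of_eLpNorm_top_le hC)

theorem tendsto_sum_norm_sub_of_convergesBounded {V : Type} [NormedAddCommGroup V]
    [NormedSpace ℝ V] (hd : 1 ≤ d) (hΩo : IsOpen Ω) (hΩb : Bornology.IsBounded Ω)
    (hΩp : IsPolyhedral Ω) (hT : 0 < T) (hN : ∀ m, 0 < N m)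
    (hsize : Tendsto (fun m => (M m).size) atTop (𝓝 0))
    (hstep : Tendsto (fun m => T / (N m : ℝ)) atTop (𝓝 0))
    {f : ℕ → Space d × ℝ → V} {g : Space d × ℝ → V} (hfg : ConvergesBounded Ω T f g)
    (hf : ∀ m, Integrable (f m) (spaceTime Ω T))
    {v : ∀ m, Fin (N m) × (Fin (M m).numCells × LocalFace d) → V}
    (hv : ∀ m i, ∀ᵐ p ∂volume.restrict ((M m).box T (N m) i), f m p = v m i)
    (π : ∀ m, Fin (M m).numCells × LocalFace d → Fin (M m).numCells × LocalFace d)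
    (hπ : ∀ m q x y, x ∈ (M m).cell (π m q).1 → y ∈ (M m).cell q.1 → dist x y ≤ 2 * (M m).size)
    {Θ : ℝ} (hΘ0 : 0 ≤ Θ)
    (hΘ : ∀ m, ∀ h : Fin (N m) × (Fin (M m).numCells × LocalFace d) → ℝ, (∀ i, 0 ≤ h i) →
      ∑ i, volume.real ((M m).box T (N m) i) * h (i.1, π m i.2) ≤
        Θ * ∑ i, volume.real ((M m).box T (N m) i) * h i) :
    Tendsto (fun m => ∑ i, volume.real ((M m).box T (N m) i) * ‖v m i - v m (i.1, π m i.2)‖)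
      atTop (𝓝 0) := by
  have := isFiniteMeasure_spaceTime hΩb T
  have := regular_spaceTime hΩb T
  have hex : ∀ m (K : Fin (M m).numCells), ∃ x, x ∈ (M m).cell K := fun m K =>
    ((M m).isConnected_cell K).nonempty
  choose x hx using hex
  have hη : Tendsto (fun m => 2 * (M m).size + T / (N m : ℝ)) atTop (𝓝 0) := by
    simpa using (hsize.const_mul 2).add hstep
  refine tendsto_sum_measureReal_mul_norm_sub
    (fun m => (M m).spaceTime_eq_sum hd hΩo hΩp hT (hN m))
    (fun m i => (M m).measurableSet_box T (N m) i) hv hf hfg.integrable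
    (hfg.tendsto_integral_norm_sub hf) (fun m i => (i.1, π m i.2)) hΘ0 hΘ
    (fun m i => (x m i.2.1, ((i.1 : ℕ) : ℝ) * (T / N m))) hη ?_ ?_
  · intro m i p hp
    refine (Mesh.dist_le_of_mem_box hp (hx m i.2.1)).trans ?_
    have := (M m).size_nonneg
    linarith
  · intro m i
    have h1 := hπ m i.2 _ _ (hx m (π m i.2).1) (hx m i.2.1)
    have h2 : 0 ≤ T / (N m : ℝ) := by positivity
    have := (M m).size_nonneg
    rw [Prod.dist_eq]
    dsimp only
    rw [dist_self, dist_comm]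
    exact max_le (by linarith) (by linarith)

/-- The general oscillation result is applied with `π = opp` for the density, and with `π` sending
each face of a cell to its reference face for `z` and `u`. Both maps move points by at most `2 *
size`. -/
theorem tendsto_sum_osc (hd : 1 ≤ d) (hΩo : IsOpen Ω) (hΩb : Bornology.IsBounded Ω)
    (hΩp : IsPolyhedral Ω) (hT : 0 < T) (hN : ∀ m, 0 < N m) {θ : ℝ} (hθ0 : 0 ≤ θ)
    (hθ : ∀ m, (M m).theta1 ≤ θ)
    (hsize : Tendsto (fun m => (M m).size) atTop (𝓝 0))
    (hstep : Tendsto (fun m => T / (N m : ℝ)) atTop (𝓝 0))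
    (U : ∀ m, Unknowns (M m)) {rhoBar zBar : Space d × ℝ → ℝ} {uBar : Space d × ℝ → Space d}
    (hrho : ConvergesBounded Ω T
      (fun m => Mesh.discreteFun (M m).cell T (N m) (U m).rho) rhoBar)
    (hz : ConvergesBounded Ω T
      (fun m => Mesh.discreteFun (M m).dualCell T (N m) (U m).z) zBar)
    (hu : ConvergesBounded Ω T
      (fun m => Mesh.discreteFun (M m).dualCell T (N m) (U m).u) uBar) (a₀ : LocalFace d) :
    Tendsto (fun m => ∑ i, volume.real ((M m).box T (N m) i) * (U m).osc a₀ i.1 i.2)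
      atTop (𝓝 0) := by
  obtain ⟨Cr, hCr⟩ := hrho.bounded
  obtain ⟨Cz, hCz⟩ := hz.bounded
  obtain ⟨Cu, hCu⟩ := hu.bounded
  have hconst : ∀ m (q : Fin (M m).numCells × LocalFace d) (x y : Space d),
      x ∈ (M m).cell ((q.1, a₀) : Fin (M m).numCells × LocalFace d).1 → y ∈ (M m).cell q.1 →
      dist x y ≤ 2 * (M m).size := fun m q x y hx hy => by
    have := (M m).dist_le_size hx hy
    have := (M m).size_nonneg
    linarith
  have h1 := tendsto_sum_norm_sub_of_convergesBounded hd hΩo hΩb hΩp hT hN hsize hstep hrho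
    (fun m => integrable_discreteFun hΩb (fun K => ((M m).isCompact_cell K).measurableSet) _ _
      (hCr m))
    (fun m i => (M m).discreteFun_cell_ae_eq hT (U m).rho i) (fun m q => (M m).opp q)
    (fun m q x y => (M m).dist_le_two_mul_size) (by positivity : 0 ≤ θ + 1)
    (fun m => Mesh.sum_volume_real_box_mul_opp_le hd hT (hθ m) hθ0)
  have h2 := tendsto_sum_norm_sub_of_convergesBounded hd hΩo hΩb hΩp hT hN hsize hstep hz
    (fun m => integrable_discreteFun hΩb (M m).measurableSet_dualCell _ _ (hCz m))
    (fun m i => (M m).discreteFun_dualCell_ae_eq hT (U m).z i) (fun m q => (q.1, a₀))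
    hconst (by positivity : (0 : ℝ) ≤ 2 * d)
    (fun m => Mesh.sum_volume_real_box_mul_const_le hT a₀)
  have h3 := tendsto_sum_norm_sub_of_convergesBounded hd hΩo hΩb hΩp hT hN hsize hstep hu
    (fun m => integrable_discreteFun hΩb (M m).measurableSet_dualCell _ _ (hCu m))
    (fun m i => (M m).discreteFun_dualCell_ae_eq hT (U m).u i) (fun m q => (q.1, a₀))
    hconst (by positivity : (0 : ℝ) ≤ 2 * d)
    (fun m => Mesh.sum_volume_real_box_mul_const_le hT a₀)
  have h4 := (h1.add h2).add h3
  simp only [add_zero] at h4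
  refine h4.congr fun m => ?_
  rw [← Finset.sum_add_distrib, ← Finset.sum_add_distrib]
  refine Finset.sum_congr rfl fun i _ => ?_
  rw [Unknowns.osc, mul_add, mul_add, abs_sub_comm ((U m).rho _ _)]
  rfl

end Sequence

end StaggeredFV

/-! ### The test function and convergence of the consistent part -/

namespace StaggeredFV

variable {d : ℕ} {Ω : Set (Space d)}

/-- The derivative with respect to the space variable. -/
noncomputable def spaceDeriv (φ : Space d × ℝ → ℝ) (p : Space d × ℝ) : Space d →L[ℝ] ℝ :=
  fderiv ℝ (fun y => φ (y, p.2)) p.1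

theorem inner_gradient_eq_spaceDeriv (φ : Space d × ℝ → ℝ) (p : Space d × ℝ) (v : Space d) :
    inner ℝ v (gradient (fun y => φ (y, p.2)) p.1) = spaceDeriv φ p v := by
  rw [gradient, real_inner_comm, InnerProductSpace.toDual_symm_apply]
  rfl

theorem spaceDeriv_eq_comp {φ : Space d × ℝ → ℝ} (hφ : ContDiff ℝ ∞ φ) (p : Space d × ℝ) :
    spaceDeriv φ p = (fderiv ℝ φ p).comp (ContinuousLinearMap.inl ℝ (Space d) ℝ) := by
  have h1 : HasFDerivAt φ (fderiv ℝ φ p) (p.1, p.2) :=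
    (hφ.differentiable (by simp) p).hasFDerivAt
  exact (h1.comp p.1 (hasFDerivAt_prodMk_left p.1 p.2)).fderiv

namespace IsTestFunction

variable {T : ℝ} {φ : Space d × ℝ → ℝ}

theorem continuous_spaceDeriv (hφ : IsTestFunction Ω T φ) : Continuous (spaceDeriv φ) := by
  have h : spaceDeriv φ =
      fun p => (fderiv ℝ φ p).comp (ContinuousLinearMap.inl ℝ (Space d) ℝ) :=
    funext (spaceDeriv_eq_comp hφ.smooth)
  rw [h]
  exact (hφ.smooth.continuous_fderiv (by simp)).clm_comp continuous_const

theorem hasCompactSupport_spaceDeriv (hφ : IsTestFunction Ω T φ) :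
    HasCompactSupport (spaceDeriv φ) := by
  have h : spaceDeriv φ =
      fun p => (fderiv ℝ φ p).comp (ContinuousLinearMap.inl ℝ (Space d) ℝ) :=
    funext (spaceDeriv_eq_comp hφ.smooth)
  rw [h]
  exact (hφ.compact.fderiv (𝕜 := ℝ)).comp_left
    (g := fun L : Space d × ℝ →L[ℝ] ℝ => L.comp (ContinuousLinearMap.inl ℝ (Space d) ℝ))
    (ContinuousLinearMap.zero_comp _)

theorem contDiff_slice (hφ : IsTestFunction Ω T φ) (t : ℝ) : ContDiff ℝ 1 fun x => φ (x, t) :=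
  (hφ.smooth.of_le (by exact_mod_cast le_top)).comp (by fun_prop)

theorem exists_bound (hφ : IsTestFunction Ω T φ) : ∃ Λ : ℝ, 0 ≤ Λ ∧
    (∀ p, ‖spaceDeriv φ p‖ ≤ Λ) ∧ ∀ t x y, |φ (x, t) - φ (y, t)| ≤ Λ * dist x y := by
  obtain ⟨Λ, hΛ⟩ := hφ.hasCompactSupport_spaceDeriv.exists_bound_of_continuous
    hφ.continuous_spaceDeriv
  refine ⟨Λ, (norm_nonneg _).trans (hΛ 0), hΛ, fun t x y => ?_⟩
  have h := Convex.norm_image_sub_le_of_norm_fderiv_le (𝕜 := ℝ) (f := fun x => φ (x, t))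
    (s := Set.univ) (C := Λ) (x := y) (y := x)
    (fun z _ => (hφ.contDiff_slice t).differentiable one_ne_zero z)
    (fun z _ => hΛ (z, t)) convex_univ (Set.mem_univ _) (Set.mem_univ _)
  rwa [← dist_eq_norm x y] at h

/-- The projection of the support on space is compact in the open set `Ω`, hence at positive
distance from its complement, uniformly in time. -/
theorem exists_pos_forall_eq_zero (hφ : IsTestFunction Ω T φ) (hΩo : IsOpen Ω) :
    ∃ δ > 0, ∀ x₀ ∉ Ω, ∀ x, dist x x₀ < δ → ∀ t, φ (x, t) = 0 := by
  have hS : IsCompact (Prod.fst '' tsupport φ) := hφ.compact.isCompact.image continuous_fst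
  have hSΩ : Prod.fst '' tsupport φ ⊆ Ω := by
    rintro _ ⟨p, hp, rfl⟩
    exact (hφ.support_subset hp).1
  obtain ⟨δ, hδ, hsub⟩ := hS.exists_thickening_subset_open hΩo hSΩ
  refine ⟨δ, hδ, fun x₀ hx₀ x hx t => ?_⟩
  by_contra h
  refine hx₀ (hsub (Metric.mem_thickening_iff.2 ⟨x, ⟨(x, t), subset_tsupport _ h, rfl⟩, ?_⟩))
  rwa [dist_comm]

theorem eventually_internal_or_eq_zero (hφ : IsTestFunction Ω T φ) (hΩo : IsOpen Ω)
    {M : ℕ → Mesh d Ω} (hsize : Tendsto (fun m => (M m).size) atTop (𝓝 0))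
    {xc : ∀ m, Fin (M m).numCells → Space d} (hxc : ∀ m K, xc m K ∈ (M m).cell K) :
    ∀ᶠ m in atTop, ∀ t K, (∀ a, (M m).IsInternal ((M m).face K a)) ∨
      ((∀ x ∈ (M m).cell K, φ (x, t) = 0) ∧ ∀ a, φ (xc m ((M m).opp (K, a)).1, t) = 0) := by
  obtain ⟨δ, hδ, hzero⟩ := hφ.exists_pos_forall_eq_zero hΩo
  have h2 : Tendsto (fun m => 2 * (M m).size) atTop (𝓝 0) := by simpa using hsize.const_mul 2
  filter_upwards [h2.eventually (gt_mem_nhds hδ)] with m hm t K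
  by_cases h : ∀ a, (M m).IsInternal ((M m).face K a)
  · exact Or.inl h
  · right
    push Not at h
    obtain ⟨a, ha⟩ := h
    -- The cell contains a point outside `Ω`; the whole cell and all its neighbours are within `2 *
    -- size < δ` of it.
    obtain ⟨x₀, hx₀, hx₀Ω⟩ := (M m).exists_notMem_of_not_isInternal hΩo ha
    have hx₀K := (M m).faceSet_subset_cell K a hx₀
    have hs := (M m).size_nonneg
    refine ⟨fun x hx => hzero x₀ hx₀Ω x ?_ t, fun b => hzero x₀ hx₀Ω _ ?_ t⟩
    · have := (M m).dist_le_size hx hx₀K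
      linarith
    · exact ((M m).dist_le_two_mul_size (q := (K, b)) (hxc m _) hx₀K).trans_lt hm

end IsTestFunction

theorem abs_integral_sub_mul_le {X : Type*} [MeasurableSpace X] {μ : Measure X} [IsFiniteMeasure μ]
    {h : X → ℝ} (hi : Integrable h μ) {c κ : ℝ} (hc : ∀ᵐ x ∂μ, |h x - c| ≤ κ) :
    |∫ x, h x ∂μ - μ.real Set.univ * c| ≤ κ * μ.real Set.univ := by
  have h1 : ∫ x, h x ∂μ - μ.real Set.univ * c = ∫ x, (h x - c) ∂μ := by
    rw [integral_sub hi (integrable_const _), integral_const, smul_eq_mul]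
  rw [h1]
  exact norm_integral_le_of_norm_le_const (f := fun x => h x - c) (C := κ) hc

namespace Unknowns

variable {M : Mesh d Ω} {U : Unknowns M} {T : ℝ} {N : ℕ}

theorem norm_smul_sub_smul_le {C : ℝ} (hC : 0 ≤ C) {n : ℕ} (hρ : ∀ K, |U.rho n K| ≤ C)
    (hz : ∀ σ, |U.z n σ| ≤ C) (hu : ∀ σ, ‖U.u n σ‖ ≤ C) (a₀ : LocalFace d)
    (q : Fin M.numCells × LocalFace d) :
    ‖(U.rho n q.1 * U.z n (M.face q.1 a₀)) • U.u n (M.face q.1 a₀) -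
      U.rho n q.1 • U.z n (M.face q.1 q.2) • U.u n (M.face q.1 q.2)‖ ≤ C ^ 2 * U.osc a₀ n q := by
  have h1 : (U.rho n q.1 * U.z n (M.face q.1 a₀)) • U.u n (M.face q.1 a₀) -
      U.rho n q.1 • U.z n (M.face q.1 q.2) • U.u n (M.face q.1 q.2) =
      -(U.rho n q.1 • ((U.z n (M.face q.1 q.2) - U.z n (M.face q.1 a₀)) • U.u n (M.face q.1 a₀) +
        U.z n (M.face q.1 q.2) • (U.u n (M.face q.1 q.2) - U.u n (M.face q.1 a₀)))) := by
    simp only [mul_smul, sub_smul, smul_sub, smul_add]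
    abel
  rw [h1, norm_neg, norm_smul, Real.norm_eq_abs]
  have h2 : ‖(U.z n (M.face q.1 q.2) - U.z n (M.face q.1 a₀)) • U.u n (M.face q.1 a₀) +
      U.z n (M.face q.1 q.2) • (U.u n (M.face q.1 q.2) - U.u n (M.face q.1 a₀))‖ ≤
      C * U.osc a₀ n q := by
    refine (norm_add_le _ _).trans ?_
    rw [norm_smul, norm_smul, Real.norm_eq_abs, Real.norm_eq_abs]
    have e1 := mul_le_mul_of_nonneg_left (hu (M.face q.1 a₀))
      (abs_nonneg (U.z n (M.face q.1 q.2) - U.z n (M.face q.1 a₀)))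
    have e2 := mul_le_mul_of_nonneg_right (hz (M.face q.1 q.2))
      (norm_nonneg (U.u n (M.face q.1 q.2) - U.u n (M.face q.1 a₀)))
    have e3 := mul_nonneg hC (abs_nonneg (U.rho n (M.opp q).1 - U.rho n q.1))
    unfold osc
    nlinarith
  calc _ ≤ C * (C * U.osc a₀ n q) := mul_le_mul (hρ _) h2 (norm_nonneg _) hC
    _ = _ := by ring

/-- The consistent part of the divergence term is close to the corresponding integral. -/
theorem abs_sum_integral_cell_sub_integral_le (hd : 1 ≤ d) (hΩo : IsOpen Ω)
    (hΩb : Bornology.IsBounded Ω) (hΩp : IsPolyhedral Ω) (hT : 0 < T) (hN : 0 < N)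
    {P : Space d × ℝ → Space d →L[ℝ] ℝ} (hP : Continuous P) {Λ C κ : ℝ}
    (hΛ : ∀ p, ‖P p‖ ≤ Λ) (hC : 0 ≤ C) (hκ0 : 0 ≤ κ)
    (hκ : ∀ p p', dist p p' ≤ M.size + T / N → ‖P p - P p'‖ ≤ κ)
    (hρ : ∀ n < N, ∀ K, |U.rho n K| ≤ C) (hz : ∀ n < N, ∀ σ, |U.z n σ| ≤ C)
    (hu : ∀ n < N, ∀ σ, ‖U.u n σ‖ ≤ C) (a₀ : LocalFace d) {F : Space d × ℝ → Space d}
    (hF : ∀ i, ∀ᵐ p ∂volume.restrict (M.box T N i), F p =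
      U.rho i.1 i.2.1 • U.z i.1 (M.face i.2.1 i.2.2) • U.u i.1 (M.face i.2.1 i.2.2))
    (hFi : Integrable (fun p => P p (F p)) (spaceTime Ω T)) :
    |(∑ n ∈ Finset.range N, T / N * ∑ K, ∫ x in M.cell K, P (x, n * (T / N))
        ((U.rho n K * U.z n (M.face K a₀)) • U.u n (M.face K a₀))) -
      ∫ p, P p (F p) ∂spaceTime Ω T| ≤
      2 * κ * C ^ 3 * (spaceTime Ω T).real Set.univ +
        Λ * C ^ 2 * ∑ i, volume.real (M.box T N i) * U.osc a₀ i.1 i.2 := by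
  have hfin := isFiniteMeasure_spaceTime hΩb T
  have hsum := M.spaceTime_eq_sum hd hΩo hΩp hT hN
  have hcard : Fintype.card (LocalFace d) = 2 * d := by simp [LocalFace, mul_comm]
  have hdp : (0 : ℝ) < d := by exact_mod_cast hd
  have hNp : (0 : ℝ) < N := by exact_mod_cast hN
  have hτ : 0 < T / N := by positivity
  have hW : ∑ i, volume.real (M.box T N i) = (spaceTime Ω T).real Set.univ := by
    have := integral_eq_sum_setIntegral hsum (integrable_const (1 : ℝ))
    simpa using this.symm
  have hexK : ∀ K : Fin M.numCells, ∃ x, x ∈ M.cell K := fun K => (M.isConnected_cell K).nonempty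
  choose y hy using hexK
  let fK : ℕ → Fin M.numCells → Space d := fun n K =>
    (U.rho n K * U.z n (M.face K a₀)) • U.u n (M.face K a₀)
  let Fi : Fin N × (Fin M.numCells × LocalFace d) → Space d := fun i =>
    U.rho i.1 i.2.1 • U.z i.1 (M.face i.2.1 i.2.2) • U.u i.1 (M.face i.2.1 i.2.2)
  let J : ℕ → Fin M.numCells → ℝ := fun n K =>
    ∫ x in M.cell K, P (x, n * (T / N)) (fK n K)
  let p₀ : Fin N × (Fin M.numCells × LocalFace d) → Space d × ℝ := fun i =>
    (y i.2.1, ((i.1 : ℕ) : ℝ) * (T / N))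
  -- The integral over a cell is shared equally between its half-diamonds, so that both sides become
  -- sums over boxes.
  have hJ : ∑ n ∈ Finset.range N, T / N * ∑ K, J n K =
      ∑ i : Fin N × (Fin M.numCells × LocalFace d), T / N * (J i.1 i.2.1 / (2 * d)) := by
    rw [Finset.sum_range, Fintype.sum_prod_type]
    refine Finset.sum_congr rfl fun n _ => ?_
    rw [← Finset.mul_sum, Fintype.sum_prod_type]
    congr 1
    refine Finset.sum_congr rfl fun K _ => ?_
    dsimp only
    rw [Finset.sum_const, Finset.card_univ, hcard, nsmul_eq_mul]
    push_cast
    field_simp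
  have hnormK : ∀ n < N, ∀ K, ‖fK n K‖ ≤ C ^ 3 := fun n hn K => by
    simp only [fK]
    rw [norm_smul, norm_mul, Real.norm_eq_abs, Real.norm_eq_abs]
    calc _ ≤ (C * C) * C := by
          gcongr
          exacts [hρ n hn K, hz n hn _, hu n hn _]
      _ = C ^ 3 := by ring
  have hnormF : ∀ i, ‖Fi i‖ ≤ C ^ 3 := fun i => by
    simp only [Fi]
    rw [norm_smul, norm_smul, Real.norm_eq_abs, Real.norm_eq_abs]
    calc _ ≤ C * (C * C) := by
          gcongr
          exacts [hρ _ i.1.2 _, hz _ i.1.2 _, hu _ i.1.2 _]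
      _ = C ^ 3 := by ring
  have hclm : ∀ p p' (v : Space d), dist p p' ≤ M.size + T / N → ‖v‖ ≤ C ^ 3 →
      |P p v - P p' v| ≤ κ * C ^ 3 := fun p p' v hpp hv => by
    rw [← sub_apply, ← Real.norm_eq_abs]
    refine (ContinuousLinearMap.le_opNorm _ _).trans ?_
    exact mul_le_mul (hκ p p' hpp) hv (norm_nonneg _) hκ0
  have key : ∀ i, |T / N * (J i.1 i.2.1 / (2 * d)) - ∫ p in M.box T N i, P p (F p)| ≤
      2 * κ * C ^ 3 * volume.real (M.box T N i) +
        Λ * C ^ 2 * (volume.real (M.box T N i) * U.osc a₀ i.1 i.2) := by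
    intro i
    set w := volume.real (M.box T N i) with hw
    have hw' : w = M.vol i.2.1 / (2 * d) * (T / N) := M.volume_real_box hT i
    have hw0 : 0 ≤ w := measureReal_nonneg
    have hle : volume.restrict (M.box T N i) ≤ spaceTime Ω T := by
      rw [hsum]; exact Measure.le_sum _ i
    have e1 : |J i.1 i.2.1 - M.vol i.2.1 * P (p₀ i) (fK i.1 i.2.1)| ≤
        κ * C ^ 3 * M.vol i.2.1 := by
      have hcf : IsFiniteMeasure (volume.restrict (M.cell i.2.1)) :=
        ⟨by rw [Measure.restrict_apply_univ]; exact (M.isCompact_cell _).measure_lt_top⟩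
      have h := abs_integral_sub_mul_le (μ := volume.restrict (M.cell i.2.1))
        (h := fun x => P (x, ((i.1 : ℕ) : ℝ) * (T / N)) (fK i.1 i.2.1))
        (c := P (p₀ i) (fK i.1 i.2.1)) (κ := κ * C ^ 3)
        (by
          refine ContinuousOn.integrableOn_compact (M.isCompact_cell _) (Continuous.continuousOn ?_)
          fun_prop)
        (by
          filter_upwards [ae_restrict_mem (M.isCompact_cell i.2.1).measurableSet] with x hx
          refine hclm _ _ _ ?_ (hnormK _ i.1.2 _)
          rw [Prod.dist_eq]
          simp only [p₀, dist_self]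
          have h1 := M.dist_le_size hx (hy i.2.1)
          have h2 := M.size_nonneg
          exact max_le (by linarith) (by linarith))
      rwa [measureReal_restrict_apply_univ] at h
    have e2 : |(∫ p in M.box T N i, P p (F p)) - w * P (p₀ i) (Fi i)| ≤ κ * C ^ 3 * w := by
      have hbf : IsFiniteMeasure (volume.restrict (M.box T N i)) := isFiniteMeasure_of_le _ hle
      have h := abs_integral_sub_mul_le (μ := volume.restrict (M.box T N i))
        (c := P (p₀ i) (Fi i)) (κ := κ * C ^ 3) (hFi.mono_measure hle)
        (by
          filter_upwards [hF i, ae_restrict_mem (M.measurableSet_box T N i)] with p hp hpi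
          rw [hp]
          exact hclm _ _ _ (Mesh.dist_le_of_mem_box hpi (hy i.2.1)) (hnormF i))
      rwa [measureReal_restrict_apply_univ] at h
    have e3 : |P (p₀ i) (fK i.1 i.2.1) - P (p₀ i) (Fi i)| ≤ Λ * C ^ 2 * U.osc a₀ i.1 i.2 := by
      rw [← map_sub, ← Real.norm_eq_abs, mul_assoc]
      refine (ContinuousLinearMap.le_opNorm _ _).trans ?_
      exact mul_le_mul (hΛ _) (norm_smul_sub_smul_le hC (hρ _ i.1.2) (hz _ i.1.2) (hu _ i.1.2) a₀ i.2)
        (norm_nonneg _) ((norm_nonneg _).trans (hΛ (p₀ i)))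
    -- Three errors: freezing the derivative at `p₀ i` in the cell integral and in the box integral,
    -- which together give `2 κ C³`, and replacing the reference face by the actual one, which gives
    -- the oscillation.
    have e4 : T / N * (J i.1 i.2.1 / (2 * d)) - (∫ p in M.box T N i, P p (F p)) =
        T / N / (2 * d) * (J i.1 i.2.1 - M.vol i.2.1 * P (p₀ i) (fK i.1 i.2.1)) -
        ((∫ p in M.box T N i, P p (F p)) - w * P (p₀ i) (Fi i)) +
        w * (P (p₀ i) (fK i.1 i.2.1) - P (p₀ i) (Fi i)) := by
      rw [hw']; field_simp; ring
    rw [e4]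
    have e5 : |T / N / (2 * d) * (J i.1 i.2.1 - M.vol i.2.1 * P (p₀ i) (fK i.1 i.2.1))| ≤
        κ * C ^ 3 * w := by
      have hpos : 0 < T / N / (2 * d) := by positivity
      rw [abs_mul, abs_of_pos hpos]
      refine (mul_le_mul_of_nonneg_left e1 hpos.le).trans (le_of_eq ?_)
      rw [hw']; ring
    have e6 : |w * (P (p₀ i) (fK i.1 i.2.1) - P (p₀ i) (Fi i))| ≤
        w * (Λ * C ^ 2 * U.osc a₀ i.1 i.2) := by
      rw [abs_mul, abs_of_nonneg hw0]
      exact mul_le_mul_of_nonneg_left e3 hw0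
    have e7 := abs_add_le
      (T / N / (2 * d) * (J i.1 i.2.1 - M.vol i.2.1 * P (p₀ i) (fK i.1 i.2.1)) -
        ((∫ p in M.box T N i, P p (F p)) - w * P (p₀ i) (Fi i)))
      (w * (P (p₀ i) (fK i.1 i.2.1) - P (p₀ i) (Fi i)))
    have e8 := abs_sub (T / N / (2 * d) * (J i.1 i.2.1 - M.vol i.2.1 * P (p₀ i) (fK i.1 i.2.1)))
        ((∫ p in M.box T N i, P p (F p)) - w * P (p₀ i) (Fi i))
    linarith
  change |(∑ n ∈ Finset.range N, T / N * ∑ K, J n K) - _| ≤ _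
  rw [hJ, integral_eq_sum_setIntegral hsum hFi, ← Finset.sum_sub_distrib]
  refine (Finset.abs_sum_le_sum_abs _ _).trans ((Finset.sum_le_sum fun i _ => key i).trans ?_)
  rw [Finset.sum_add_distrib, ← Finset.mul_sum, ← Finset.mul_sum, hW]

end Unknowns

end StaggeredFV

/-! ### Passage to the limit -/

namespace StaggeredFV

variable {d : ℕ} {Ω : Set (Space d)}

theorem integral_spaceTime {T : ℝ} (hT : 0 < T) {h : Space d × ℝ → ℝ}
    (hi : Integrable h (spaceTime Ω T)) :
    ∫ p, h p ∂spaceTime Ω T = ∫ t in (0 : ℝ)..T, ∫ x in Ω, h (x, t) := by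
  have hμ : spaceTime Ω T = (volume.restrict Ω).prod (volume.restrict (Set.Ioo 0 T)) := by
    rw [spaceTime, Measure.prod_restrict]; rfl
  rw [hμ] at hi ⊢
  rw [integral_prod_symm _ hi, intervalIntegral.integral_of_le hT.le,
    integral_Ioc_eq_integral_Ioo]

/-- The divergence term is close to minus its consistent part. -/
theorem abs_divTerm_add_le {M : Mesh d Ω} {U : Unknowns M} {T : ℝ} {N : ℕ} (hd : 1 ≤ d)
    (hT : 0 < T) {ξ : LocalFace d → LocalFace d → LocalFace d → ℝ} (hU : U.IsAdmissible ξ N)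
    {φ : Space d × ℝ → ℝ} (hφ : IsTestFunction Ω T φ) {xc : Fin M.numCells → Space d}
    (hxc : ∀ K, xc K ∈ M.cell K) {Λ C X θ : ℝ} (hΛ : 0 ≤ Λ) (hC : 0 ≤ C) (hθ0 : 0 ≤ θ)
    (hLip : ∀ t x y, |φ (x, t) - φ (y, t)| ≤ Λ * dist x y)
    (hρ : ∀ n < N, ∀ K, |U.rho n K| ≤ C) (hz : ∀ n < N, ∀ σ, |U.z n σ| ≤ C)
    (hu : ∀ n < N, ∀ σ, ‖U.u n σ‖ ≤ C) (hξ : ∀ a b c, |ξ a b c| ≤ X)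
    (hin : ∀ t K, (∀ a, M.IsInternal (M.face K a)) ∨
      ((∀ x ∈ M.cell K, φ (x, t) = 0) ∧ ∀ a, φ (xc (M.opp (K, a)).1, t) = 0))
    (hθ : M.theta2 ≤ θ) (a₀ : LocalFace d) :
    |U.divTerm ξ T N xc φ + ∑ n ∈ Finset.range N, T / N * ∑ K, ∫ x in M.cell K,
        spaceDeriv φ (x, n * (T / N)) ((U.rho n K * U.z n (M.face K a₀)) • U.u n (M.face K a₀))| ≤
      Λ * C ^ 2 * θ * (2 * d * (1 + 1 / (2 * (2 * d)) + X * (2 * d) / 2)) * (2 * d) *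
        ∑ i, volume.real (M.box T N i) * U.osc a₀ i.1 i.2 := by
  have hdp : (0 : ℝ) < d := by exact_mod_cast hd
  have hstep : 0 ≤ T / (N : ℝ) := by positivity
  rw [Unknowns.divTerm, ← Finset.sum_add_distrib]
  refine (Finset.abs_sum_le_sum_abs _ _).trans ?_
  have h1 : ∀ n ∈ Finset.range N, |T / N * ∑ K, φ (xc K, n * (T / N)) *
      ∑ a, U.G ξ n K (M.face K a) + T / N * ∑ K, ∫ x in M.cell K,
        spaceDeriv φ (x, n * (T / N)) ((U.rho n K * U.z n (M.face K a₀)) • U.u n (M.face K a₀))| ≤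
      T / N * (Λ * C ^ 2 * θ * (2 * d * (1 + 1 / (2 * (2 * d)) + X * (2 * d) / 2)) *
        ∑ q : Fin M.numCells × LocalFace d, M.vol q.1 * U.osc a₀ n q) := by
    intro n hn
    have hn' := Finset.mem_range.1 hn
    rw [← mul_add, abs_mul, abs_of_nonneg hstep]
    refine mul_le_mul_of_nonneg_left ?_ hstep
    exact hU.abs_sum_mul_sum_G_add_integral_le hd hn' (hφ.contDiff_slice (n * (T / N))) xc hxc hΛ hC
      hθ0 (hLip _) (hρ n hn') (hz n hn') (hu n hn') hξ (hin _)
      (fun q hq => Mesh.sum_faceArea_mul_diam_le hd hθ hq) a₀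
  refine (Finset.sum_le_sum h1).trans (le_of_eq ?_)
  rw [Finset.sum_range, Fintype.sum_prod_type, Finset.mul_sum]
  refine Finset.sum_congr rfl fun n _ => ?_
  -- A half-diamond has volume `|K| / (2 d)`, whence the extra factor `2 * d` in the final constant.
  have h2 : ∑ q : Fin M.numCells × LocalFace d, volume.real (M.box T N (n, q)) *
      U.osc a₀ n q = T / N / (2 * d) * ∑ q : Fin M.numCells × LocalFace d,
        M.vol q.1 * U.osc a₀ n q := by
    rw [Finset.mul_sum]
    refine Finset.sum_congr rfl fun q _ => ?_
    rw [M.volume_real_box hT]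
    ring
  dsimp only
  rw [h2]
  field_simp

/-- The divergence term converges; the space dimension is arbitrary. -/
theorem integrable_and_tendsto_divTerm {d : ℕ} (hd1 : 1 ≤ d)
    (Ω : Set (StaggeredFV.Space d)) (hΩo : IsOpen Ω) (hΩb : Bornology.IsBounded Ω)
    (hΩp : StaggeredFV.IsPolyhedral Ω)
    (T : ℝ) (hT : 0 < T)
    (θ : ℝ) (hθ : 0 < θ)
    (M : ℕ → StaggeredFV.Mesh d Ω)
    (hreg : ∀ m, max (M m).theta1 (M m).theta2 ≤ θ)
    (hsize : Tendsto (fun m => (M m).size) atTop (𝓝 0))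
    (N : ℕ → ℕ) (hN : ∀ m, 0 < N m)
    (hstep : Tendsto (fun m => T / (N m : ℝ)) atTop (𝓝 0))
    (ξ : StaggeredFV.LocalFace d → StaggeredFV.LocalFace d → StaggeredFV.LocalFace d → ℝ)
    (U : ∀ m, StaggeredFV.Unknowns (M m))
    (hU : ∀ m, (U m).IsAdmissible ξ (N m))
    (rhoBar zBar : StaggeredFV.Space d × ℝ → ℝ)
    (uBar : StaggeredFV.Space d × ℝ → StaggeredFV.Space d)
    (hrho : StaggeredFV.ConvergesBounded Ω T
      (fun m => StaggeredFV.Mesh.discreteFun (M m).cell T (N m) (U m).rho) rhoBar)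
    (hz : StaggeredFV.ConvergesBounded Ω T
      (fun m => StaggeredFV.Mesh.discreteFun (M m).dualCell T (N m) (U m).z) zBar)
    (hu : StaggeredFV.ConvergesBounded Ω T
      (fun m => StaggeredFV.Mesh.discreteFun (M m).dualCell T (N m) (U m).u) uBar)
    (xc : ∀ m, Fin (M m).numCells → StaggeredFV.Space d)
    (hxc : ∀ m K, xc m K ∈ (M m).cell K)
    (φ : StaggeredFV.Space d × ℝ → ℝ) (hφ : StaggeredFV.IsTestFunction Ω T φ) :
    Integrable (fun p : StaggeredFV.Space d × ℝ =>
        rhoBar p * zBar p * inner ℝ (uBar p) (gradient (fun y => φ (y, p.2)) p.1))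
      (StaggeredFV.spaceTime Ω T) ∧
    Tendsto (fun m => (U m).divTerm ξ T (N m) (xc m) φ) atTop
      (𝓝 (-∫ t in (0 : ℝ)..T, ∫ x in Ω,
        rhoBar (x, t) * zBar (x, t) *
          inner ℝ (uBar (x, t)) (gradient (fun y => φ (y, t)) x))) := by
  have hfin := isFiniteMeasure_spaceTime hΩb T
  obtain ⟨Λ, hΛ0, hΛ, hLip⟩ := hφ.exists_bound
  have hPc := hφ.continuous_spaceDeriv
  let a₀ : LocalFace d := (⟨0, hd1⟩, false)
  have hcellm : ∀ m K, MeasurableSet ((M m).cell K) := fun m K =>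
    ((M m).isCompact_cell K).measurableSet
  have hrm : ∀ m, AEStronglyMeasurable (Mesh.discreteFun (M m).cell T (N m) (U m).rho)
      (spaceTime Ω T) := fun m => (Mesh.measurable_discreteFun (hcellm m) _).aestronglyMeasurable
  have hzm : ∀ m, AEStronglyMeasurable (Mesh.discreteFun (M m).dualCell T (N m) (U m).z)
      (spaceTime Ω T) := fun m =>
    (Mesh.measurable_discreteFun (M m).measurableSet_dualCell _).aestronglyMeasurable
  have hum : ∀ m, AEStronglyMeasurable (Mesh.discreteFun (M m).dualCell T (N m) (U m).u)
      (spaceTime Ω T) := fun m =>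
    (Mesh.measurable_discreteFun (M m).measurableSet_dualCell _).aestronglyMeasurable
  have hzu := hz.smul hu hzm hum
  have hF := hrho.smul hzu hrm fun m => (hzm m).smul (hum m)
  have hFm : ∀ m, AEStronglyMeasurable (fun p => Mesh.discreteFun (M m).cell T (N m) (U m).rho p •
      Mesh.discreteFun (M m).dualCell T (N m) (U m).z p •
        Mesh.discreteFun (M m).dualCell T (N m) (U m).u p) (spaceTime Ω T) :=
    fun m => (hrm m).smul ((hzm m).smul (hum m))
  set F : ℕ → Space d × ℝ → Space d := fun m p =>
    Mesh.discreteFun (M m).cell T (N m) (U m).rho p •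
      Mesh.discreteFun (M m).dualCell T (N m) (U m).z p •
        Mesh.discreteFun (M m).dualCell T (N m) (U m).u p with hFdef
  have hFi : ∀ m, Integrable (F m) (spaceTime Ω T) := by
    obtain ⟨CF, hCF⟩ := hF.bounded
    exact fun m => Integrable.of_bound (hFm m) CF (ae_norm_le_of_eLpNorm_top_le (hCF m))
  have hPi : ∀ {G : Space d × ℝ → Space d}, Integrable G (spaceTime Ω T) →
      Integrable (fun p => spaceDeriv φ p (G p)) (spaceTime Ω T) := by
    intro G hG
    refine Integrable.mono' (hG.norm.const_mul Λ) ?_ (ae_of_all _ fun p => ?_)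
    · exact isBoundedBilinearMap_apply.continuous.comp_aestronglyMeasurable
        (hPc.aestronglyMeasurable.prodMk hG.aestronglyMeasurable)
    · exact (ContinuousLinearMap.le_opNorm _ _).trans
        (mul_le_mul_of_nonneg_right (hΛ p) (norm_nonneg _))
  have hpt : ∀ p : Space d × ℝ,
      rhoBar p * zBar p * inner ℝ (uBar p) (gradient (fun y => φ (y, p.2)) p.1) =
      spaceDeriv φ p (rhoBar p • zBar p • uBar p) := by
    intro p
    rw [inner_gradient_eq_spaceDeriv, map_smul, map_smul, smul_eq_mul, smul_eq_mul, mul_assoc]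
  have hI := hPi hF.integrable
  have hI' : Integrable (fun p : Space d × ℝ =>
      rhoBar p * zBar p * inner ℝ (uBar p) (gradient (fun y => φ (y, p.2)) p.1))
      (spaceTime Ω T) := hI.congr (ae_of_all _ fun p => (hpt p).symm)
  refine ⟨hI', ?_⟩
  have hlim : ∫ t in (0 : ℝ)..T, ∫ x in Ω, rhoBar (x, t) * zBar (x, t) *
      inner ℝ (uBar (x, t)) (gradient (fun y => φ (y, t)) x) =
      ∫ p, spaceDeriv φ p (rhoBar p • zBar p • uBar p) ∂spaceTime Ω T := by
    rw [← integral_congr_ae (ae_of_all _ hpt)]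
    exact (integral_spaceTime hT hI').symm
  rw [hlim]
  obtain ⟨Cr, hCr⟩ := hrho.bounded
  obtain ⟨Cz, hCz⟩ := hz.bounded
  obtain ⟨Cu, hCu⟩ := hu.bounded
  -- A common bound for the three families of unknowns.
  set C : ℝ := Cr + Cz + Cu with hCdef
  have hC0 : 0 ≤ C := by positivity
  have hρb : ∀ m, ∀ n < N m, ∀ K, |(U m).rho n K| ≤ C := fun m n hn K => by
    have := (M m).norm_le_of_eLpNorm_le hd1 hΩo hΩp hT (hCr m) (⟨n, hn⟩, (K, a₀))
      ((M m).discreteFun_cell_ae_eq hT (U m).rho _)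
    rw [Real.norm_eq_abs] at this
    refine this.trans ?_
    rw [hCdef]; linarith [Cz.2, Cu.2]
  have hzb : ∀ m, ∀ n < N m, ∀ σ, |(U m).z n σ| ≤ C := fun m n hn σ => by
    obtain ⟨K, a, rfl⟩ := (M m).exists_cell σ
    have := (M m).norm_le_of_eLpNorm_le hd1 hΩo hΩp hT (hCz m) (⟨n, hn⟩, (K, a))
      ((M m).discreteFun_dualCell_ae_eq hT (U m).z _)
    rw [Real.norm_eq_abs] at this
    refine this.trans ?_
    rw [hCdef]; linarith [Cr.2, Cu.2]
  have hub : ∀ m, ∀ n < N m, ∀ σ, ‖(U m).u n σ‖ ≤ C := fun m n hn σ => by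
    obtain ⟨K, a, rfl⟩ := (M m).exists_cell σ
    have := (M m).norm_le_of_eLpNorm_le hd1 hΩo hΩp hT (hCu m) (⟨n, hn⟩, (K, a))
      ((M m).discreteFun_dualCell_ae_eq hT (U m).u _)
    refine this.trans ?_
    rw [hCdef]; linarith [Cr.2, Cz.2]
  obtain ⟨X, hX⟩ : ∃ X : ℝ, ∀ a b c, |ξ a b c| ≤ X := by
    obtain ⟨X, hX⟩ := (Set.finite_range fun q : LocalFace d × LocalFace d × LocalFace d =>
      |ξ q.1 q.2.1 q.2.2|).bddAbove
    exact ⟨X, fun a b c => hX ⟨(a, b, c), rfl⟩⟩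
  have hosc := tendsto_sum_osc hd1 hΩo hΩb hΩp hT hN hθ.le
    (fun m => (le_max_left _ _).trans (hreg m)) hsize hstep U hrho hz hu a₀
  let A : ℕ → ℝ := fun m => ∑ n ∈ Finset.range (N m), T / N m * ∑ K, ∫ x in (M m).cell K,
    spaceDeriv φ (x, n * (T / N m))
      (((U m).rho n K * (U m).z n ((M m).face K a₀)) • (U m).u n ((M m).face K a₀))
  have hDA : Tendsto (fun m => (U m).divTerm ξ T (N m) (xc m) φ + A m) atTop (𝓝 0) := by
    have h0 := hosc.const_mul
      (Λ * C ^ 2 * θ * (2 * d * (1 + 1 / (2 * (2 * d)) + X * (2 * d) / 2)) * (2 * d))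
    rw [mul_zero] at h0
    refine squeeze_zero_norm' ?_ h0
    filter_upwards [hφ.eventually_internal_or_eq_zero hΩo hsize hxc] with m hm
    rw [Real.norm_eq_abs]
    exact abs_divTerm_add_le hd1 hT (hU m) hφ (hxc m) hΛ0 hC0 hθ.le hLip (hρb m) (hzb m) (hub m) hX
      hm ((le_max_right _ _).trans (hreg m)) a₀
  -- The derivative of `φ` is uniformly continuous, so its freezing error is at most `ε / 2` on a
  -- fine mesh; the oscillation term is below `ε / 2` as well.
  have hAB : Tendsto (fun m => A m - ∫ p, spaceDeriv φ p (F m p) ∂spaceTime Ω T) atTop (𝓝 0) := by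
    rw [Metric.tendsto_nhds]
    intro ε hε
    set W := (spaceTime Ω T).real Set.univ with hW
    have hW0 : 0 ≤ W := measureReal_nonneg
    obtain ⟨κ, hκ, hκε⟩ : ∃ κ > 0, 2 * κ * C ^ 3 * W ≤ ε / 2 := by
      refine ⟨ε / (4 * (C ^ 3 * W + 1)), by positivity, ?_⟩
      have h1 : 2 * (ε / (4 * (C ^ 3 * W + 1))) * C ^ 3 * W =
          ε / 2 * (C ^ 3 * W / (C ^ 3 * W + 1)) := by
        have : C ^ 3 * W + 1 ≠ 0 := by positivity
        field_simp; ring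
      rw [h1]
      have h2 : C ^ 3 * W / (C ^ 3 * W + 1) ≤ 1 := by
        rw [div_le_one (by positivity)]; linarith
      nlinarith
    have hunif := hφ.hasCompactSupport_spaceDeriv.uniformContinuous_of_continuous hPc
    obtain ⟨r, hr, hPr⟩ := Metric.uniformContinuous_iff.1 hunif κ hκ
    have h1 : Tendsto (fun m => (M m).size + T / (N m : ℝ)) atTop (𝓝 0) := by
      simpa using hsize.add hstep
    have h2 : Tendsto (fun m => Λ * C ^ 2 *
        ∑ i, volume.real ((M m).box T (N m) i) * (U m).osc a₀ i.1 i.2) atTop (𝓝 0) := by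
      simpa using hosc.const_mul (Λ * C ^ 2)
    filter_upwards [h1.eventually (gt_mem_nhds hr), h2.eventually (gt_mem_nhds (half_pos hε))]
      with m hm1 hm2
    rw [Real.dist_eq, sub_zero]
    refine lt_of_le_of_lt (Unknowns.abs_sum_integral_cell_sub_integral_le hd1 hΩo hΩb hΩp hT (hN m)
      hPc hΛ hC0 hκ.le (fun p p' hpp => ?_) (hρb m) (hzb m) (hub m) a₀ (F := F m) (fun i => ?_)
      (hPi (hFi m))) (by linarith)
    · rw [← dist_eq_norm]
      exact (hPr (hpp.trans_lt hm1)).le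
    · filter_upwards [(M m).discreteFun_cell_ae_eq hT (U m).rho i,
        (M m).discreteFun_dualCell_ae_eq hT (U m).z i,
        (M m).discreteFun_dualCell_ae_eq hT (U m).u i] with p h1 h2 h3
      simp only [hFdef, h1, h2, h3]
  -- The derivative of `φ` is bounded, so `L¹` convergence of the products is enough.
  have hB : Tendsto (fun m => ∫ p, spaceDeriv φ p (F m p) ∂spaceTime Ω T) atTop
      (𝓝 (∫ p, spaceDeriv φ p (rhoBar p • zBar p • uBar p) ∂spaceTime Ω T)) := by
    rw [tendsto_iff_norm_sub_tendsto_zero]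
    have h1 := (hF.tendsto_integral_norm_sub hFi).const_mul Λ
    rw [mul_zero] at h1
    refine squeeze_zero (fun m => norm_nonneg _) (fun m => ?_) h1
    rw [← integral_sub (hPi (hFi m)) hI, ← integral_const_mul]
    refine norm_integral_le_of_norm_le (((hFi m).sub hF.integrable).norm.const_mul Λ)
      (ae_of_all _ fun p => ?_)
    rw [← map_sub]
    exact (ContinuousLinearMap.le_opNorm _ _).trans
      (mul_le_mul_of_nonneg_right (hΛ p) (norm_nonneg _))
  -- With `B m` the integral in `hB`, the divergence term is `(divTerm + A m) - (A m - B m) - B m`.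
  have h := (hDA.sub hAB).sub hB
  simp only [sub_zero, zero_sub] at h
  refine h.congr fun m => ?_
  ring

end StaggeredFV

theorem mainTheorem4 {d : ℕ} (hd1 : 1 ≤ d) (hd3 : d ≤ 3)
    (Ω : Set (StaggeredFV.Space d)) (hΩo : IsOpen Ω) (hΩb : Bornology.IsBounded Ω)
    (hΩp : StaggeredFV.IsPolyhedral Ω)
    (T : ℝ) (hT : 0 < T)
    (θ : ℝ) (hθ : 0 < θ)
    (M : ℕ → StaggeredFV.Mesh d Ω)
    (hreg : ∀ m, max (M m).theta1 (M m).theta2 ≤ θ)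
    (hsize : Tendsto (fun m => (M m).size) atTop (𝓝 0))
    (N : ℕ → ℕ) (hN : ∀ m, 0 < N m)
    (hstep : Tendsto (fun m => T / (N m : ℝ)) atTop (𝓝 0))
    (ξ : StaggeredFV.LocalFace d → StaggeredFV.LocalFace d → StaggeredFV.LocalFace d → ℝ)
    (U : ∀ m, StaggeredFV.Unknowns (M m))
    (hU : ∀ m, (U m).IsAdmissible ξ (N m))
    (rhoBar zBar : StaggeredFV.Space d × ℝ → ℝ)
    (uBar : StaggeredFV.Space d × ℝ → StaggeredFV.Space d)
    (hrho : StaggeredFV.ConvergesBounded Ω T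
      (fun m => StaggeredFV.Mesh.discreteFun (M m).cell T (N m) (U m).rho) rhoBar)
    (hz : StaggeredFV.ConvergesBounded Ω T
      (fun m => StaggeredFV.Mesh.discreteFun (M m).dualCell T (N m) (U m).z) zBar)
    (hu : StaggeredFV.ConvergesBounded Ω T
      (fun m => StaggeredFV.Mesh.discreteFun (M m).dualCell T (N m) (U m).u) uBar)
    (xc : ∀ m, Fin (M m).numCells → StaggeredFV.Space d)
    (hxc : ∀ m K, xc m K ∈ (M m).cell K)
    (φ : StaggeredFV.Space d × ℝ → ℝ) (hφ : StaggeredFV.IsTestFunction Ω T φ) :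
    Integrable (fun p : StaggeredFV.Space d × ℝ =>
        rhoBar p * zBar p * inner ℝ (uBar p) (gradient (fun y => φ (y, p.2)) p.1))
      (StaggeredFV.spaceTime Ω T) ∧
    Tendsto (fun m => (U m).divTerm ξ T (N m) (xc m) φ) atTop
      (𝓝 (-∫ t in (0 : ℝ)..T, ∫ x in Ω,
        rhoBar (x, t) * zBar (x, t) *
          inner ℝ (uBar (x, t)) (gradient (fun y => φ (y, t)) x))) := by
  exact StaggeredFV.integrable_and_tendsto_divTerm hd1 Ω hΩo hΩb hΩp T hT θ hθ M hreg hsize N hN hstep ξ U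
    hU rhoBar zBar uBar hrho hz hu xc hxc φ hφ
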